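/- **Setting.** Let $d\in\{2,3\}$. For $j\in\mathbb Z^d$ let $|j|$ be the Euclidean norm, $\langle j\rangle=\sqrt{1+|j|^2}$ and, for $a\in(1,4)^d$, $|j|_a^2=\sum_i a_i j_i^2$. Fix $\kappa>0$, $\mathtt m>0$, $\tau>0$, a function $g\in C^\infty((0,\infty);\mathbb R)$ with $g(\mathtt m)=0$, $g'(\mathtt m)>0$, and a primitive $G$ of $g$ on $(0,\infty)$; put $\hbar=2\sqrt\kappa$, $p=\mathtt m g'(\mathtt m)$ and $\omega(j)=\sqrt{\kappa|j|_a^4+p|j|_a^2}$. Functions $w(x)=(2\pi)^{-d/2}\sum_{j\neq0}w_je^{\mathrm i j\cdot x}$ with zero mean on $\mathbb T^d=(\mathbb R/2\pi\mathbb Z)^d$ are identified with their coefficients; $H^s_0$ is given by $N_s(w):=\|w\|_{H^s}^2=\sum_{j\ne0}\langle j\rangle^{2s}|w_j|^2<\infty$. Let $$\mathcal K_{\mathtt m}(z)=\frac\hbar2\int_{\mathbb T^d}|D|_a^2z\cdot\bar z\,dx+\frac1\hbar\int_{\mathbb T^d}G\big(|\alpha+z|^2\big)dx,\qquad \alpha=\sqrt{\mathtt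 m-\tau\textstyle\sum_{j\ne0}|z_j|^2},$$ where $|D|_a^2$ is the Fourier multiplier with symbol $|j|_a^2$, and let $\widetilde{\mathcal K}_{\mathtt m}(w)=\mathcal K_{\mathtt m}(z)$, where $$z_j=\frac{A(j)w_j-\tfrac{p}{\hbar}\,\overline{w_{-j}}}{\sqrt{2\omega(j)A(j)}},\qquad A(j)=\omega(j)+\tfrac\hbar2|j|_a^2+\tfrac p\hbar .$$ (This change of variables puts the quadratic part of $\widetilde{\mathcal K}_{\mathtt m}$ in the form $\sum_j\omega(j)|w_j|^2$.) The Poisson bracket is $\{F,H\}=-\mathrm i\sum_{j\ne0}(\partial_{w_j}F\,\partial_{\bar w_j}H-\partial_{\bar w_j}F\,\partial_{w_j}H)$. $\mathcal L_3$ is the class of real trilinear Hamiltonians $E(w)=\sum_{\sigma,j}E_{\sigma,j}\,w_{j_1}^{\sigma_1}w_{j_2}^{\sigma_2}w_{j_3}^{\sigma_3}$, the sum being over $\sigma\in\{\pm1\}^3$ and $j\in(\mathbb Z^d\setminus\{0\})^3$ with $\sigma_1j_1+\sigma_2j_2+\sigma_3j_3=0$, with $w_j^{+}=w_j$, $w_j^-=\overline{w_j}$,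 coefficients invariant under simultaneous permutations of $\sigma$ and $j$, and $E_{-\sigma,j}=\overline{E_{\sigma,j}}$. $\mu_1(j)$ and $\mu_3(j)$ denote the largest and the smallest of $|j_1|,|j_2|,|j_3|$. For $M>0$ let $\mathfrak A_M\subset(1,4)^d$ be the set of $a$ for which there is $\gamma>0$ such that, for all $\sigma\in\{\pm1\}^3$ and all nonzero $j_1,j_2,j_3\in\mathbb Z^d$ with $\sigma_1j_1+\sigma_2j_2+\sigma_3j_3=0$ and $|j_1|_a\ge|j_2|_a\ge|j_3|_a$, $$\kappa^{-1/2}\Big|\sum_{i=1}^3\sigma_i\omega(j_i)\Big|\ \ge\ \begin{cases}\dfrac{\gamma}{|j_1|^{d-1}\log^{d+1}(1+|j_1|^2)\,|j_3|^{M}}&\text{if }\sigma_1\sigma_2=-1,\\[2mm] 1&\text{if }\sigma_1\sigma_2=1.\end{cases}$$ **Proposition.** (i) There is $M=M(d)>0$ such that, for all $\kappa>0$ and $p>0$, $\mathfrak A_M$ has full Lebesgue measure in $(1,4)^d$. (ii) For every $M>0$ there is $\tilde s_0=\tilde s_0(M,d)>0$ such that the following holds for all $\kappa,\mathtt m,\tau,g,G$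 as above, all $a\in\mathfrak A_M$ and all $s\ge\tilde s_0$. There are $C,c>0$, independent of $N$, such that for every $N>1$, with $\varepsilon_0=c\,\log^{-d-1}(1+N)$, there is $E_3\in\mathcal L_3$ satisfying: - $|(E_3)_{\sigma,j}|\le C\,N^{d-2}\log^{d+1}(1+N)\,\mu_3(j)^{M+1}\mu_1(j)^{2s}$ for all $\sigma,j$; - for every $w\in H^s_0$ with $\|w\|_{H^s}\le\varepsilon_0$, the series $E_3(w)$ converges absolutely, the bracket $\{N_s+E_3,\widetilde{\mathcal K}_{\mathtt m}\}(w)$ exists (the Wirtinger derivatives exist and the series over $j$ converges absolutely), and $$|\{N_s+E_3,\widetilde{\mathcal K}_{\mathtt m}\}(w)|\le C\big(N^{d-2}\log^{d+1}(1+N)\,\|w\|_{H^s}^4+N^{-1}\|w\|_{H^s}^3\big).$$ -/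

import Mathlib

open Real MeasureTheory
open scoped ContDiff ComplexConjugate

noncomputable section

namespace QHD

/-- The nonzero Fourier modes `ℤ^d ∖ {0}` of the torus `𝕋^d = (ℝ/2πℤ)^d`. -/
abbrev Mode (d : ℕ) : Type := {j : Fin d → ℤ // j ≠ 0}

/-- A zero-mean function on the torus, given by its Fourier coefficients:
`w(x) = (2π)^{-d/2} ∑_{j ≠ 0} w_j e^{i j·x}`. -/
abbrev Seq (d : ℕ) : Type := Mode d → ℂ

variable {d : ℕ}

/-- The mode `-j`. -/
def Mode.neg (j : Mode d) : Mode d := ⟨-j.1, neg_ne_zero.mpr j.2⟩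

/-- The Euclidean length `|j|`. -/
def Mode.len (j : Mode d) : ℝ := √(∑ i, (j.1 i : ℝ) ^ 2)

/-- The weighted squared length `|j|_a² = ∑ a_i j_i²`. -/
def Mode.lenSq (a : Fin d → ℝ) (j : Mode d) : ℝ := ∑ i, a i * (j.1 i : ℝ) ^ 2

/-! ### The Sobolev spaces `H^s_0(𝕋^d; ℂ)` -/

/-- `⟨j⟩^{2s} = (1 + |j|²)^s`. -/
def Mode.weight (s : ℝ) (j : Mode d) : ℝ := (1 + j.len ^ 2) ^ s

/-- Membership in `H^s_0(𝕋^d; ℂ)`. -/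
def MemHs (s : ℝ) (w : Seq d) : Prop := Summable fun j => j.weight s * ‖w j‖ ^ 2

/-- `N_s(w) = ‖w‖²_{H^s} = ∑ ⟨j⟩^{2s} |w_j|²` (meaningful when `MemHs s w`). -/
def sobolevEnergy (s : ℝ) (w : Seq d) : ℝ := ∑' j, j.weight s * ‖w j‖ ^ 2

/-- `‖w‖_{H^s}` (meaningful when `MemHs s w`). -/
def hsNorm (s : ℝ) (w : Seq d) : ℝ := √(sobolevEnergy s w)

/-! ### Wirtinger derivatives and the Poisson bracket -/

/-- `p = ∂F/∂w_j` and `q = ∂F/∂w̄_j` at `w`: the map `ζ ↦ F(w + ζ e_j)` is real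
differentiable at `0`, with differential `ζ ↦ p ζ + q ζ̄`. -/
def HasWirtingerDerivAt (F : Seq d → ℂ) (w : Seq d) (j : Mode d) (p q : ℂ) : Prop :=
  HasFDerivAt (𝕜 := ℝ) (fun ζ : ℂ => F (Function.update w j (w j + ζ)))
    (p • (ContinuousLinearMap.id ℝ ℂ) + q • (Complex.conjCLE : ℂ →L[ℝ] ℂ)) 0

/-- The Poisson bracket
`{F, G} = -i ∑_j (∂_{w_j} F ∂_{w̄_j} G - ∂_{w̄_j} F ∂_{w_j} G)`
exists at `w` (all the derivatives exist and the series converges unconditionally) and has the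
value `P`. -/
def HasPoissonBracketAt (F G : Seq d → ℂ) (w : Seq d) (P : ℂ) : Prop :=
  ∃ dF dFbar dG dGbar : Mode d → ℂ,
    (∀ j, HasWirtingerDerivAt F w j (dF j) (dFbar j)) ∧
    (∀ j, HasWirtingerDerivAt G w j (dG j) (dGbar j)) ∧
    HasSum (fun j => -Complex.I * (dF j * dGbar j - dFbar j * dG j)) P

/-! ### Trilinear Hamiltonians -/

/-- The momentum `σ₁ j₁ + σ₂ j₂ + σ₃ j₃`. -/
def momentum (σ : Fin 3 → ℤˣ) (j : Fin 3 → Mode d) : Fin d → ℤ :=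
  ∑ i, (σ i : ℤ) • (j i).1

/-- `w_j^σ`: it is `w_j` for `σ = +1` and the conjugate of `w_j` for `σ = -1`. -/
def signedCoeff (w : Seq d) (σ : ℤˣ) (j : Mode d) : ℂ := if σ = 1 then w j else conj (w j)

/-- The class `𝓛₃` of (real) trilinear Hamiltonians: coefficients indexed by signs and nonzero
modes, symmetric, supported on zero momentum; `reality` says that the associated function
takes real values. -/
structure TrilinearHamiltonian (d : ℕ) where
  coeff : (Fin 3 → ℤˣ) → (Fin 3 → Mode d) → ℂ
  symmetric : ∀ (ρ : Equiv.Perm (Fin 3)) (σ : Fin 3 → ℤˣ) (j : Fin 3 → Mode d),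
    coeff (σ ∘ ρ) (j ∘ ρ) = coeff σ j
  momentum_support : ∀ (σ : Fin 3 → ℤˣ) (j : Fin 3 → Mode d),
    momentum σ j ≠ 0 → coeff σ j = 0
  reality : ∀ (σ : Fin 3 → ℤˣ) (j : Fin 3 → Mode d),
    coeff (fun i => -σ i) j = conj (coeff σ j)

/-- The monomials `(E)_{σ,j} w_{j₁}^{σ₁} w_{j₂}^{σ₂} w_{j₃}^{σ₃}`. -/
def TrilinearHamiltonian.term (E : TrilinearHamiltonian d) (w : Seq d)
    (p : (Fin 3 → ℤˣ) × (Fin 3 → Mode d)) : ℂ :=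
  E.coeff p.1 p.2 * ∏ i, signedCoeff w (p.1 i) (p.2 i)

/-- `E(w)`, the sum of all the monomials. -/
def TrilinearHamiltonian.eval (E : TrilinearHamiltonian d) (w : Seq d) : ℂ :=
  ∑' p, E.term w p

/-- `μ₁(j)`, the largest of `|j₁|, |j₂|, |j₃|`. -/
def mu1 (j : Fin 3 → Mode d) : ℝ := max (j 0).len (max (j 1).len (j 2).len)

/-- `μ₃(j)`, the third largest (that is, the smallest) of `|j₁|, |j₂|, |j₃|`. -/
def mu3 (j : Fin 3 → Mode d) : ℝ := min (j 0).len (min (j 1).len (j 2).len)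

/-! ### Frequencies and non-resonant parameters

Below `κ > 0` is the capillarity constant and `p` stands for `m g'(m) > 0`. -/

/-- `ω(j) = √(κ |j|_a⁴ + p |j|_a²)`. -/
def omega (κ p : ℝ) (a : Fin d → ℝ) (j : Mode d) : ℝ :=
  √(κ * j.lenSq a ^ 2 + p * j.lenSq a)

/-- The cube `(1,4)^d`. -/
def cube (d : ℕ) : Set (Fin d → ℝ) := Set.univ.pi fun _ => Set.Ioo (1 : ℝ) 4

/-- The set `𝔄` of the `a ∈ (1,4)^d` for which the three-wave small divisors have, for some
`γ > 0`, the lower bounds with exponent `M`. -/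
def nonresonantSet (d : ℕ) (κ p M : ℝ) : Set (Fin d → ℝ) :=
  {a | a ∈ cube d ∧ ∃ γ > 0, ∀ (σ : Fin 3 → ℤˣ) (j : Fin 3 → Mode d),
    momentum σ j = 0 →
    (j 1).lenSq a ≤ (j 0).lenSq a → (j 2).lenSq a ≤ (j 1).lenSq a →
      (σ 0 * σ 1 = -1 →
        γ / ((j 0).len ^ (d - 1) * log (1 + (j 0).len ^ 2) ^ (d + 1) * (j 2).len ^ M)
          ≤ |∑ i, ((σ i : ℤ) : ℝ) * omega κ p a (j i)| / √κ) ∧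
      (σ 0 * σ 1 = 1 →
        1 ≤ |∑ i, ((σ i : ℤ) : ℝ) * omega κ p a (j i)| / √κ)}

/-! ### The Hamiltonian -/

/-- `ħ = 2 √κ`. -/
def hbar (κ : ℝ) : ℝ := 2 * √κ

/-- The function `z(x) = (2π)^{-d/2} ∑_{j ≠ 0} z_j e^{i j·x}`. -/
def toFun (z : Seq d) (x : Fin d → ℝ) : ℂ :=
  (((2 * π) ^ (-(d : ℝ) / 2) : ℝ) : ℂ) *
    ∑' j : Mode d, z j * Complex.exp (Complex.I * ((∑ i, (j.1 i : ℝ) * x i : ℝ) : ℂ))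

/-- The zero mode `α = √(m - τ ∑ |z_j|²)`; `τ` is the normalization constant that relates the
Fourier coefficients to the mass. -/
def zeroMode (m τ : ℝ) (z : Seq d) : ℝ := √(m - τ * ∑' j, ‖z j‖ ^ 2)

/-- `𝒦_m(z) = (ħ/2) ∫ |D|_a² z · z̄ dx + (1/ħ) ∫ G(|α + z|²) dx`, integrals over `[0,2π]^d`,
where the first one is written in Fourier coefficients. -/
def hamiltonianZ (κ m τ : ℝ) (G : ℝ → ℝ) (a : Fin d → ℝ) (z : Seq d) : ℝ :=
  hbar κ / 2 * ∑' j, j.lenSq a * ‖z j‖ ^ 2 +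
    1 / hbar κ * ∫ x in Set.Icc (0 : Fin d → ℝ) (fun _ => 2 * π),
      G (‖(zeroMode m τ z : ℂ) + toFun z x‖ ^ 2)

/-- `A(j) = ω(j) + (ħ/2) |j|_a² + p/ħ`. -/
def symbolA (κ p : ℝ) (a : Fin d → ℝ) (j : Mode d) : ℝ :=
  omega κ p a j + hbar κ / 2 * j.lenSq a + p / hbar κ

/-- The first component `z` of `(z, z̄) = 𝒞 (w, w̄)`, where `𝒞` is the Fourier multiplier
`(2 ω A)^{-1/2} [[A, -p/ħ], [-p/ħ, A]]` that diagonalizes the quadratic part of `𝒦_m`. The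
`j`-th Fourier coefficient of `w̄` is the conjugate of `w_{-j}`. -/
def diagonalize (κ p : ℝ) (a : Fin d → ℝ) (w : Seq d) : Seq d := fun j =>
  (((symbolA κ p a j : ℝ) : ℂ) * w j - ((p / hbar κ : ℝ) : ℂ) * conj (w j.neg)) /
    ((√(2 * omega κ p a j * symbolA κ p a j) : ℝ) : ℂ)

/-- `𝒦̃_m(w) = 𝒦_m(𝒞 w)`, with `p = m g'(m)`. -/
def hamiltonianW (κ m τ : ℝ) (g G : ℝ → ℝ) (a : Fin d → ℝ) (w : Seq d) : ℝ :=
  hamiltonianZ κ m τ G a (diagonalize κ (m * deriv g m) a w)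

end QHD

end

noncomputable section

namespace QHD

variable {d : ℕ}

/-! ### Summability over lattices -/

lemma summable_pi_prod {f : ℤ → ℝ} (hf : ∀ x, 0 ≤ f x) (hs : Summable f) (n : ℕ) :
    Summable fun k : Fin n → ℤ => ∏ i, f (k i) := by
  induction n with
  | zero => exact (hasSum_fintype _).summable
  | succ n ih =>
    rw [← (Fin.consEquiv fun _ : Fin (n + 1) => ℤ).summable_iff]
    have := hs.mul_of_nonneg ih hf (fun k => Finset.prod_nonneg fun i _ => hf _)
    refine this.congr fun x => ?_
    simp [Fin.prod_univ_succ, Fin.consEquiv]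

lemma summable_bertrand_nat {q : ℝ} (hq : 1 < q) :
    Summable fun n : ℕ => ((1 + (n : ℝ)) * log (2 + n) ^ q)⁻¹ := by
  have hlog : ∀ n : ℕ, 0 < log (2 + (n : ℝ)) := fun n => log_pos (by
    have : (0 : ℝ) ≤ n := n.cast_nonneg
    linarith)
  rw [← summable_condensed_iff_of_nonneg]
  · have h1 : Summable fun k : ℕ => (log 2 ^ q)⁻¹ * (((k : ℝ) ^ q)⁻¹) :=
      (Real.summable_nat_rpow_inv.2 hq).mul_left _
    rw [← summable_nat_add_iff 1] at h1 ⊢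
    refine Summable.of_nonneg_of_le (fun k => ?_) (fun k => ?_) h1
    · have := hlog (2 ^ (k + 1)); positivity
    · have h2 : (0 : ℝ) < 2 ^ (k + 1) := by positivity
      have h3 : log 2 * ((k + 1 : ℕ) : ℝ) ≤ log (2 + ((2 ^ (k + 1) : ℕ) : ℝ)) := by
        rw [mul_comm, ← log_pow]
        apply log_le_log (by positivity)
        push_cast; linarith
      have h4 : 0 < log 2 := log_pos (by norm_num)
      rw [← mul_inv, ← mul_rpow h4.le (by positivity), mul_inv, ← mul_assoc]
      have h5 : (2 : ℝ) ^ (k + 1) * (1 + ((2 ^ (k + 1) : ℕ) : ℝ))⁻¹ ≤ 1 := by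
        rw [← div_eq_mul_inv, div_le_one (by positivity)]; push_cast; linarith
      calc _ ≤ 1 * (log (2 + ((2 ^ (k + 1) : ℕ) : ℝ)) ^ q)⁻¹ := by
            have := hlog (2 ^ (k + 1)); gcongr
        _ ≤ _ := by rw [one_mul]; gcongr
  · intro n; have := hlog n; positivity
  · intro m n _ hmn
    have := hlog m
    gcongr

lemma summable_bertrand_int {q : ℝ} (hq : 1 < q) :
    Summable fun x : ℤ => ((1 + |(x : ℝ)|) * log (2 + |(x : ℝ)|) ^ q)⁻¹ := by
  apply Summable.of_nat_of_neg <;> simpa using summable_bertrand_nat hq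

lemma summable_inv_one_add_sq : Summable fun x : ℤ => (1 + (x : ℝ) ^ 2)⁻¹ := by
  have h : Summable fun n : ℕ => (1 + (n : ℝ) ^ 2)⁻¹ := by
    rw [← summable_nat_add_iff 1]
    have h1 := (summable_nat_add_iff 1).2 (Real.summable_nat_pow_inv.2 (le_refl 2))
    refine Summable.of_nonneg_of_le (fun k => by positivity) (fun k => ?_) h1
    gcongr; linarith
  apply Summable.of_nat_of_neg <;> simpa using h

/-! ### Elementary facts on modes -/

lemma Mode.len_sq (j : Mode d) : j.len ^ 2 = ∑ i, (j.1 i : ℝ) ^ 2 :=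
  Real.sq_sqrt (Finset.sum_nonneg fun _ _ => sq_nonneg _)

lemma Mode.len_nonneg (j : Mode d) : 0 ≤ j.len := Real.sqrt_nonneg _

lemma Mode.exists_ne (j : Mode d) : ∃ i, j.1 i ≠ 0 := by
  by_contra! h
  exact j.2 (funext h)

lemma Mode.abs_le_len (j : Mode d) (i : Fin d) : |(j.1 i : ℝ)| ≤ j.len := by
  apply Real.abs_le_sqrt
  exact Finset.single_le_sum (f := fun i => (j.1 i : ℝ) ^ 2) (fun i _ => sq_nonneg _)
    (Finset.mem_univ i)

lemma Mode.one_le_len (j : Mode d) : 1 ≤ j.len := by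
  obtain ⟨i, hi⟩ := j.exists_ne
  refine le_trans ?_ (j.abs_le_len i)
  exact_mod_cast Int.one_le_abs hi

lemma Mode.len_pos (j : Mode d) : 0 < j.len := one_pos.trans_le j.one_le_len

lemma Mode.log_pos (j : Mode d) : 0 < log (1 + j.len ^ 2) :=
  Real.log_pos (by have := j.len_pos; nlinarith)

lemma summable_mode_len :
    Summable fun j : Mode d => (j.len ^ (2 * d))⁻¹ := by
  have h1 := (summable_pi_prod (fun x => by positivity) summable_inv_one_add_sq d).mul_left
    ((2 : ℝ) ^ d)
  refine Summable.of_nonneg_of_le (fun j => by have := j.len_pos; positivity) (fun j => ?_)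
    (h1.comp_injective (Subtype.val_injective (p := fun j : Fin d → ℤ => j ≠ 0)))
  have := j.one_le_len
  simp only [Function.comp]
  rw [Finset.prod_inv_distrib, ← div_eq_mul_inv, inv_eq_one_div, div_le_div_iff₀
    (by positivity) (Finset.prod_pos fun i _ => by positivity), one_mul, pow_mul, ← mul_pow]
  calc ∏ i, (1 + (j.1 i : ℝ) ^ 2) ≤ ∏ i : Fin d, (2 * j.len ^ 2) := by
        refine Finset.prod_le_prod (fun i _ => by positivity) fun i _ => ?_
        have h2 := j.abs_le_len i
        have h3 : (j.1 i : ℝ) ^ 2 ≤ j.len ^ 2 := by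
          rw [← sq_abs]; gcongr
        nlinarith
    _ = _ := by simp

lemma summable_mode_bertrand (i : Fin d) :
    Summable fun j : Mode d =>
      ((1 + |(j.1 i : ℝ)|) * (j.len ^ (d - 1) * log (1 + j.len ^ 2) ^ (d + 1)))⁻¹ := by
  have hd : 0 < d := i.pos
  have hq : (1 : ℝ) < 1 + 1 / d := by
    have : (0 : ℝ) < 1 / d := by positivity
    linarith
  have hl : ∀ x : ℝ, 0 < log (2 + |x|) := fun x => Real.log_pos (by
    have := abs_nonneg x; linarith)
  have h1 := (summable_pi_prod (fun x : ℤ => by have := hl x; positivity)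
    (summable_bertrand_int hq) d).mul_left ((2 : ℝ) ^ (d - 1) * 2 ^ (d + 1))
  refine Summable.of_nonneg_of_le (fun j => by have := j.len_pos; have := j.log_pos; positivity)
    (fun j => ?_)
    (h1.comp_injective (Subtype.val_injective (p := fun j : Fin d → ℤ => j ≠ 0)))
  have hj := j.one_le_len
  have hlp := j.log_pos
  simp only [Function.comp]
  have hpos : 0 < ∏ l, ((1 + |(j.1 l : ℝ)|) * log (2 + |(j.1 l : ℝ)|) ^ ((1 : ℝ) + 1 / d)) :=
    Finset.prod_pos fun l _ => by have := hl (j.1 l); positivity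
  rw [Finset.prod_inv_distrib, ← div_eq_mul_inv, inv_eq_one_div, div_le_div_iff₀
    (by positivity) hpos, one_mul, Finset.prod_mul_distrib]
  have e1 : ∏ l, (1 + |(j.1 l : ℝ)|) ≤ (1 + |(j.1 i : ℝ)|) * (2 * j.len) ^ (d - 1) := by
    rw [← Finset.mul_prod_erase _ _ (Finset.mem_univ i)]
    gcongr
    calc _ ≤ ∏ l ∈ Finset.univ.erase i, (2 * j.len) := by
          refine Finset.prod_le_prod (fun l _ => by positivity) fun l _ => ?_
          have := j.abs_le_len l; linarith
      _ = _ := by simp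
  have e2 : ∏ l, log (2 + |(j.1 l : ℝ)|) ^ ((1 : ℝ) + 1 / d)
      ≤ (2 * log (1 + j.len ^ 2)) ^ (d + 1) := by
    calc _ ≤ ∏ l : Fin d, (2 * log (1 + j.len ^ 2)) ^ ((1 : ℝ) + 1 / d) := by
          refine Finset.prod_le_prod (fun l _ => by have := hl (j.1 l); positivity) fun l _ => ?_
          have := hl (j.1 l)
          apply rpow_le_rpow this.le _ (by positivity)
          have h3 : (2 : ℝ) * log (1 + j.len ^ 2) = log ((1 + j.len ^ 2) ^ 2) := by
            rw [log_pow]; norm_num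
          rw [h3]
          apply log_le_log (by positivity)
          have := j.abs_le_len l
          nlinarith
      _ = _ := by
          have hb : 0 ≤ 2 * log (1 + j.len ^ 2) := by linarith
          rw [Finset.prod_const, Finset.card_univ, Fintype.card_fin, ← rpow_mul_natCast hb,
            ← rpow_natCast _ (d + 1)]
          congr 1
          have : (d : ℝ) ≠ 0 := by positivity
          push_cast; field_simp
  calc _ ≤ ((1 + |(j.1 i : ℝ)|) * (2 * j.len) ^ (d - 1)) * (2 * log (1 + j.len ^ 2)) ^ (d + 1) := by
        apply mul_le_mul e1 e2 _ (by positivity)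
        exact Finset.prod_nonneg fun l _ => by have := hl (j.1 l); positivity
    _ = _ := by rw [mul_pow, mul_pow]; ring

/-! ### Measure estimates along one-parameter families of maps -/

lemma volume_le_of_fibers {S B A : Set (Fin d → ℝ)} (hS : MeasurableSet S) (hB : MeasurableSet B)
    (hA : MeasurableSet A)
    {T : ℝ → (Fin d → ℝ) → (Fin d → ℝ)} (hT : Measurable fun q : ℝ × (Fin d → ℝ) => T q.1 q.2)
    {c r : ENNReal} (h : ∀ t ∈ Set.Icc (1 : ℝ) 2, volume S ≤ c * volume (T t ⁻¹' S ∩ B))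
    (hfib : ∀ a ∈ B, a ∈ A → volume {t ∈ Set.Icc (1 : ℝ) 2 | T t a ∈ S} ≤ r)
    (hfib' : ∀ a ∈ B, a ∉ A → {t ∈ Set.Icc (1 : ℝ) 2 | T t a ∈ S} = ∅) :
    volume S ≤ c * (r * volume (A ∩ B)) := by
  set U : Set (ℝ × (Fin d → ℝ)) := {q | q.1 ∈ Set.Icc (1 : ℝ) 2 ∧ q.2 ∈ B ∧ T q.1 q.2 ∈ S}
  have hU : MeasurableSet U :=
    (measurable_fst measurableSet_Icc).inter ((measurable_snd hB).inter (hT hS))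
  have h1 : ((volume : Measure ℝ).prod (volume : Measure (Fin d → ℝ))) U
      = ∫⁻ t in Set.Icc (1 : ℝ) 2, volume (T t ⁻¹' S ∩ B) := by
    rw [Measure.prod_apply hU, ← lintegral_indicator measurableSet_Icc]
    congr 1; ext t
    by_cases ht : t ∈ Set.Icc (1 : ℝ) 2
    · rw [Set.indicator_of_mem ht]
      congr 1; ext a
      simp only [U, Set.mem_preimage, Set.mem_ofPred_eq, Set.mem_inter_iff]
      tauto
    · rw [Set.indicator_of_notMem ht]
      convert measure_empty (μ := (volume : Measure (Fin d → ℝ)))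
      ext a
      simp only [U, Set.mem_preimage, Set.mem_ofPred_eq, Set.mem_empty_iff_false]
      tauto
  have h2 : ((volume : Measure ℝ).prod (volume : Measure (Fin d → ℝ))) U
      ≤ r * volume (A ∩ B) := by
    rw [Measure.prod_apply_symm hU, ← lintegral_indicator_const (hA.inter hB)]
    apply lintegral_mono
    intro a
    by_cases ha : a ∈ B
    · have e : (fun t : ℝ => (t, a)) ⁻¹' U = {t ∈ Set.Icc (1 : ℝ) 2 | T t a ∈ S} := by
        ext t; simp only [U, Set.mem_preimage, Set.mem_ofPred_eq]; tauto
      by_cases hA' : a ∈ A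
      · rw [Set.indicator_of_mem (show a ∈ A ∩ B from ⟨hA', ha⟩)]
        simp only [e]; exact hfib a ha hA'
      · simp only [e, hfib' a ha hA', measure_empty, zero_le]
    · have : (fun t : ℝ => (t, a)) ⁻¹' U = ∅ := by
        ext t; simp only [U, Set.mem_preimage, Set.mem_ofPred_eq, Set.mem_empty_iff_false]; tauto
      simp only [this, measure_empty, zero_le]
  calc volume S = ∫⁻ _ in Set.Icc (1 : ℝ) 2, volume S := by
        rw [lintegral_const]; simp; norm_num
    _ ≤ ∫⁻ t in Set.Icc (1 : ℝ) 2, c * volume (T t ⁻¹' S ∩ B) :=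
        setLIntegral_mono' measurableSet_Icc h
    _ = c * ∫⁻ t in Set.Icc (1 : ℝ) 2, volume (T t ⁻¹' S ∩ B) := by
        rw [lintegral_const_mul]
        have := measurable_measure_prodMk_left (ν := (volume : Measure (Fin d → ℝ)))
          ((hT hS).inter (measurable_snd hB))
        exact this
    _ ≤ _ := by rw [← h1]; gcongr

lemma volume_le_of_dist_le {s : Set ℝ} {r : ℝ} (h : ∀ x ∈ s, ∀ y ∈ s, |x - y| ≤ r) :
    volume s ≤ ENNReal.ofReal r := by
  refine (Real.volume_le_diam s).trans (Metric.ediam_le fun x hx y hy => ?_)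
  rw [edist_dist]
  exact ENNReal.ofReal_le_ofReal (by simpa [Real.dist_eq] using h x hx y hy)

/-- A set in the cube is estimated by its traces on rays. -/
lemma volume_le_radial {S A : Set (Fin d → ℝ)} (hS : MeasurableSet S) (hA : MeasurableSet A)
    (hSc : S ⊆ cube d) {r : ENNReal}
    (hfib : ∀ a ∈ Set.univ.pi (fun _ : Fin d => Set.Ioo (1 / 2 : ℝ) 4), a ∈ A →
      volume {t ∈ Set.Icc (1 : ℝ) 2 | t • a ∈ S} ≤ r)
    (hfib' : ∀ a ∈ Set.univ.pi (fun _ : Fin d => Set.Ioo (1 / 2 : ℝ) 4), a ∉ A →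
      {t ∈ Set.Icc (1 : ℝ) 2 | t • a ∈ S} = ∅) :
    volume S ≤ 2 ^ d * (r * volume (A ∩ Set.univ.pi (fun _ : Fin d => Set.Ioo (1 / 2 : ℝ) 4))) := by
  refine volume_le_of_fibers (T := fun t a => t • a) hS
    (MeasurableSet.univ_pi fun _ => measurableSet_Ioo) hA
    (measurable_fst.smul measurable_snd) (fun t ht => ?_) hfib hfib'
  have ht0 : (0 : ℝ) < t := by linarith [ht.1]
  have e : (fun a : Fin d → ℝ => t • a) ⁻¹' S ∩ Set.univ.pi (fun _ : Fin d => Set.Ioo (1 / 2 : ℝ) 4)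
      = (fun a : Fin d → ℝ => t • a) ⁻¹' S := by
    apply Set.inter_eq_left.2
    intro a ha i _
    have h1 := hSc ha i (Set.mem_univ i)
    simp only [Pi.smul_apply, smul_eq_mul, Set.mem_Ioo] at h1
    have h2 : 0 < a i := by
      by_contra! h; nlinarith
    constructor <;> nlinarith [ht.1, ht.2]
  rw [e, Measure.addHaar_preimage_smul _ ht0.ne', ← mul_assoc]
  have h2 : (1 : ENNReal) ≤ 2 ^ d * ENNReal.ofReal |(t ^ Module.finrank ℝ (Fin d → ℝ))⁻¹| := by
    rw [Module.finrank_fin_fun, abs_of_pos (by positivity)]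
    have : (2 : ENNReal) ^ d = ENNReal.ofReal (2 ^ d) := by
      rw [ENNReal.ofReal_pow (by norm_num)]; norm_num
    rw [this, ← ENNReal.ofReal_mul (by positivity), ← ENNReal.ofReal_one]
    apply ENNReal.ofReal_le_ofReal
    rw [← div_eq_mul_inv, le_div_iff₀ (by positivity), one_mul]
    exact pow_le_pow_left₀ ht0.le ht.2 d
  calc volume S = 1 * volume S := (one_mul _).symm
    _ ≤ _ := by gcongr

lemma volume_slab_le (w : Fin d → ℝ) (i : Fin d) (hw : w i ≠ 0) {δ : ℝ} (hδ : 0 ≤ δ) :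
    volume ({a | |∑ l, a l * w l| ≤ δ} ∩ Set.univ.pi (fun _ : Fin d => Set.Ioo (1 / 2 : ℝ) 4))
      ≤ ENNReal.ofReal (6 ^ d * (2 * δ / |w i|)) := by
  set S := {a : Fin d → ℝ | |∑ l, a l * w l| ≤ δ} ∩
    Set.univ.pi (fun _ : Fin d => Set.Ioo (1 / 2 : ℝ) 4)
  set B : Set (Fin d → ℝ) := Set.univ.pi (fun _ : Fin d => Set.Ioo (-2 : ℝ) 4)
  have hS : MeasurableSet S := by
    apply MeasurableSet.inter _ (MeasurableSet.univ_pi fun _ => measurableSet_Ioo)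
    exact measurableSet_le (by fun_prop) measurable_const
  have key := volume_le_of_fibers (S := S) (B := B) (A := Set.univ)
    (T := fun t a => a + t • Pi.single i 1) hS
    (MeasurableSet.univ_pi fun _ => measurableSet_Ioo) MeasurableSet.univ (by fun_prop)
    (c := 1) (r := ENNReal.ofReal (2 * δ / |w i|)) ?_ ?_ ?_
  · refine key.trans (le_of_eq ?_)
    rw [Set.univ_inter, one_mul, mul_comm (6 ^ d : ℝ), ENNReal.ofReal_mul (by positivity)]
    congr 1
    simp only [B, volume_pi_pi, Real.volume_Ioo]
    norm_num
  · intro t ht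
    rw [one_mul]
    have e : (fun a : Fin d → ℝ => a + t • Pi.single i 1) ⁻¹' S ∩ B
        = (fun a : Fin d → ℝ => a + t • Pi.single i 1) ⁻¹' S := by
      apply Set.inter_eq_left.2
      intro a ha l _
      have h1 := ha.2 l (Set.mem_univ l)
      simp only [Pi.add_apply, Pi.smul_apply, smul_eq_mul, Set.mem_Ioo, Pi.single_apply] at h1
      split_ifs at h1 <;> constructor <;> linarith [ht.1, ht.2]
    rw [e, measure_preimage_add_right]
  · intro a _ _
    apply volume_le_of_dist_le
    rintro x ⟨_, hx, _⟩ y ⟨_, hy, _⟩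
    simp only [Set.mem_ofPred_eq, Pi.add_apply, Pi.smul_apply, smul_eq_mul, Pi.single_apply,
      add_mul, Finset.sum_add_distrib, mul_ite, mul_one, mul_zero, ite_mul, zero_mul,
      Finset.sum_ite_eq', Finset.mem_univ, if_true] at hx hy
    rw [le_div_iff₀ (abs_pos.2 hw), ← abs_mul]
    rw [abs_le] at hx hy ⊢
    constructor <;> linarith
  · intro a _ h; exact absurd (Set.mem_univ a) h

/-! ### The dispersion relation -/

/-- The dispersion relation as a function of the weighted squared length. -/
def dispersion (κ p L : ℝ) : ℝ := √(κ * L ^ 2 + p * L)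

/-- `∑ a_i v_i²` for an arbitrary lattice vector. -/
def latticeSq (a : Fin d → ℝ) (v : Fin d → ℤ) : ℝ := ∑ i, a i * (v i : ℝ) ^ 2

lemma lenSq_eq (a : Fin d → ℝ) (j : Mode d) : j.lenSq a = latticeSq a j.1 := rfl

lemma omega_eq (κ p : ℝ) (a : Fin d → ℝ) (j : Mode d) :
    omega κ p a j = dispersion κ p (latticeSq a j.1) := rfl

lemma sqrt_mul_le_dispersion {κ p L : ℝ} (hκ : 0 ≤ κ) (hp : 0 ≤ p) (hL : 0 ≤ L) :
    √κ * L ≤ dispersion κ p L := by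
  apply Real.le_sqrt_of_sq_le
  rw [mul_pow, Real.sq_sqrt hκ]
  nlinarith [mul_nonneg hp hL]

lemma dispersion_mono {κ p L L' : ℝ} (hκ : 0 ≤ κ) (hp : 0 ≤ p) (hL : 0 ≤ L) (h : L ≤ L') :
    dispersion κ p L ≤ dispersion κ p L' := by
  unfold dispersion; gcongr

lemma dispersion_le {κ p L : ℝ} (hκ : 0 ≤ κ) (hp : 0 ≤ p) (hL : 1 ≤ L) :
    dispersion κ p L ≤ √(κ + p) * L := by
  apply Real.sqrt_le_iff.2 ⟨by positivity, ?_⟩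
  rw [mul_pow, Real.sq_sqrt (by positivity)]
  nlinarith [mul_nonneg hp (by linarith : (0 : ℝ) ≤ L), mul_nonneg hp (sub_nonneg.2 hL)]

/-- The dispersion relation grows at least as fast as its leading part. -/
lemma sqrt_mul_sub_le_dispersion_sub {κ p L L' : ℝ} (hκ : 0 < κ) (hp : 0 ≤ p) (hL : 0 < L)
    (h : L ≤ L') : √κ * (L' - L) ≤ dispersion κ p L' - dispersion κ p L := by
  have hD := sqrt_mul_le_dispersion hκ.le hp hL.le
  have hs := Real.sqrt_pos.2 hκ
  have e : √κ * (L' - L) + dispersion κ p L ≤ dispersion κ p L' := by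
    apply Real.le_sqrt_of_sq_le
    have h1 : dispersion κ p L ^ 2 = κ * L ^ 2 + p * L := Real.sq_sqrt (by positivity)
    have h2 : √κ ^ 2 = κ := Real.sq_sqrt hκ.le
    have h3 : dispersion κ p L ≤ √κ * L + p / (2 * √κ) := by
      apply Real.sqrt_le_iff.2 ⟨by positivity, ?_⟩
      have : (√κ * L + p / (2 * √κ)) ^ 2 = √κ ^ 2 * L ^ 2 + p * L + (p / (2 * √κ)) ^ 2 := by
        field_simp; ring
      rw [this, h2]; nlinarith [sq_nonneg (p / (2 * √κ))]
    have h4 : √κ * (L' - L) * dispersion κ p L ≤ √κ * (L' - L) * (√κ * L + p / (2 * √κ)) :=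
      mul_le_mul_of_nonneg_left h3 (mul_nonneg hs.le (sub_nonneg.2 h))
    have h5 : √κ * (L' - L) * (√κ * L + p / (2 * √κ))
        = √κ ^ 2 * (L' - L) * L + p / 2 * (L' - L) := by field_simp
    rw [h5, h2] at h4
    have h6 : (√κ * (L' - L) + dispersion κ p L) ^ 2
        = √κ ^ 2 * (L' - L) ^ 2 + dispersion κ p L ^ 2
          + 2 * (√κ * (L' - L) * dispersion κ p L) := by ring
    rw [h6, h1, h2]
    nlinarith
  linarith

/-- The three-wave divisor is transversal to rays. -/
lemma exists_radial_bound {κ p : ℝ} (hκ : 0 < κ) (hp : 0 < p) :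
    ∃ c > 0, ∃ R > 0, ∀ L₀ L₁ L₂ t₁ t₂ : ℝ, t₁ ∈ Set.Icc (1 : ℝ) 2 → t₂ ∈ Set.Icc (1 : ℝ) 2 →
      1 / 2 ≤ L₂ → L₂ ≤ L₁ → L₁ ≤ L₀ → R ≤ L₁ →
      c * |t₁ - t₂| ≤
        |(dispersion κ p (t₁ * L₀) - dispersion κ p (t₁ * L₁) - dispersion κ p (t₁ * L₂)) / t₁ -
          (dispersion κ p (t₂ * L₀) - dispersion κ p (t₂ * L₁) - dispersion κ p (t₂ * L₂)) / t₂|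
    := by
  have hs := Real.sqrt_pos.2 hκ
  have hs2 : √κ < √(κ + 2 * p) := Real.sqrt_lt_sqrt hκ.le (by linarith)
  set e : ℝ := 1 / (4 * √(κ + 2 * p))
  have he : 0 < e := by positivity
  have he2 : e < 1 / (2 * √κ) := by
    apply one_div_lt_one_div_of_lt (by positivity); linarith
  set y : ℝ := 1 / (2 * (1 / (2 * √κ) - e))
  have hy0 : 0 < 1 / (2 * √κ) - e := by linarith
  have hy : √κ < y := by
    rw [lt_div_iff₀ (by positivity)]
    have : √κ * (2 * (1 / (2 * √κ) - e)) = 1 - 2 * e * √κ := by field_simp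
    rw [this]; nlinarith [mul_pos he hs]
  have hy2 : κ < y ^ 2 := by
    rw [← Real.sq_sqrt hκ.le]; gcongr
  refine ⟨p / 4 * e, by positivity, p / (y ^ 2 - κ), div_pos hp (by linarith), ?_⟩
  intro L₀ L₁ L₂ t₁ t₂ ht₁ ht₂ h2 h21 h10 hR
  have t1p : 0 < t₁ := by linarith [ht₁.1]
  have t2p : 0 < t₂ := by linarith [ht₂.1]
  have hdiv : ∀ t L : ℝ, 0 < t → dispersion κ p (t * L) / t = √(κ * L ^ 2 + p * L * t⁻¹) := by
    intro t L ht
    have : κ * (t * L) ^ 2 + p * (t * L) = t ^ 2 * (κ * L ^ 2 + p * L * t⁻¹) := by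
      field_simp
    rw [dispersion, this, Real.sqrt_mul (by positivity), Real.sqrt_sq ht.le]
    field_simp
  set D : ℝ → ℝ := fun L => L / (√(κ * L ^ 2 + p * L * t₁⁻¹) + √(κ * L ^ 2 + p * L * t₂⁻¹))
  have hdiff : ∀ L : ℝ, 0 < L → dispersion κ p (t₁ * L) / t₁ - dispersion κ p (t₂ * L) / t₂
      = p * (t₁⁻¹ - t₂⁻¹) * D L := by
    intro L hL
    rw [hdiv _ _ t1p, hdiv _ _ t2p]
    have q1 : 0 < √(κ * L ^ 2 + p * L * t₁⁻¹) := Real.sqrt_pos.2 (by positivity)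
    have q2 : 0 < √(κ * L ^ 2 + p * L * t₂⁻¹) := Real.sqrt_pos.2 (by positivity)
    have r1 : √(κ * L ^ 2 + p * L * t₁⁻¹) ^ 2 = κ * L ^ 2 + p * L * t₁⁻¹ :=
      Real.sq_sqrt (by positivity)
    have r2 : √(κ * L ^ 2 + p * L * t₂⁻¹) ^ 2 = κ * L ^ 2 + p * L * t₂⁻¹ :=
      Real.sq_sqrt (by positivity)
    simp only [D]
    rw [← mul_div_assoc, eq_div_iff (by positivity)]
    linear_combination r1 - r2
  have hupper : ∀ L : ℝ, 0 < L → D L ≤ 1 / (2 * √κ) := by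
    intro L hL
    have q : ∀ t : ℝ, 0 < t → √κ * L ≤ √(κ * L ^ 2 + p * L * t⁻¹) := by
      intro t ht
      apply Real.le_sqrt_of_sq_le
      rw [mul_pow, Real.sq_sqrt hκ.le]
      have : 0 < p * L * t⁻¹ := by positivity
      linarith
    have := q _ t1p; have := q _ t2p
    simp only [D]
    rw [div_le_div_iff₀ (by positivity) (by positivity)]
    linarith
  have hlower : ∀ L b : ℝ, 0 < L → 0 < b → κ * L ^ 2 + p * L ≤ (b * L) ^ 2 → 1 / (2 * b) ≤ D L := by
    intro L b hL hb h
    have q : ∀ t : ℝ, 1 ≤ t → √(κ * L ^ 2 + p * L * t⁻¹) ≤ b * L := by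
      intro t ht
      apply Real.sqrt_le_iff.2 ⟨by positivity, ?_⟩
      have h1 : t⁻¹ ≤ 1 := inv_le_one_of_one_le₀ ht
      have : p * L * t⁻¹ ≤ p * L * 1 := by gcongr
      linarith
    have := q _ ht₁.1; have := q _ ht₂.1
    have q1 : 0 < √(κ * L ^ 2 + p * L * t₁⁻¹) := Real.sqrt_pos.2 (by positivity)
    simp only [D]
    rw [div_le_div_iff₀ (by positivity) (by positivity)]
    linarith
  have L2p : 0 < L₂ := by linarith
  have L1p : 0 < L₁ := by linarith
  have L0p : 0 < L₀ := by linarith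
  have b0 := hupper L₀ L0p
  have b1 : 1 / (2 * y) ≤ D L₁ := by
    apply hlower _ _ L1p (by positivity)
    rw [div_le_iff₀ (by linarith)] at hR
    nlinarith
  have b2 : 2 * e ≤ D L₂ := by
    have : 2 * e = 1 / (2 * √(κ + 2 * p)) := by simp only [e]; field_simp; norm_num
    rw [this]
    apply hlower _ _ L2p (by positivity)
    rw [mul_pow, Real.sq_sqrt (by positivity)]
    nlinarith [mul_pos hp L2p]
  have b1' : 1 / (2 * y) = 1 / (2 * √κ) - e := by
    simp only [y]; field_simp
  have hsum : e ≤ D L₁ + D L₂ - D L₀ := by linarith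
  have main : (dispersion κ p (t₁ * L₀) - dispersion κ p (t₁ * L₁) - dispersion κ p (t₁ * L₂)) / t₁ -
          (dispersion κ p (t₂ * L₀) - dispersion κ p (t₂ * L₁) - dispersion κ p (t₂ * L₂)) / t₂
      = p * ((t₁ - t₂) / (t₁ * t₂)) * (D L₁ + D L₂ - D L₀) := by
    have e1 : t₁⁻¹ - t₂⁻¹ = - ((t₁ - t₂) / (t₁ * t₂)) := by field_simp; ring
    have f0 := hdiff L₀ L0p
    have f1 := hdiff L₁ L1p
    have f2 := hdiff L₂ L2p
    rw [e1] at f0 f1 f2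
    linear_combination f0 - f1 - f2
  rw [main, abs_mul, abs_mul, abs_of_pos hp, abs_div, abs_of_pos (mul_pos t1p t2p),
    abs_of_pos (he.trans_le hsum)]
  have h4 : |t₁ - t₂| / 4 ≤ |t₁ - t₂| / (t₁ * t₂) := by
    gcongr
    nlinarith [ht₁.1, ht₁.2, ht₂.1, ht₂.2]
  calc p / 4 * e * |t₁ - t₂| = p * (|t₁ - t₂| / 4) * e := by ring
    _ ≤ _ := by gcongr

lemma finite_quadratic_zeros {A B C : ℝ} (h : ¬(A = 0 ∧ C = 0)) :
    {t : ℝ | A * t ^ 2 + B * t + C = 0}.Finite := by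
  have hP0 : Polynomial.C A * Polynomial.X ^ 2 + Polynomial.C B * Polynomial.X
      + Polynomial.C C ≠ 0 := by
    intro h'
    apply h
    have c2 := congrArg (fun P => Polynomial.coeff P 2) h'
    have c0 := congrArg (fun P => Polynomial.coeff P 0) h'
    simp [Polynomial.coeff_X, Polynomial.coeff_C] at c2 c0
    exact ⟨c2, c0⟩
  refine (Polynomial.finite_setOfPred_isRoot hP0).subset fun t ht => ?_
  simpa [Polynomial.IsRoot] using ht

/-- On a ray, the three-wave divisor has finitely many zeros. -/
lemma finite_radial_zeros {κ p L₀ L₁ L₂ : ℝ} (hκ : 0 < κ) (hp : 0 < p) (h0 : 0 < L₀)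
    (h1 : 0 < L₁) (h2 : 0 < L₂) :
    {t : ℝ | 0 < t ∧ dispersion κ p (t * L₀) - dispersion κ p (t * L₁)
      - dispersion κ p (t * L₂) = 0}.Finite := by
  have hne : ¬(κ ^ 2 * ((L₀ ^ 2 - L₁ ^ 2 - L₂ ^ 2) ^ 2 - 4 * L₁ ^ 2 * L₂ ^ 2) = 0 ∧
      p ^ 2 * ((L₀ - L₁ - L₂) ^ 2 - 4 * L₁ * L₂) = 0) := by
    rintro ⟨c2, c0⟩
    replace c2 := (mul_eq_zero.1 c2).resolve_left (by positivity)
    replace c0 := (mul_eq_zero.1 c0).resolve_left (by positivity)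
    have f : (L₀ ^ 2 - L₁ ^ 2 - L₂ ^ 2) ^ 2 - 4 * L₁ ^ 2 * L₂ ^ 2
        = (L₀ - L₁ - L₂) * ((L₀ + L₁ + L₂) * (L₀ - L₁ + L₂) * (L₀ + L₁ - L₂)) := by ring
    have hLL := mul_pos h1 h2
    have g0 : (L₀ - L₁ - L₂) ^ 2 = 4 * (L₁ * L₂) := by linarith
    have gne : L₀ - L₁ - L₂ ≠ 0 := by
      intro h; rw [h] at g0; nlinarith
    rw [f] at c2
    simp only [mul_eq_zero, gne, false_or] at c2
    rcases c2 with (h | h) | h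
    · nlinarith
    · have e : L₀ - L₁ - L₂ = -2 * L₂ := by linarith
      rw [e] at g0; nlinarith
    · have e : L₀ - L₁ - L₂ = -2 * L₁ := by linarith
      rw [e] at g0; nlinarith
  refine (finite_quadratic_zeros (B := 2 * κ * p * ((L₀ ^ 2 - L₁ ^ 2 - L₂ ^ 2) * (L₀ - L₁ - L₂)
      - 2 * L₁ * L₂ * (L₁ + L₂))) hne).subset ?_
  rintro t ⟨ht, h⟩
  have hsq : ∀ L : ℝ, 0 < L → dispersion κ p (t * L) ^ 2 = κ * (t * L) ^ 2 + p * (t * L) :=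
    fun L hL => Real.sq_sqrt (by positivity)
  have s0 := hsq _ h0
  have s1 := hsq _ h1
  have s2 := hsq _ h2
  have e0 : dispersion κ p (t * L₀) = dispersion κ p (t * L₁) + dispersion κ p (t * L₂) := by
    linarith
  have e1 : (dispersion κ p (t * L₀) ^ 2 - dispersion κ p (t * L₁) ^ 2
      - dispersion κ p (t * L₂) ^ 2) ^ 2
      = 4 * (dispersion κ p (t * L₁) ^ 2 * dispersion κ p (t * L₂) ^ 2) := by
    rw [e0]; ring
  rw [s0, s1, s2] at e1
  have ht2 : t ^ 2 ≠ 0 := by positivity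
  refine (mul_eq_zero.1 (?_ : t ^ 2 * _ = 0)).resolve_left ht2
  linear_combination e1

/-! ### Non-resonance for almost every parameter -/

lemma latticeSq_smul (t : ℝ) (a : Fin d → ℝ) (v : Fin d → ℤ) :
    latticeSq (t • a) v = t * latticeSq a v := by
  simp [latticeSq, Finset.mul_sum, mul_assoc]

lemma le_latticeSq {a : Fin d → ℝ} {b : ℝ} (ha : ∀ i, b ≤ a i) (v : Fin d → ℤ) :
    b * ∑ i, (v i : ℝ) ^ 2 ≤ latticeSq a v := by
  rw [Finset.mul_sum]
  exact Finset.sum_le_sum fun i _ => mul_le_mul_of_nonneg_right (ha i) (sq_nonneg _)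

lemma latticeSq_le {a : Fin d → ℝ} {b : ℝ} (ha : ∀ i, a i ≤ b) (v : Fin d → ℤ) :
    latticeSq a v ≤ b * ∑ i, (v i : ℝ) ^ 2 := by
  rw [Finset.mul_sum]
  exact Finset.sum_le_sum fun i _ => mul_le_mul_of_nonneg_right (ha i) (sq_nonneg _)

lemma continuous_latticeSq (v : Fin d → ℤ) : Continuous fun a : Fin d → ℝ => latticeSq a v := by
  unfold latticeSq; fun_prop

lemma continuous_dispersion (κ p : ℝ) : Continuous (dispersion κ p) := by
  unfold dispersion; fun_prop

/-- The three-wave divisor of the interaction `j → (j - k) + k`. -/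
def divisor (κ p : ℝ) (j k : Mode d) (a : Fin d → ℝ) : ℝ :=
  dispersion κ p (latticeSq a j.1) - dispersion κ p (latticeSq a (j.1 - k.1))
    - dispersion κ p (latticeSq a k.1)

lemma continuous_divisor (κ p : ℝ) (j k : Mode d) : Continuous (divisor κ p j k) :=
  (((continuous_dispersion κ p).comp (continuous_latticeSq _)).sub
    ((continuous_dispersion κ p).comp (continuous_latticeSq _))).sub
    ((continuous_dispersion κ p).comp (continuous_latticeSq _))

/-- The parameters for which the interaction `j → (j - k) + k` is almost resonant. -/
def badSet (κ p : ℝ) (j k : Mode d) (η : ℝ) : Set (Fin d → ℝ) :=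
  cube d ∩ {a | latticeSq a (j.1 - k.1) ≤ latticeSq a j.1 ∧
    latticeSq a k.1 ≤ latticeSq a (j.1 - k.1) ∧ |divisor κ p j k a| < √κ * η}

lemma measurableSet_cube : MeasurableSet (cube d) :=
  MeasurableSet.univ_pi fun _ => measurableSet_Ioo

lemma measurableSet_badSet (κ p : ℝ) (j k : Mode d) (η : ℝ) :
    MeasurableSet (badSet κ p j k η) := by
  refine measurableSet_cube.inter (MeasurableSet.inter ?_ (MeasurableSet.inter ?_ ?_))
  · exact measurableSet_le (continuous_latticeSq _).measurable (continuous_latticeSq _).measurable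
  · exact measurableSet_le (continuous_latticeSq _).measurable (continuous_latticeSq _).measurable
  · exact measurableSet_lt (continuous_divisor κ p j k).abs.measurable measurable_const

lemma ae_divisor_ne_zero {κ p : ℝ} (hκ : 0 < κ) (hp : 0 < p) (j k : Mode d)
    (hjk : j.1 - k.1 ≠ 0) : volume (cube d ∩ {a | divisor κ p j k a = 0}) = 0 := by
  have hpos : ∀ (a : Fin d → ℝ) (_ : a ∈ Set.univ.pi (fun _ : Fin d => Set.Ioo (1 / 2 : ℝ) 4))
      (v : Mode d), 0 < latticeSq a v.1 := by
    intro a ha v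
    have h1 := le_latticeSq (b := 1 / 2) (fun i => (ha i (Set.mem_univ i)).1.le) v.1
    rw [← v.len_sq] at h1
    have := v.len_pos
    have : 0 < v.len ^ 2 := by positivity
    linarith
  have h := volume_le_radial (S := cube d ∩ {a | divisor κ p j k a = 0}) (A := Set.univ)
    (measurableSet_cube.inter (measurableSet_eq_fun (continuous_divisor κ p j k).measurable
      measurable_const)) MeasurableSet.univ Set.inter_subset_left (r := 0) ?_ ?_
  · simpa using h
  · intro a ha _
    rw [nonpos_iff_eq_zero]
    apply Set.Finite.measure_zero
    refine (finite_radial_zeros hκ hp (hpos a ha j) (hpos a ha ⟨_, hjk⟩) (hpos a ha k)).subset ?_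
    rintro t ⟨ht, _, h0⟩
    refine ⟨by linarith [ht.1], ?_⟩
    simpa only [Set.mem_ofPred_eq, divisor, latticeSq_smul] using h0
  · intro a _ h; exact absurd (Set.mem_univ a) h

lemma exists_volume_badSet_le (d : ℕ) {κ p : ℝ} (hκ : 0 < κ) (hp : 0 < p) :
    ∃ C > 0, ∃ R > 0, ∀ (j k : Mode d) (η : ℝ) (i : Fin d), R ≤ j.len → 0 < η → η ≤ 1 →
      k.1 i ≠ 0 → volume (badSet κ p j k η) ≤
        ENNReal.ofReal (C * (η * (k.len ^ 3 / (1 + |(j.1 i : ℝ)|)))) := by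
  obtain ⟨c, hc, R, hR, hrad⟩ := exists_radial_bound hκ hp
  have hs := Real.sqrt_pos.2 hκ
  set C₁ : ℝ := 1 + √(κ + p) * 4 / √κ
  have hC₁ : 1 ≤ C₁ := by
    have : 0 ≤ √(κ + p) * 4 / √κ := by positivity
    linarith
  refine ⟨2 ^ d * ((2 * √κ / c) * (6 ^ d * (8 * C₁))), by positivity, 36 * R + 1, by positivity,
    fun j k η i hj hη hη1 hi => ?_⟩
  have hk1 := k.one_le_len
  have hj1 := j.one_le_len
  set v : Fin d → ℤ := j.1 - k.1 with hv
  set w : Fin d → ℝ := fun l => (j.1 l : ℝ) ^ 2 - (v l : ℝ) ^ 2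
  set δ : ℝ := C₁ * k.len ^ 2
  set Box : Set (Fin d → ℝ) := Set.univ.pi (fun _ : Fin d => Set.Ioo (1 / 2 : ℝ) 4) with hBox
  have hw : ∀ a, ∑ l, a l * w l = latticeSq a j.1 - latticeSq a v := by
    intro a; simp only [latticeSq, ← Finset.sum_sub_distrib, w]
    exact Finset.sum_congr rfl fun l _ => by ring
  have hv0 : 0 ≤ ∑ l, (v l : ℝ) ^ 2 := Finset.sum_nonneg fun _ _ => sq_nonneg _
  have hjv : j.len ^ 2 ≤ 2 * ∑ l, (v l : ℝ) ^ 2 + 2 * k.len ^ 2 := by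
    rw [j.len_sq, k.len_sq, Finset.mul_sum, Finset.mul_sum, ← Finset.sum_add_distrib]
    refine Finset.sum_le_sum fun l _ => ?_
    have : (j.1 l : ℝ) = v l + k.1 l := by simp [hv]
    rw [this]; nlinarith [sq_nonneg ((v l : ℝ) - k.1 l)]
  have key := volume_le_radial (S := badSet κ p j k η) (A := {a | |∑ l, a l * w l| ≤ δ})
    (measurableSet_badSet κ p j k η) (measurableSet_le (by fun_prop) measurable_const)
    Set.inter_subset_left (r := ENNReal.ofReal (2 * √κ / c * η)) ?_ ?_
  · have hA : volume ({a | |∑ l, a l * w l| ≤ δ} ∩ Box)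
        ≤ ENNReal.ofReal (6 ^ d * (8 * C₁ * (k.len ^ 3 / (1 + |(j.1 i : ℝ)|)))) := by
      have hwi : w i = (k.1 i : ℝ) * (2 * j.1 i - k.1 i) := by simp [w, hv]; ring
      have hki := k.abs_le_len i
      by_cases h0 : w i = 0
      · calc volume ({a | |∑ l, a l * w l| ≤ δ} ∩ Box) ≤ volume Box :=
              measure_mono Set.inter_subset_right
          _ = ENNReal.ofReal ((4 - 1 / 2) ^ d) := by
              simp only [hBox, volume_pi_pi, Real.volume_Ioo, Finset.prod_const, Finset.card_univ,
                Fintype.card_fin]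
              rw [ENNReal.ofReal_pow (by norm_num)]
          _ ≤ _ := by
              apply ENNReal.ofReal_le_ofReal
              have hk0 : (k.1 i : ℝ) ≠ 0 := by exact_mod_cast hi
              have h2 : 2 * (j.1 i : ℝ) = k.1 i := by
                have := (mul_eq_zero.1 (hwi ▸ h0)).resolve_left hk0
                linarith
              have h3 : |(j.1 i : ℝ)| ≤ k.len := by
                rw [← h2, abs_mul, abs_two] at hki
                have := abs_nonneg (j.1 i : ℝ); linarith
              have h4 : 1 ≤ 8 * C₁ * (k.len ^ 3 / (1 + |(j.1 i : ℝ)|)) := by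
                rw [← mul_div_assoc, le_div_iff₀ (by positivity), one_mul]
                have : k.len ≤ k.len ^ 3 := le_self_pow₀ hk1 (by norm_num)
                nlinarith
              calc ((4 - 1 / 2) ^ d : ℝ) ≤ 6 ^ d * 1 := by
                    rw [mul_one]; gcongr; norm_num
                _ ≤ _ := by gcongr
      · refine (volume_slab_le w i h0 (by positivity)).trans (ENNReal.ofReal_le_ofReal ?_)
        gcongr 6 ^ d * ?_
        have hn : (1 : ℝ) ≤ |(k.1 i : ℝ)| := by exact_mod_cast Int.one_le_abs hi
        have hm : (1 : ℝ) ≤ |(2 * j.1 i - k.1 i : ℝ)| := by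
          have : (2 * j.1 i - k.1 i : ℤ) ≠ 0 := by
            intro h; apply h0; rw [hwi]
            have : (2 * j.1 i - k.1 i : ℝ) = 0 := by exact_mod_cast h
            rw [this, mul_zero]
          exact_mod_cast Int.one_le_abs this
        have hw1 : |(2 * j.1 i - k.1 i : ℝ)| ≤ |w i| := by
          rw [hwi, abs_mul]; nlinarith [abs_nonneg (2 * j.1 i - k.1 i : ℝ)]
        have h5 : 1 + |(j.1 i : ℝ)| ≤ 4 * |w i| * k.len := by
          have : 2 * |(j.1 i : ℝ)| ≤ |(2 * j.1 i - k.1 i : ℝ)| + |(k.1 i : ℝ)| := by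
            have := abs_add_le (2 * j.1 i - k.1 i : ℝ) (k.1 i)
            rw [sub_add_cancel, abs_mul, abs_two] at this
            exact this
          have := abs_nonneg (j.1 i : ℝ)
          nlinarith
        rw [← mul_div_assoc, div_le_div_iff₀ (by positivity) (by positivity)]
        simp only [δ]
        have : 0 ≤ 2 * C₁ * k.len ^ 2 := by positivity
        calc _ = 2 * C₁ * k.len ^ 2 * (1 + |(j.1 i : ℝ)|) := by ring
          _ ≤ 2 * C₁ * k.len ^ 2 * (4 * |w i| * k.len) := by gcongr
          _ = _ := by ring
    calc _ ≤ _ := key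
      _ ≤ 2 ^ d * (ENNReal.ofReal (2 * √κ / c * η) *
            ENNReal.ofReal (6 ^ d * (8 * C₁ * (k.len ^ 3 / (1 + |(j.1 i : ℝ)|))))) := by gcongr
      _ = ENNReal.ofReal (2 ^ d) * (ENNReal.ofReal (2 * √κ / c * η) *
            ENNReal.ofReal (6 ^ d * (8 * C₁ * (k.len ^ 3 / (1 + |(j.1 i : ℝ)|))))) := by
          rw [ENNReal.ofReal_pow (by norm_num)]; norm_num
      _ = _ := by
          rw [← ENNReal.ofReal_mul (by positivity), ← ENNReal.ofReal_mul (by positivity)]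
          congr 1; ring
  · intro a ha _
    apply volume_le_of_dist_le
    have hfib : ∀ t ∈ {t ∈ Set.Icc (1 : ℝ) 2 | t • a ∈ badSet κ p j k η},
        t ∈ Set.Icc (1 : ℝ) 2 ∧ 1 / 2 ≤ latticeSq a k.1 ∧ latticeSq a k.1 ≤ latticeSq a v ∧
        latticeSq a v ≤ latticeSq a j.1 ∧ |(dispersion κ p (t * latticeSq a j.1)
          - dispersion κ p (t * latticeSq a v) - dispersion κ p (t * latticeSq a k.1)) / t|
          ≤ √κ * η := by
      rintro t ⟨ht, hcube, h10, h21, hsmall⟩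
      have t0 : 0 < t := by linarith [ht.1]
      simp only [divisor, latticeSq_smul] at h10 h21 hsmall
      refine ⟨ht, ?_, le_of_mul_le_mul_left h21 t0, le_of_mul_le_mul_left h10 t0, ?_⟩
      · have h1 := le_latticeSq (b := 1) (fun i => (hcube i (Set.mem_univ i)).1.le) k.1
        rw [latticeSq_smul, ← k.len_sq] at h1
        nlinarith [ht.1, ht.2]
      · rw [abs_div, abs_of_pos t0]
        exact (div_le_self (abs_nonneg _) ht.1).trans hsmall.le
    intro x hx y hy
    obtain ⟨hx0, hk, hkv, hvj, hx1⟩ := hfib x hx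
    obtain ⟨hy0, -, -, -, hy1⟩ := hfib y hy
    have hRv : R ≤ latticeSq a v := by
      have h1 := le_latticeSq (b := 1 / 2) (fun i => (ha i (Set.mem_univ i)).1.le) k.1
      have h2 := latticeSq_le (b := 4) (fun i => (ha i (Set.mem_univ i)).2.le) v
      have h3 := le_latticeSq (b := 1 / 2) (fun i => (ha i (Set.mem_univ i)).1.le) v
      rw [← k.len_sq] at h1
      nlinarith
    have h4 := hrad _ _ _ x y hx0 hy0 hk hkv hvj hRv
    have h5 := (abs_sub _ _).trans (add_le_add hx1 hy1) |> h4.trans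
    rw [div_mul_eq_mul_div, le_div_iff₀ hc]
    linarith
  · intro a ha hnot
    rw [Set.eq_empty_iff_forall_notMem]
    rintro t ⟨ht, hcube, h10, h21, hsmall⟩
    apply hnot
    have t0 : 0 < t := by linarith [ht.1]
    have h1 := le_latticeSq (b := 1) (fun i => (hcube i (Set.mem_univ i)).1.le) k.1
    have h2 := latticeSq_le (b := 4) (fun i => (hcube i (Set.mem_univ i)).2.le) k.1
    rw [← k.len_sq] at h1 h2
    have hk2 : 1 ≤ k.len ^ 2 := one_le_pow₀ hk1
    have h3 := dispersion_le hκ.le hp.le (by linarith : 1 ≤ latticeSq (t • a) k.1)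
    have h4 := sqrt_mul_sub_le_dispersion_sub hκ hp.le (by linarith) h10
    have h5 := (abs_lt.1 hsmall).2
    simp only [divisor] at h5
    have h6 : √κ * (latticeSq (t • a) j.1 - latticeSq (t • a) v) ≤ √κ * δ := by
      have e1 : √κ * δ = √κ * k.len ^ 2 + √(κ + p) * (4 * k.len ^ 2) := by
        simp only [δ, C₁]; field_simp
      have e2 : √κ * η ≤ √κ * k.len ^ 2 := by gcongr; linarith
      have e3 := mul_le_mul_of_nonneg_left h2 (Real.sqrt_nonneg (κ + p))
      rw [e1]; linarith
    have h7 := le_of_mul_le_mul_left h6 hs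
    rw [latticeSq_smul, latticeSq_smul] at h7 h10
    have h8 := le_of_mul_le_mul_left h10 t0
    show |∑ l, a l * w l| ≤ δ
    rw [hw, abs_of_nonneg (by linarith)]
    nlinarith [ht.1]

lemma Mode.finite_len_le (R : ℝ) : {j : Mode d | j.len ≤ R}.Finite := by
  have h : (Set.Icc (fun _ => -⌈R⌉ : Fin d → ℤ) (fun _ => ⌈R⌉)).Finite := Set.finite_Icc _ _
  refine (h.preimage (Subtype.val_injective (p := fun j : Fin d → ℤ => j ≠ 0)).injOn).subset ?_
  intro (j : Mode d) hj
  have h1 : ∀ i, |j.1 i| ≤ ⌈R⌉ := fun i => by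
    have := (j.abs_le_len i).trans (hj.trans (Int.le_ceil R))
    exact_mod_cast this
  exact ⟨fun i => (abs_le.1 (h1 i)).1, fun i => (abs_le.1 (h1 i)).2⟩

/-- The loss in the small divisor estimate. -/
def loss (d M : ℕ) (j k : Mode d) : ℝ :=
  j.len ^ (d - 1) * log (1 + j.len ^ 2) ^ (d + 1) * k.len ^ M

lemma Mode.half_le_log (j : Mode d) : 1 / 2 ≤ log (1 + j.len ^ 2) := by
  have h1 := Real.log_two_gt_d9
  have h2 : log 2 ≤ log (1 + j.len ^ 2) := by
    apply log_le_log (by norm_num); nlinarith [j.one_le_len]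
  norm_num at h1 ⊢; linarith

lemma loss_ge (d M : ℕ) (j k : Mode d) : (1 / 2) ^ (d + 1) ≤ loss d M j k := by
  have h1 : (1 : ℝ) ≤ j.len ^ (d - 1) := one_le_pow₀ j.one_le_len
  have h2 : (1 : ℝ) ≤ k.len ^ M := one_le_pow₀ k.one_le_len
  have h3 : ((1 : ℝ) / 2) ^ (d + 1) ≤ log (1 + j.len ^ 2) ^ (d + 1) := by
    gcongr; exact j.half_le_log
  have h4 : (0 : ℝ) < (1 / 2) ^ (d + 1) := by positivity
  have h5 := j.len_pos
  have h6 := j.log_pos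
  unfold loss
  calc ((1 : ℝ) / 2) ^ (d + 1) = 1 * (1 / 2) ^ (d + 1) * 1 := by ring
    _ ≤ _ := by gcongr

lemma loss_pos (d M : ℕ) (j k : Mode d) : 0 < loss d M j k :=
  (by positivity : (0 : ℝ) < (1 / 2) ^ (d + 1)).trans_le (loss_ge d M j k)

/-- For almost every parameter, only finitely many interactions are almost resonant. -/
lemma ae_finite_bad {κ p : ℝ} (hκ : 0 < κ) (hp : 0 < p) :
    ∀ᵐ a ∂(volume : Measure (Fin d → ℝ)),
      {q : Mode d × Mode d | a ∈ badSet κ p q.1 q.2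
        ((1 / 2) ^ (d + 1) / loss d (2 * d + 3) q.1 q.2)}.Finite := by
  obtain ⟨C, hC, R, hR, hvol⟩ := exists_volume_badSet_le d hκ hp
  set η : Mode d × Mode d → ℝ := fun q => (1 / 2) ^ (d + 1) / loss d (2 * d + 3) q.1 q.2
  set S : Mode d × Mode d → Set (Fin d → ℝ) := fun q =>
    {a | R ≤ q.1.len ∧ a ∈ badSet κ p q.1 q.2 (η q)}
  set b : Mode d → ℝ := fun j => ∑ i : Fin d,
    ((1 + |(j.1 i : ℝ)|) * (j.len ^ (d - 1) * log (1 + j.len ^ 2) ^ (d + 1)))⁻¹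
  have hb0 : ∀ j, 0 ≤ b j := fun j => Finset.sum_nonneg fun i _ => by
    have := j.len_pos; have := j.log_pos; positivity
  have hb : Summable b := summable_sum fun i _ => summable_mode_bertrand i
  have hsum : Summable fun q : Mode d × Mode d => C * (b q.1 * (q.2.len ^ (2 * d))⁻¹) :=
    (hb.mul_of_nonneg summable_mode_len hb0
      (fun k => by have := k.len_pos; positivity)).mul_left C
  have hle : ∀ q, volume (S q) ≤ ENNReal.ofReal (C * (b q.1 * (q.2.len ^ (2 * d))⁻¹)) := by
    intro q
    by_cases hq : R ≤ q.1.len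
    · obtain ⟨i, hi⟩ := q.2.exists_ne
      have hl := loss_pos d (2 * d + 3) q.1 q.2
      have h1 := hvol q.1 q.2 (η q) i hq (by positivity)
        ((div_le_one hl).2 (loss_ge d _ q.1 q.2)) hi
      refine (measure_mono fun a ha => ha.2).trans (h1.trans (ENNReal.ofReal_le_ofReal ?_))
      gcongr C * ?_
      have hj := q.1.len_pos
      have hk := q.2.len_pos
      have hlog := q.1.log_pos
      have e1 : η q * (q.2.len ^ 3 / (1 + |(q.1.1 i : ℝ)|)) = (1 / 2) ^ (d + 1) *
          (((1 + |(q.1.1 i : ℝ)|) * (q.1.len ^ (d - 1) * log (1 + q.1.len ^ 2) ^ (d + 1)))⁻¹ *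
            (q.2.len ^ (2 * d))⁻¹) := by
        simp only [η, loss, pow_add]; field_simp
      have e2 : ((1 + |(q.1.1 i : ℝ)|) * (q.1.len ^ (d - 1) * log (1 + q.1.len ^ 2) ^ (d + 1)))⁻¹
          ≤ b q.1 := Finset.single_le_sum (f := fun i : Fin d =>
          ((1 + |(q.1.1 i : ℝ)|) * (q.1.len ^ (d - 1) * log (1 + q.1.len ^ 2) ^ (d + 1)))⁻¹)
          (fun i _ => by positivity) (Finset.mem_univ i)
      rw [e1]
      calc _ ≤ 1 * (b q.1 * (q.2.len ^ (2 * d))⁻¹) := by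
            gcongr
            exact pow_le_one₀ (by norm_num) (by norm_num)
        _ = _ := one_mul _
    · have : S q = ∅ := by
        ext a; simp [S, hq]
      rw [this]; simp
  have hfin : ∑' q, volume (S q) ≠ ⊤ := by
    refine ne_top_of_le_ne_top ?_ (ENNReal.tsum_le_tsum hle)
    exact hsum.tsum_ofReal_ne_top
  filter_upwards [ae_finite_setOfPred_mem hfin] with a ha
  have hsmall : ({j : Mode d | j.len ≤ R} ×ˢ {k : Mode d | k.len ≤ 2 * R}).Finite :=
    (Mode.finite_len_le R).prod (Mode.finite_len_le (2 * R))
  refine (ha.union hsmall).subset ?_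
  rintro q hq
  by_cases h : R ≤ q.1.len
  · exact Or.inl ⟨h, hq⟩
  · right
    push Not at h
    obtain ⟨hc, h10, h21, -⟩ := hq
    have h1 := le_latticeSq (b := 1) (fun i => (hc i (Set.mem_univ i)).1.le) q.2.1
    have h2 := latticeSq_le (b := 4) (fun i => (hc i (Set.mem_univ i)).2.le) q.1.1
    rw [← q.2.len_sq] at h1
    rw [← q.1.len_sq] at h2
    refine ⟨h.le, (?_ : q.2.len ≤ 2 * R)⟩
    apply abs_le_of_sq_le_sq' _ (by positivity) |>.2
    have := q.1.len_pos
    nlinarith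

lemma exists_pos_forall_le {ι : Type*} {s : Set ι} (hs : s.Finite) (f : ι → ℝ)
    (hf : ∀ q ∈ s, 0 < f q) : ∃ γ > 0, ∀ q ∈ s, γ ≤ f q := by
  induction s, hs using Set.Finite.induction_on with
  | empty => exact ⟨1, one_pos, by simp⟩
  | @insert a s _ _ ih =>
    obtain ⟨γ, hγ, h⟩ := ih fun q hq => hf q (Set.mem_insert_of_mem _ hq)
    refine ⟨min γ (f a), lt_min hγ (hf a (Set.mem_insert _ _)), ?_⟩
    rintro q (rfl | hq)
    · exact min_le_right _ _
    · exact (min_le_left _ _).trans (h q hq)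

lemma sqrt_le_omega {κ p : ℝ} (hκ : 0 ≤ κ) (hp : 0 ≤ p) {a : Fin d → ℝ} (ha : a ∈ cube d)
    (j : Mode d) : √κ ≤ omega κ p a j := by
  have h1 := le_latticeSq (b := 1) (fun i => (ha i (Set.mem_univ i)).1.le) j.1
  rw [← j.len_sq] at h1
  have h2 : 1 ≤ j.len ^ 2 := one_le_pow₀ j.one_le_len
  have h3 := sqrt_mul_le_dispersion hκ hp (by linarith : 0 ≤ latticeSq a j.1)
  rw [omega_eq]
  nlinarith [Real.sqrt_nonneg κ]

lemma mem_nonresonantSet {κ p : ℝ} (hκ : 0 < κ) (hp : 0 < p) {a : Fin d → ℝ} (ha : a ∈ cube d)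
    (hfin : {q : Mode d × Mode d | a ∈ badSet κ p q.1 q.2
        ((1 / 2) ^ (d + 1) / loss d (2 * d + 3) q.1 q.2)}.Finite)
    (hne : ∀ j k : Mode d, j.1 - k.1 ≠ 0 → divisor κ p j k a ≠ 0) :
    a ∈ nonresonantSet d κ p ((2 * d + 3 : ℕ) : ℝ) := by
  have hs := Real.sqrt_pos.2 hκ
  have hlat : ∀ j : Mode d, 0 < latticeSq a j.1 := by
    intro j
    have h1 := le_latticeSq (b := 1) (fun i => (ha i (Set.mem_univ i)).1.le) j.1
    rw [← j.len_sq] at h1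
    have h2 : 1 ≤ j.len ^ 2 := one_le_pow₀ j.one_le_len
    linarith
  have hne' : ∀ q ∈ {q : Mode d × Mode d | a ∈ badSet κ p q.1 q.2
        ((1 / 2) ^ (d + 1) / loss d (2 * d + 3) q.1 q.2)}, divisor κ p q.1 q.2 a ≠ 0 := by
    rintro q ⟨-, -, h21, -⟩
    apply hne
    intro h0
    rw [h0] at h21
    have : latticeSq a (0 : Fin d → ℤ) = 0 := by simp [latticeSq]
    linarith [hlat q.2]
  obtain ⟨γ, hγ, hγle⟩ := exists_pos_forall_le hfin
    (fun q => |divisor κ p q.1 q.2 a| / √κ * loss d (2 * d + 3) q.1 q.2) (fun q hq => by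
      have := loss_pos d (2 * d + 3) q.1 q.2
      have := abs_pos.2 (hne' q hq)
      positivity)
  have hloss : ∀ j k : Mode d, min γ ((1 / 2) ^ (d + 1)) / (j.len ^ (d - 1) *
      log (1 + j.len ^ 2) ^ (d + 1) * k.len ^ (((2 * d + 3 : ℕ) : ℝ)))
      = min γ ((1 / 2) ^ (d + 1)) / loss d (2 * d + 3) j k := by
    intro j k; rw [rpow_natCast]; rfl
  have hle1 : ∀ j k : Mode d, min γ ((1 / 2) ^ (d + 1)) / loss d (2 * d + 3) j k ≤ 1 := by
    intro j k
    rw [div_le_one (loss_pos d _ j k)]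
    exact (min_le_right _ _).trans (loss_ge d _ j k)
  have hdiv : ∀ j₀ j₁ j₂ : Mode d, j₁.1 = j₀.1 - j₂.1 → j₁.lenSq a ≤ j₀.lenSq a →
      j₂.lenSq a ≤ j₁.lenSq a → min γ ((1 / 2) ^ (d + 1)) / loss d (2 * d + 3) j₀ j₂ ≤
        |omega κ p a j₀ - omega κ p a j₁ - omega κ p a j₂| / √κ := by
    intro j₀ j₁ j₂ h h10 h21
    have e : omega κ p a j₀ - omega κ p a j₁ - omega κ p a j₂ = divisor κ p j₀ j₂ a := by
      simp only [omega_eq, divisor, h]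
    simp only [lenSq_eq, h] at h10 h21
    rw [e]
    by_cases hbad : a ∈ badSet κ p j₀ j₂ ((1 / 2) ^ (d + 1) / loss d (2 * d + 3) j₀ j₂)
    · rw [div_le_iff₀ (loss_pos d _ j₀ j₂)]
      exact (min_le_left _ _).trans (hγle (j₀, j₂) hbad)
    · have h3 : ¬ |divisor κ p j₀ j₂ a| < √κ * ((1 / 2) ^ (d + 1) / loss d (2 * d + 3) j₀ j₂) :=
        fun h4 => hbad ⟨ha, h10, h21, h4⟩
      rw [le_div_iff₀ hs]
      push Not at h3
      refine le_trans ?_ h3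
      rw [mul_comm]
      have := loss_pos d (2 * d + 3) j₀ j₂
      gcongr
      exact min_le_right _ _
  refine ⟨ha, min γ ((1 / 2) ^ (d + 1)), lt_min hγ (by positivity), fun σ j hmom h10 h21 => ?_⟩
  have hω : ∀ i, √κ ≤ omega κ p a (j i) := fun i => sqrt_le_omega hκ.le hp.le ha _
  have hω10 : omega κ p a (j 1) ≤ omega κ p a (j 0) := dispersion_mono hκ.le hp.le (hlat _).le h10
  have hω21 : omega κ p a (j 2) ≤ omega κ p a (j 1) := dispersion_mono hκ.le hp.le (hlat _).le h21
  have hω2 := hω 2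
  have hω0 := hω 0
  have hω1 := hω 1
  rw [hloss]
  simp only [momentum, Fin.sum_univ_three] at hmom ⊢
  have habs : ∀ x : ℝ, √κ ≤ x → min γ ((1 / 2) ^ (d + 1)) / loss d (2 * d + 3) (j 0) (j 2)
      ≤ |x| / √κ := by
    intro x hx
    refine (hle1 _ _).trans ?_
    rw [one_le_div hs]; exact hx.trans (le_abs_self x)
  have habs' : ∀ x : ℝ, √κ ≤ x → 1 ≤ |x| / √κ := by
    intro x hx
    rw [one_le_div hs]; exact hx.trans (le_abs_self x)
  rcases Int.units_eq_one_or (σ 0) with h0 | h0 <;> rcases Int.units_eq_one_or (σ 1) with h1 | h1 <;>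
    rcases Int.units_eq_one_or (σ 2) with h2 | h2 <;>
    simp only [h0, h1, h2, Units.val_one, Units.val_neg, one_smul, neg_smul, Int.cast_one,
      Int.cast_neg, one_mul, neg_mul, mul_one, neg_neg] at hmom ⊢ <;>
    refine ⟨fun hσ => ?_, fun hσ => ?_⟩ <;>
    first
    | exact absurd hσ (by decide)
    | (refine habs' _ ?_; linarith)
    | (rw [← abs_neg]; refine habs' _ ?_; linarith)
    | (refine habs _ ?_; linarith)
    | (rw [← abs_neg]; refine habs _ ?_; linarith)
    | (rw [← sub_eq_add_neg, ← sub_eq_add_neg] at hmom ⊢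
       exact hdiv (j 0) (j 1) (j 2) (by linear_combination -hmom) h10 h21)
    | (refine (hdiv (j 0) (j 1) (j 2) (by linear_combination hmom) h10 h21).trans (le_of_eq ?_)
       rw [← abs_neg]; congr 2; ring1)

theorem ae_mem_nonresonantSet {κ p : ℝ} (hκ : 0 < κ) (hp : 0 < p) :
    ∀ᵐ a ∂(volume.restrict (cube d)), a ∈ nonresonantSet d κ p ((2 * d + 3 : ℕ) : ℝ) := by
  rw [ae_restrict_iff' measurableSet_cube]
  have h1 : ∀ᵐ a ∂(volume : Measure (Fin d → ℝ)), ∀ j k : Mode d, j.1 - k.1 ≠ 0 →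
      a ∉ cube d ∩ {a | divisor κ p j k a = 0} := by
    rw [ae_all_iff]; intro j
    rw [ae_all_iff]; intro k
    by_cases hjk : j.1 - k.1 = 0
    · filter_upwards with a h; exact absurd hjk h
    · have h2 := measure_eq_zero_iff_ae_notMem.1 (ae_divisor_ne_zero hκ hp j k hjk)
      filter_upwards [h2] with a ha _ using ha
  filter_upwards [ae_finite_bad hκ hp, h1] with a hfin hne ha
  exact mem_nonresonantSet hκ hp ha hfin fun j k hjk h0 => hne j k hjk ⟨ha, h0⟩

/-! ### Square-summable families -/

/-- The family `b` is square summable with `ℓ²`-norm at most `B`. -/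
def L2Bound {ι : Type*} (b : ι → ℝ) (B : ℝ) : Prop :=
  0 ≤ B ∧ ∀ F : Finset ι, ∑ k ∈ F, b k ^ 2 ≤ B ^ 2

namespace L2Bound

variable {ι ι' : Type*} {b c : ι → ℝ} {B C : ℝ}

lemma mono (h : L2Bound c C) (hb : ∀ k, |b k| ≤ |c k|) : L2Bound b C :=
  ⟨h.1, fun F => (Finset.sum_le_sum fun k _ => sq_le_sq.2 (hb k)).trans (h.2 F)⟩

lemma mono_of_nonneg (h : L2Bound c C) (h0 : ∀ k, 0 ≤ b k) (hb : ∀ k, b k ≤ c k) :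
    L2Bound b C :=
  h.mono fun k => by rw [abs_of_nonneg (h0 k)]; exact (hb k).trans (le_abs_self _)

lemma mono_right (h : L2Bound b B) (hB : B ≤ C) : L2Bound b C :=
  ⟨h.1.trans hB, fun F => (h.2 F).trans (pow_le_pow_left₀ h.1 hB 2)⟩

lemma const_mul (h : L2Bound b B) (t : ℝ) : L2Bound (fun k => t * b k) (|t| * B) := by
  refine ⟨mul_nonneg (abs_nonneg _) h.1, fun F => ?_⟩
  simp only [mul_pow, ← Finset.mul_sum, sq_abs]
  exact mul_le_mul_of_nonneg_left (h.2 F) (sq_nonneg t)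

lemma add (hb : L2Bound b B) (hc : L2Bound c C) : L2Bound (fun k => b k + c k) (B + C) := by
  refine ⟨add_nonneg hb.1 hc.1, fun F => ?_⟩
  have h1 : ∑ k ∈ F, b k * c k ≤ B * C := by
    refine (Real.sum_mul_le_sqrt_mul_sqrt F b c).trans ?_
    exact mul_le_mul (Real.sqrt_le_iff.2 ⟨hb.1, hb.2 F⟩) (Real.sqrt_le_iff.2 ⟨hc.1, hc.2 F⟩)
      (Real.sqrt_nonneg _) hb.1
  have h2 := hb.2 F
  have h3 := hc.2 F
  calc ∑ k ∈ F, (b k + c k) ^ 2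
      = ∑ k ∈ F, b k ^ 2 + 2 * ∑ k ∈ F, b k * c k + ∑ k ∈ F, c k ^ 2 := by
        rw [Finset.mul_sum, ← Finset.sum_add_distrib, ← Finset.sum_add_distrib]
        exact Finset.sum_congr rfl fun k _ => by ring
    _ ≤ _ := by nlinarith

lemma comp_injective (h : L2Bound b B) {e : ι' → ι} (he : Function.Injective e) :
    L2Bound (fun k => b (e k)) B := by
  refine ⟨h.1, fun F => ?_⟩
  have := h.2 (F.map ⟨e, he⟩)
  rwa [Finset.sum_map] at this

lemma abs_le (h : L2Bound b B) (k : ι) : |b k| ≤ B := by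
  have := h.2 {k}
  rw [Finset.sum_singleton] at this
  exact abs_le_of_sq_le_sq this h.1

lemma summable_sq (h : L2Bound b B) : Summable fun k => b k ^ 2 :=
  summable_of_sum_le (fun _ => sq_nonneg _) h.2

lemma tsum_sq_le (h : L2Bound b B) : ∑' k, b k ^ 2 ≤ B ^ 2 :=
  h.summable_sq.tsum_le_of_sum_le h.2

lemma of_summable (h : Summable fun k => b k ^ 2) : L2Bound b √(∑' k, b k ^ 2) := by
  refine ⟨Real.sqrt_nonneg _, fun F => ?_⟩
  rw [Real.sq_sqrt (tsum_nonneg fun k => sq_nonneg _)]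
  exact h.sum_le_tsum F fun k _ => sq_nonneg _

lemma sum_mul_le (hb : L2Bound b B) (hc : L2Bound c C) (F : Finset ι) :
    ∑ k ∈ F, |b k * c k| ≤ B * C := by
  have h := Real.sum_mul_le_sqrt_mul_sqrt F (fun k => |b k|) (fun k => |c k|)
  simp only [sq_abs, ← abs_mul] at h
  refine h.trans ?_
  exact mul_le_mul (Real.sqrt_le_iff.2 ⟨hb.1, hb.2 F⟩) (Real.sqrt_le_iff.2 ⟨hc.1, hc.2 F⟩)
    (Real.sqrt_nonneg _) hb.1

lemma summable_mul (hb : L2Bound b B) (hc : L2Bound c C) : Summable fun k => |b k * c k| :=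
  summable_of_sum_le (fun _ => abs_nonneg _) (hb.sum_mul_le hc)

lemma tsum_mul_le (hb : L2Bound b B) (hc : L2Bound c C) : ∑' k, |b k * c k| ≤ B * C :=
  (hb.summable_mul hc).tsum_le_of_sum_le (hb.sum_mul_le hc)

end L2Bound

section Young

variable {ι : Type*} [AddCommGroup ι] {a b : ι → ℝ} {A B : ℝ}

lemma L2Bound.summable_conv (ha : ∀ k, 0 ≤ a k) (hs : Summable a) (hb : L2Bound b B) (k : ι) :
    Summable fun l => a l * b (k - l) := by
  refine Summable.of_norm_bounded (hs.mul_right B) fun l => ?_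
  rw [norm_mul, Real.norm_eq_abs, Real.norm_eq_abs, abs_of_nonneg (ha l)]
  exact mul_le_mul_of_nonneg_left (hb.abs_le _) (ha l)

/-- Young's inequality `ℓ¹ * ℓ² ⊆ ℓ²`. -/
lemma L2Bound.conv (ha : ∀ k, 0 ≤ a k) (hs : Summable a) (hA : ∑' k, a k ≤ A) (hb : L2Bound b B) :
    L2Bound (fun k => ∑' l, a l * b (k - l)) (A * B) := by
  have hA0 : 0 ≤ A := (tsum_nonneg ha).trans hA
  refine ⟨mul_nonneg hA0 hb.1, fun F => ?_⟩
  have hsq : ∀ k, Summable fun l => a l * b (k - l) ^ 2 := fun k => by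
    refine Summable.of_norm_bounded (hs.mul_right (B ^ 2)) fun l => ?_
    rw [Real.norm_eq_abs, abs_of_nonneg (mul_nonneg (ha l) (sq_nonneg _))]
    exact mul_le_mul_of_nonneg_left (sq_le_sq' (neg_le_of_abs_le (hb.abs_le _))
      (le_of_abs_le (hb.abs_le _))) (ha l)
  have hcs : ∀ k, (∑' l, a l * b (k - l)) ^ 2 ≤ A * ∑' l, a l * b (k - l) ^ 2 := by
    intro k
    have h1 : L2Bound (fun l => √(a l)) √A := by
      refine ⟨Real.sqrt_nonneg _, fun G => ?_⟩
      simp only [Real.sq_sqrt (ha _), Real.sq_sqrt hA0]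
      exact (hs.sum_le_tsum G fun l _ => ha l).trans hA
    have h2 : L2Bound (fun l => √(a l) * b (k - l)) √(∑' l, a l * b (k - l) ^ 2) := by
      have : (fun l => a l * b (k - l) ^ 2) = fun l => (√(a l) * b (k - l)) ^ 2 := by
        ext l; rw [mul_pow, Real.sq_sqrt (ha l)]
      rw [this]
      exact L2Bound.of_summable (this ▸ hsq k)
    have e : ∀ l, √(a l) * (√(a l) * b (k - l)) = a l * b (k - l) := fun l => by
      rw [← mul_assoc, Real.mul_self_sqrt (ha l)]
    have h3 := h1.tsum_mul_le h2
    have h4 := h1.summable_mul h2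
    simp only [e] at h3 h4
    have h5 : |∑' l, a l * b (k - l)| ≤ √A * √(∑' l, a l * b (k - l) ^ 2) := by
      refine le_trans ?_ h3
      simpa only [Real.norm_eq_abs] using norm_tsum_le_tsum_norm (f := fun l => a l * b (k - l)) h4
    calc (∑' l, a l * b (k - l)) ^ 2 = |∑' l, a l * b (k - l)| ^ 2 := (sq_abs _).symm
      _ ≤ (√A * √(∑' l, a l * b (k - l) ^ 2)) ^ 2 := pow_le_pow_left₀ (abs_nonneg _) h5 2
      _ = _ := by
        rw [mul_pow, Real.sq_sqrt hA0, Real.sq_sqrt]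
        exact tsum_nonneg fun l => mul_nonneg (ha l) (sq_nonneg _)
  calc ∑ k ∈ F, (∑' l, a l * b (k - l)) ^ 2
      ≤ ∑ k ∈ F, A * ∑' l, a l * b (k - l) ^ 2 := Finset.sum_le_sum fun k _ => hcs k
    _ = A * ∑' l, a l * ∑ k ∈ F, b (k - l) ^ 2 := by
        rw [← Finset.mul_sum, ← Summable.tsum_finsetSum fun k _ => hsq k]
        simp only [Finset.mul_sum]
    _ ≤ A * ∑' l, a l * B ^ 2 := by
        have hin : ∀ l, ∑ k ∈ F, b (k - l) ^ 2 ≤ B ^ 2 := fun l =>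
          (hb.comp_injective (sub_left_injective (b := l))).2 F
        refine mul_le_mul_of_nonneg_left (Summable.tsum_le_tsum (fun l =>
          mul_le_mul_of_nonneg_left (hin l) (ha l)) ?_ (hs.mul_right _)) hA0
        refine Summable.of_nonneg_of_le (fun l => mul_nonneg (ha l)
          (Finset.sum_nonneg fun k _ => sq_nonneg _)) (fun l =>
          mul_le_mul_of_nonneg_left (hin l) (ha l)) (hs.mul_right _)
    _ ≤ (A * B) ^ 2 := by
        rw [tsum_mul_right, mul_pow, sq A, mul_assoc]
        gcongr

end Young

/-! ### Weights on the lattice -/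

/-- The Japanese bracket `⟨k⟩ = √(1 + |k|²)`. -/
def jap (k : Fin d → ℤ) : ℝ := √(1 + ∑ i, (k i : ℝ) ^ 2)

lemma jap_sq (k : Fin d → ℤ) : jap k ^ 2 = 1 + ∑ i, (k i : ℝ) ^ 2 :=
  Real.sq_sqrt (add_nonneg zero_le_one (Finset.sum_nonneg fun _ _ => sq_nonneg _))

lemma one_le_jap (k : Fin d → ℤ) : 1 ≤ jap k := by
  apply Real.le_sqrt_of_sq_le
  have : 0 ≤ ∑ i, (k i : ℝ) ^ 2 := Finset.sum_nonneg fun _ _ => sq_nonneg _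
  linarith

lemma jap_pos (k : Fin d → ℤ) : 0 < jap k := one_pos.trans_le (one_le_jap k)

lemma jap_neg (k : Fin d → ℤ) : jap (-k) = jap k := by simp [jap]

lemma jap_zero : jap (0 : Fin d → ℤ) = 1 := by simp [jap]

lemma abs_le_jap (k : Fin d → ℤ) (i : Fin d) : |(k i : ℝ)| ≤ jap k := by
  apply Real.abs_le_sqrt
  have := Finset.single_le_sum (f := fun i => (k i : ℝ) ^ 2) (fun i _ => sq_nonneg _)
    (Finset.mem_univ i)
  linarith

lemma jap_le (k l : Fin d → ℤ) : jap k ≤ 2 * max (jap l) (jap (k - l)) := by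
  have h0 : 0 < max (jap l) (jap (k - l)) := lt_max_of_lt_left (jap_pos l)
  apply abs_le_of_sq_le_sq' _ (by positivity) |>.2
  have h1 : jap l ^ 2 ≤ max (jap l) (jap (k - l)) ^ 2 :=
    pow_le_pow_left₀ (jap_pos _).le (le_max_left _ _) 2
  have h2 : jap (k - l) ^ 2 ≤ max (jap l) (jap (k - l)) ^ 2 :=
    pow_le_pow_left₀ (jap_pos _).le (le_max_right _ _) 2
  have h3 : ∑ i, (k i : ℝ) ^ 2 ≤ 2 * ∑ i, (l i : ℝ) ^ 2 + 2 * ∑ i, ((k - l) i : ℝ) ^ 2 := by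
    rw [Finset.mul_sum, Finset.mul_sum, ← Finset.sum_add_distrib]
    refine Finset.sum_le_sum fun i _ => ?_
    have : (k i : ℝ) = l i + (k - l) i := by simp
    rw [this]; nlinarith [sq_nonneg ((l i : ℝ) - (k - l) i)]
  rw [jap_sq] at h1 h2 ⊢
  nlinarith

lemma Mode.weight_eq (s : ℝ) (j : Mode d) : j.weight s = (jap j.1 ^ s) ^ 2 := by
  rw [Mode.weight, j.len_sq, ← jap_sq, ← rpow_natCast, ← rpow_natCast, ← rpow_mul (jap_pos _).le,
    ← rpow_mul (jap_pos _).le, mul_comm]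

lemma summable_jap : Summable fun k : Fin d → ℤ => (jap k ^ (-(d : ℝ))) ^ 2 := by
  refine Summable.of_nonneg_of_le (fun k => sq_nonneg _) (fun k => ?_)
    (summable_pi_prod (fun x => by positivity) summable_inv_one_add_sq d)
  rw [Finset.prod_inv_distrib, rpow_neg (jap_pos k).le, rpow_natCast, inv_pow, ← pow_mul,
    mul_comm, pow_mul]
  apply inv_anti₀ (Finset.prod_pos fun i _ => by positivity)
  calc ∏ i, (1 + (k i : ℝ) ^ 2) ≤ ∏ i : Fin d, jap k ^ 2 := by
        refine Finset.prod_le_prod (fun i _ => by positivity) fun i _ => ?_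
        have h := pow_le_pow_left₀ (abs_nonneg _) (abs_le_jap k i) 2
        rw [jap_sq]
        have := Finset.single_le_sum (f := fun i => (k i : ℝ) ^ 2) (fun i _ => sq_nonneg _)
          (Finset.mem_univ i)
        linarith
    _ = _ := by simp

/-- The constant of the embedding `H^d ⊆ ℓ¹`. -/
def embConst (d : ℕ) : ℝ := 1 + √(∑' k : Fin d → ℤ, (jap k ^ (-(d : ℝ))) ^ 2)

lemma one_le_embConst (d : ℕ) : 1 ≤ embConst d := by
  have := Real.sqrt_nonneg (∑' k : Fin d → ℤ, (jap k ^ (-(d : ℝ))) ^ 2)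
  unfold embConst; linarith

lemma embConst_pos (d : ℕ) : 0 < embConst d := one_pos.trans_le (one_le_embConst d)

lemma l2Bound_jap {r : ℝ} (hr : d ≤ r) :
    L2Bound (fun k : Fin d → ℤ => jap k ^ (-r)) (embConst d) := by
  refine ((L2Bound.of_summable summable_jap).mono_right (by unfold embConst; linarith)).mono_of_nonneg
    (fun k => rpow_nonneg (jap_pos k).le _) fun k => ?_
  exact rpow_le_rpow_of_exponent_le (one_le_jap k) (by linarith)

lemma summable_of_l2Bound {r : ℝ} (hr : d ≤ r) {b : (Fin d → ℤ) → ℝ} {B : ℝ}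
    (hb0 : ∀ k, 0 ≤ b k) (hb : L2Bound (fun k => jap k ^ r * b k) B) :
    Summable b ∧ ∑' k, b k ≤ embConst d * B := by
  have e : ∀ k : Fin d → ℤ, |jap k ^ (-r) * (jap k ^ r * b k)| = b k := fun k => by
    rw [← mul_assoc, ← rpow_add (jap_pos k), neg_add_cancel, rpow_zero, one_mul,
      abs_of_nonneg (hb0 k)]
  have h1 := (l2Bound_jap hr).summable_mul hb
  have h2 := (l2Bound_jap hr).tsum_mul_le hb
  simp only [e] at h1 h2
  exact ⟨h1, h2⟩

/-- The weight inequality behind the product estimate. -/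
lemma jap_rpow_le {σ r : ℝ} (hσ : 0 ≤ σ) (hr : σ ≤ r) (k l : Fin d → ℤ) :
    jap k ^ σ ≤ 2 ^ r * (jap (k - l) ^ σ + jap l ^ r * jap (k - l) ^ (σ - r)) := by
  have hk := jap_pos k
  have hl := jap_pos l
  have hkl := jap_pos (k - l)
  have h1 : jap k ^ σ ≤ 2 ^ r * max (jap l) (jap (k - l)) ^ σ := by
    calc jap k ^ σ ≤ (2 * max (jap l) (jap (k - l))) ^ σ := rpow_le_rpow hk.le (jap_le k l) hσ
      _ = 2 ^ σ * max (jap l) (jap (k - l)) ^ σ :=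
        mul_rpow zero_le_two (hl.le.trans (le_max_left _ _))
      _ ≤ _ := by
        have : (0 : ℝ) ≤ max (jap l) (jap (k - l)) ^ σ :=
          rpow_nonneg (hl.le.trans (le_max_left _ _)) _
        gcongr
        exact one_le_two
  refine h1.trans (mul_le_mul_of_nonneg_left ?_ (by positivity))
  rcases le_total (jap l) (jap (k - l)) with h | h
  · rw [max_eq_right h]
    have : 0 ≤ jap l ^ r * jap (k - l) ^ (σ - r) := by positivity
    linarith
  · rw [max_eq_left h]
    have h2 : jap l ^ σ = jap l ^ r * jap l ^ (σ - r) := by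
      rw [← rpow_add hl]; congr 1; ring
    have h3 : jap l ^ (σ - r) ≤ jap (k - l) ^ (σ - r) :=
      rpow_le_rpow_of_nonpos hkl h (by linarith)
    rw [h2]
    have : 0 ≤ jap (k - l) ^ σ := by positivity
    have : jap l ^ r * jap l ^ (σ - r) ≤ jap l ^ r * jap (k - l) ^ (σ - r) := by gcongr
    linarith

/-- The product estimate `H^σ × H^r → H^σ` for `0 ≤ σ ≤ r`, `r ≥ d`. -/
lemma L2Bound.sobolev_conv {σ r : ℝ} (hσ : 0 ≤ σ) (hσr : σ ≤ r) (hr : d ≤ r)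
    {a b : (Fin d → ℤ) → ℝ} {A B : ℝ} (ha0 : ∀ k, 0 ≤ a k) (hb0 : ∀ k, 0 ≤ b k)
    (ha : L2Bound (fun k => jap k ^ r * a k) A) (hb : L2Bound (fun k => jap k ^ σ * b k) B) :
    L2Bound (fun k => jap k ^ σ * ∑' l, a l * b (k - l)) (2 ^ r * (2 * embConst d) * A * B) := by
  obtain ⟨sa, ta⟩ := summable_of_l2Bound hr ha0 ha
  have hb' : L2Bound (fun k => jap k ^ r * (jap k ^ (σ - r) * b k)) B := by
    have : ∀ k : Fin d → ℤ, jap k ^ r * (jap k ^ (σ - r) * b k) = jap k ^ σ * b k := fun k => by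
      rw [← mul_assoc, ← rpow_add (jap_pos k)]; congr 2; ring
    simpa only [this] using hb
  have hb0' : ∀ k, 0 ≤ jap k ^ (σ - r) * b k := fun k =>
    mul_nonneg (rpow_nonneg (jap_pos k).le _) (hb0 k)
  have ha0' : ∀ k, 0 ≤ jap k ^ r * a k := fun k =>
    mul_nonneg (rpow_nonneg (jap_pos k).le _) (ha0 k)
  have hb0'' : ∀ k, 0 ≤ jap k ^ σ * b k := fun k =>
    mul_nonneg (rpow_nonneg (jap_pos k).le _) (hb0 k)
  obtain ⟨sb, tb⟩ := summable_of_l2Bound hr hb0' hb'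
  have c1 := L2Bound.conv ha0 sa ta hb
  have c2 := L2Bound.conv hb0' sb tb ha
  have key := (c1.add c2).const_mul (2 ^ r)
  have hbb : L2Bound b B := hb.mono_of_nonneg hb0 fun k =>
    le_mul_of_one_le_left (hb0 k) (one_le_rpow (one_le_jap k) hσ)
  have hconst : |(2 : ℝ) ^ r| * (embConst d * A * B + embConst d * B * A)
      = 2 ^ r * (2 * embConst d) * A * B := by
    rw [abs_of_pos (by positivity)]; ring
  rw [hconst] at key
  refine key.mono_of_nonneg (fun k => mul_nonneg (rpow_nonneg (jap_pos k).le _)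
    (tsum_nonneg fun l => mul_nonneg (ha0 l) (hb0 _))) fun k => ?_
  have s1 := L2Bound.summable_conv ha0 sa hb k
  have s2 := L2Bound.summable_conv hb0' sb ha k
  have e2 : ∑' l, jap l ^ (σ - r) * b l * (jap (k - l) ^ r * a (k - l))
      = ∑' l, jap (k - l) ^ (σ - r) * b (k - l) * (jap l ^ r * a l) := by
    rw [← (Equiv.subLeft k).tsum_eq]
    simp
  have s2' : Summable fun l => jap (k - l) ^ (σ - r) * b (k - l) * (jap l ^ r * a l) := by
    rw [← (Equiv.subLeft k).summable_iff]
    refine s2.congr fun l => ?_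
    simp
  rw [e2, ← s1.tsum_add s2', ← tsum_mul_left, ← tsum_mul_left]
  refine Summable.tsum_le_tsum (fun l => ?_) ((L2Bound.summable_conv ha0 sa hbb k).mul_left _)
    ((s1.add s2').mul_left _)
  calc jap k ^ σ * (a l * b (k - l))
      ≤ (2 ^ r * (jap (k - l) ^ σ + jap l ^ r * jap (k - l) ^ (σ - r))) * (a l * b (k - l)) :=
        mul_le_mul_of_nonneg_right (jap_rpow_le hσ hσr k l) (mul_nonneg (ha0 l) (hb0 _))
    _ = _ := by ring

/-! ### Fourier coefficients on the box -/

/-- The character `x ↦ e^{i k·x}`. -/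
def char (k : Fin d → ℤ) (x : Fin d → ℝ) : ℂ :=
  Complex.exp (Complex.I * ((∑ i, (k i : ℝ) * x i : ℝ) : ℂ))

lemma char_add (k l : Fin d → ℤ) (x : Fin d → ℝ) : char (k + l) x = char k x * char l x := by
  rw [char, char, char, ← Complex.exp_add, ← mul_add, ← Complex.ofReal_add,
    ← Finset.sum_add_distrib]
  simp [add_mul]

lemma char_zero (x : Fin d → ℝ) : char (0 : Fin d → ℤ) x = 1 := by simp [char]

lemma norm_char (k : Fin d → ℤ) (x : Fin d → ℝ) : ‖char k x‖ = 1 := by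
  rw [char, mul_comm, Complex.norm_exp_ofReal_mul_I]

lemma conj_char (k : Fin d → ℤ) (x : Fin d → ℝ) : conj (char k x) = char (-k) x := by
  rw [char, char, ← Complex.exp_conj, map_mul, Complex.conj_I, Complex.conj_ofReal]
  simp

lemma continuous_char (k : Fin d → ℤ) : Continuous (char k) := by
  unfold char; fun_prop

/-- Periodicity with respect to `(2πℤ)^d`. -/
def IsPeriodic {E : Type*} (f : (Fin d → ℝ) → E) : Prop :=
  ∀ x i, f (x + Pi.single i (2 * π)) = f x

lemma isPeriodic_char (k : Fin d → ℤ) : IsPeriodic (char k) := by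
  intro x i
  have e : (∑ l, (k l : ℝ) * (x + Pi.single i (2 * π) : Fin d → ℝ) l : ℝ)
      = (∑ l, (k l : ℝ) * x l) + k i * (2 * π) := by
    simp [Pi.single_apply, mul_add, Finset.sum_add_distrib]
  rw [char, char, e, Complex.ofReal_add, mul_add, Complex.exp_add]
  have h2 : Complex.exp (Complex.I * ((k i * (2 * π) : ℝ) : ℂ)) = 1 := by
    rw [Complex.exp_eq_one_iff]
    exact ⟨k i, by push_cast; ring⟩
  rw [h2, mul_one]

/-- The fundamental box `[0, 2π]^d`. -/
def box (d : ℕ) : Set (Fin d → ℝ) := Set.Icc (0 : Fin d → ℝ) (fun _ => 2 * π)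

/-- The normalized Lebesgue measure on the box. -/
def boxMeasure (d : ℕ) : Measure (Fin d → ℝ) :=
  ENNReal.ofReal ((2 * π) ^ d)⁻¹ • volume.restrict (box d)

lemma integral_boxMeasure {E : Type*} [NormedAddCommGroup E] [NormedSpace ℝ E]
    (f : (Fin d → ℝ) → E) :
    ∫ x, f x ∂boxMeasure d = ((2 * π) ^ d)⁻¹ • ∫ x in box d, f x := by
  rw [boxMeasure, integral_smul_measure, ENNReal.toReal_ofReal (by positivity)]

lemma integral_box {E : Type*} [NormedAddCommGroup E] [NormedSpace ℝ E] (f : (Fin d → ℝ) → E) :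
    ∫ x in box d, f x = (2 * π) ^ d • ∫ x, f x ∂boxMeasure d := by
  rw [integral_boxMeasure, smul_smul, mul_inv_cancel₀ (by positivity), one_smul]

lemma volume_box : volume (box d) = ENNReal.ofReal ((2 * π) ^ d) := by
  rw [box, Real.volume_Icc_pi, ENNReal.ofReal_pow (by positivity)]
  simp

instance : IsProbabilityMeasure (boxMeasure d) := by
  constructor
  rw [boxMeasure, Measure.smul_apply, Measure.restrict_apply MeasurableSet.univ, Set.univ_inter,
    volume_box, smul_eq_mul, ← ENNReal.ofReal_mul (by positivity),
    inv_mul_cancel₀ (by positivity), ENNReal.ofReal_one]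

lemma integrable_boxMeasure {E : Type*} [NormedAddCommGroup E] [NormedSpace ℝ E]
    {f : (Fin d → ℝ) → E} (hf : Continuous f) : Integrable f (boxMeasure d) :=
  (hf.continuousOn.integrableOn_compact isCompact_Icc).smul_measure ENNReal.ofReal_ne_top

lemma integral_char (k : Fin d → ℤ) :
    ∫ x, char k x ∂boxMeasure d = if k = 0 then 1 else 0 := by
  split_ifs with h
  · subst h; simp [char_zero]
  · rw [integral_boxMeasure]
    obtain ⟨i, hi⟩ : ∃ i, k i ≠ 0 := by
      by_contra! h'; exact h (funext h')
    have e : ∀ x : Fin d → ℝ, char k x = ∏ l, Complex.exp (Complex.I * ((k l : ℝ) * x l : ℝ)) := by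
      intro x
      rw [char, ← Complex.exp_sum, ← Finset.mul_sum, Complex.ofReal_sum]
    have hbox : volume.restrict (box d)
        = Measure.pi fun _ : Fin d => (volume : Measure ℝ).restrict (Set.Icc 0 (2 * π)) := by
      rw [← Measure.restrict_pi_pi, Set.pi_univ_Icc]; rfl
    simp only [e]
    rw [hbox, integral_fintype_prod_eq_prod (fun l (y : ℝ) =>
      Complex.exp (Complex.I * ((k l : ℝ) * y : ℝ))), Finset.prod_eq_zero (Finset.mem_univ i),
      smul_zero]
    rw [integral_Icc_eq_integral_Ioc, ← intervalIntegral.integral_of_le (by positivity)]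
    have hc : Complex.I * (k i : ℂ) ≠ 0 := mul_ne_zero Complex.I_ne_zero (by exact_mod_cast hi)
    have h1 : ∀ y : ℝ, Complex.exp (Complex.I * ((k i : ℝ) * y : ℝ))
        = Complex.exp (Complex.I * (k i : ℂ) * y) := fun y => by push_cast; ring_nf
    simp only [h1]
    rw [integral_exp_mul_complex hc]
    have h2 : Complex.exp (Complex.I * (k i : ℂ) * ((2 * π : ℝ) : ℂ)) = 1 := by
      rw [Complex.exp_eq_one_iff]; exact ⟨k i, by push_cast; ring⟩
    rw [h2]; simp

/-- The Fourier coefficients. -/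
def fc (f : (Fin d → ℝ) → ℂ) (k : Fin d → ℤ) : ℂ := ∫ x, f x * char (-k) x ∂boxMeasure d

lemma fc_add {f g : (Fin d → ℝ) → ℂ} (hf : Continuous f) (hg : Continuous g) (k : Fin d → ℤ) :
    fc (fun x => f x + g x) k = fc f k + fc g k := by
  simp only [fc, add_mul]
  exact integral_add (integrable_boxMeasure (hf.mul (continuous_char _)))
    (integrable_boxMeasure (hg.mul (continuous_char _)))

lemma fc_const_mul (c : ℂ) (f : (Fin d → ℝ) → ℂ) (k : Fin d → ℤ) :
    fc (fun x => c * f x) k = c * fc f k := by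
  simp only [fc, mul_assoc]
  exact integral_const_mul c _

lemma fc_mul_char (f : (Fin d → ℝ) → ℂ) (k l : Fin d → ℤ) :
    fc (fun x => f x * char l x) k = fc f (k - l) := by
  simp only [fc, mul_assoc, ← char_add]
  congr 1; ext x; congr 2; abel

lemma fc_one (k : Fin d → ℤ) : fc (fun _ => 1) k = if k = 0 then 1 else 0 := by
  simp only [fc, one_mul, integral_char, neg_eq_zero]

lemma conj_fc (f : (Fin d → ℝ) → ℂ) (k : Fin d → ℤ) :
    conj (fc f k) = fc (fun x => conj (f x)) (-k) := by
  rw [fc, fc, ← integral_conj]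
  simp only [map_mul, conj_char]

lemma norm_fc_le {f : (Fin d → ℝ) → ℂ} {B : ℝ} (hf : ∀ x, ‖f x‖ ≤ B) (k : Fin d → ℤ) :
    ‖fc f k‖ ≤ B := by
  have := norm_integral_le_of_norm_le_const (μ := boxMeasure d)
    (f := fun x => f x * char (-k) x) (C := B)
    (Filter.Eventually.of_forall fun x => by rw [norm_mul, norm_char, mul_one]; exact hf x)
  simpa [fc] using this

/-- Bessel's inequality. -/
lemma bessel {f : (Fin d → ℝ) → ℂ} (hf : Continuous f) {B : ℝ} (hB : ∀ x, ‖f x‖ ≤ B) :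
    L2Bound (fun k => ‖fc f k‖) B := by
  have hB0 : 0 ≤ B := (norm_nonneg _).trans (hB 0)
  have hmem : ∀ {g : (Fin d → ℝ) → ℂ} {A : ℝ}, Continuous g → (∀ x, ‖g x‖ ≤ A) →
      MemLp g 2 (boxMeasure d) := fun hg hA =>
    MemLp.of_bound hg.aestronglyMeasurable _ (Filter.Eventually.of_forall hA)
  have hch : ∀ k : Fin d → ℤ, MemLp (char k) 2 (boxMeasure d) := fun k =>
    hmem (continuous_char k) (fun x => (norm_char k x).le)
  set v : (Fin d → ℤ) → Lp ℂ 2 (boxMeasure d) := fun k => (hch k).toLp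
  have hin : ∀ (k : Fin d → ℤ) {g : (Fin d → ℝ) → ℂ} (hg : MemLp g 2 (boxMeasure d)),
      inner ℂ (v k) hg.toLp = fc g k := by
    intro k g hg
    rw [L2.inner_def, fc]
    apply integral_congr_ae
    filter_upwards [(hch k).coeFn_toLp, hg.coeFn_toLp] with x h1 h2
    rw [h1, h2, RCLike.inner_apply, conj_char]
  have hv : Orthonormal ℂ v := by
    rw [orthonormal_iff_ite]
    intro k l
    rw [hin k (hch l), show char l = fun x => 1 * char l x by simp, fc_mul_char, fc_one]
    simp [sub_eq_zero]
  refine ⟨hB0, fun F => ?_⟩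
  have h := hv.sum_inner_products_le (hmem hf hB).toLp (s := F)
  simp only [hin] at h
  refine h.trans (pow_le_pow_left₀ (norm_nonneg _) ?_ 2)
  have h3 := Lp.norm_le_of_ae_bound (f := (hmem hf hB).toLp) hB0 (by
    filter_upwards [(hmem hf hB).coeFn_toLp] with x hx
    rw [hx]; exact hB x)
  simpa [measureUnivNNReal] using h3

/-! ### Absolutely convergent Fourier series -/

/-- The Fourier series with coefficients `c`. -/
def ser (c : (Fin d → ℤ) → ℂ) (x : Fin d → ℝ) : ℂ := ∑' k, c k * char k x

lemma summable_ser {c : (Fin d → ℤ) → ℂ} (hc : Summable fun k => ‖c k‖) (x : Fin d → ℝ) : Summable fun k => c k * char k x :=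
  Summable.of_norm (by simpa [norm_char] using hc)

lemma continuous_ser {c : (Fin d → ℤ) → ℂ} (hc : Summable fun k => ‖c k‖) : Continuous (ser c) :=
  continuous_tsum (fun k => continuous_const.mul (continuous_char k)) hc
    fun k x => by rw [norm_mul, norm_char, mul_one]

lemma norm_ser_le {c : (Fin d → ℤ) → ℂ} (hc : Summable fun k => ‖c k‖)
    (x : Fin d → ℝ) : ‖ser c x‖ ≤ ∑' k, ‖c k‖ := by
  have := norm_tsum_le_tsum_norm (f := fun k => c k * char k x)
    (by simpa [norm_char] using hc)
  simpa [norm_char, ser] using this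

lemma fc_mul_ser {c : (Fin d → ℤ) → ℂ} (hc : Summable fun k => ‖c k‖)
    {f : (Fin d → ℝ) → ℂ} (hf : Continuous f) (k : Fin d → ℤ) :
    fc (fun x => f x * ser c x) k = ∑' l, c l * fc f (k - l) := by
  obtain ⟨K, hK⟩ := (isCompact_Icc (a := (0 : Fin d → ℝ)) (b := fun _ => 2 * π)).exists_bound_of_continuousOn
    hf.continuousOn
  have e : ∀ x, f x * ser c x * char (-k) x = ∑' l, c l * (f x * char (-(k - l)) x) := by
    intro x
    rw [ser, ← tsum_mul_left, ← tsum_mul_right]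
    congr 1; ext l
    rw [neg_sub, sub_eq_add_neg, char_add]; ring
  rw [fc]
  simp only [e]
  rw [← integral_tsum_of_summable_integral_norm]
  · congr 1; ext l; exact integral_const_mul _ _
  · exact fun l => integrable_boxMeasure (continuous_const.mul (hf.mul (continuous_char _)))
  · simp only [norm_mul, norm_char, mul_one]
    simp only [integral_const_mul]
    exact hc.mul_right _

lemma isPeriodic_ser (c : (Fin d → ℤ) → ℂ) : IsPeriodic (ser c) := by
  intro x i; simp only [ser, isPeriodic_char _ x i]

lemma fc_ser {c : (Fin d → ℤ) → ℂ} (hc : Summable fun k => ‖c k‖) (k : Fin d → ℤ) :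
    fc (ser c) k = c k := by
  have := fc_mul_ser hc (f := fun _ => 1) continuous_const k
  simp only [one_mul, fc_one] at this
  change fc (fun x => ser c x) k = c k
  rw [this, tsum_eq_single k]
  · simp
  · intro l hl; simp [sub_eq_zero, hl.symm]

lemma conj_ser (c : (Fin d → ℤ) → ℂ) (x : Fin d → ℝ) :
    conj (ser c x) = ser (fun k => conj (c (-k))) x := by
  rw [ser, ser, Complex.conj_tsum, ← (Equiv.neg _).tsum_eq]
  simp [conj_char]

lemma hasFDerivAt_char (k : Fin d → ℤ) (x : Fin d → ℝ) :
    HasFDerivAt (char k) ((Complex.I * char k x) •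
      Complex.ofRealCLM.comp (∑ i, (k i : ℝ) • ContinuousLinearMap.proj (R := ℝ) (φ := fun _ => ℝ) i)) x := by
  have h1 : HasFDerivAt (fun x : Fin d → ℝ => (∑ i, (k i : ℝ) * x i : ℝ))
      (∑ i, (k i : ℝ) • ContinuousLinearMap.proj (R := ℝ) (φ := fun _ => ℝ) i) x := by
    refine HasFDerivAt.fun_sum fun i _ => ?_
    exact (hasFDerivAt_apply i x).const_mul _
  have h2 := (Complex.ofRealCLM.hasFDerivAt.comp x h1).const_mul Complex.I |>.cexp
  refine h2.congr_fderiv ?_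
  ext v
  simp [char]
  ring

lemma hasFDerivAt_ser {c : (Fin d → ℤ) → ℂ} (hc : Summable fun k => jap k * ‖c k‖)
    (x : Fin d → ℝ) :
    ∃ L : (Fin d → ℝ) →L[ℝ] ℂ, HasFDerivAt (ser c) L x ∧
      ∀ i, L (Pi.single i 1) = ser (fun k => Complex.I * k i * c k) x := by
  set f' : (Fin d → ℤ) → (Fin d → ℝ) → (Fin d → ℝ) →L[ℝ] ℂ := fun k x =>
    c k • ((Complex.I * char k x) • Complex.ofRealCLM.comp
      (∑ i, (k i : ℝ) • ContinuousLinearMap.proj (R := ℝ) (φ := fun _ => ℝ) i))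
  have hb : ∀ k x, ‖f' k x‖ ≤ d * (jap k * ‖c k‖) := by
    intro k x
    refine ContinuousLinearMap.opNorm_le_bound _ (by have := jap_pos k; positivity) fun v => ?_
    have h1 : ‖(∑ i, (k i : ℝ) * v i : ℝ)‖ ≤ d * (jap k * ‖v‖) := by
      refine (norm_sum_le _ _).trans ?_
      calc _ ≤ ∑ i : Fin d, jap k * ‖v‖ := by
            refine Finset.sum_le_sum fun i _ => ?_
            rw [norm_mul]
            have := jap_pos k
            exact mul_le_mul (abs_le_jap k i) (norm_le_pi_norm v i) (norm_nonneg _) this.le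
        _ = _ := by simp
    have h2 : f' k x v = c k * (Complex.I * char k x * ((∑ i, (k i : ℝ) * v i : ℝ) : ℂ)) := by
      simp [f']
    rw [h2, norm_mul, norm_mul, norm_mul, Complex.norm_I, norm_char, Complex.norm_real]
    calc _ = ‖c k‖ * ‖(∑ i, (k i : ℝ) * v i : ℝ)‖ := by ring
      _ ≤ ‖c k‖ * (d * (jap k * ‖v‖)) := by gcongr
      _ = _ := by ring
  have hsum : Summable fun k => (d : ℝ) * (jap k * ‖c k‖) := hc.mul_left _
  have hc' : Summable fun k => ‖c k‖ := by
    refine Summable.of_nonneg_of_le (fun k => norm_nonneg _) (fun k => ?_) hc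
    exact le_mul_of_one_le_left (norm_nonneg _) (one_le_jap k)
  refine ⟨∑' k, f' k x, ?_, fun i => ?_⟩
  · exact hasFDerivAt_tsum hsum (fun k x => (hasFDerivAt_char k x).const_mul (c k)) hb
      (summable_ser hc' 0) x
  · have hs : Summable fun k => f' k x := Summable.of_norm_bounded hsum fun k => hb k x
    have := ((ContinuousLinearMap.apply ℝ ℂ (Pi.single i 1 : Fin d → ℝ)).map_tsum hs)
    simp only [ContinuousLinearMap.apply_apply] at this
    rw [this, ser]
    congr 1; ext k
    simp [f', Pi.single_apply]
    ring

/-! ### Integration by parts -/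

lemma integral_partial_eq_zero {G : (Fin d → ℝ) → ℂ} {G' : (Fin d → ℝ) → (Fin d → ℝ) →L[ℝ] ℂ}
    (hG : ∀ x, HasFDerivAt G (G' x) x) (hp : IsPeriodic G) (i : Fin d)
    (hc : Continuous fun x => G' x (Pi.single i 1)) :
    ∫ x in box d, G' x (Pi.single i 1) = 0 := by
  obtain ⟨n, rfl⟩ : ∃ n, d = n + 1 := ⟨d - 1, by have := i.pos; omega⟩
  have hGc : Continuous G := continuous_iff_continuousAt.2 fun x => (hG x).continuousAt
  have key := integral_divergence_of_hasFDerivAt_off_countable' (E := ℂ) (0 : Fin (n + 1) → ℝ)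
    (fun _ => 2 * π) (fun _ => by positivity) (fun j => if j = i then G else 0)
    (fun j => if j = i then G' else 0) ∅ Set.countable_empty
    (fun j => by split_ifs <;> [exact hGc.continuousOn; exact continuousOn_const])
    (fun x _ j => by
      split_ifs with h
      · simpa using hG x
      · simpa using! hasFDerivAt_const (0 : ℂ) x) ?_
  · have e1 : ∀ x : Fin (n + 1) → ℝ, ∑ j, (if j = i then G' else 0) x (Pi.single j 1)
        = G' x (Pi.single i 1) := by
      intro x
      rw [Finset.sum_eq_single i]
      · simp
      · intro j _ hj; simp [hj]
      · simp
    simp only [e1] at key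
    rw [box, key]
    apply Finset.sum_eq_zero
    intro j _
    by_cases hj : j = i
    · subst hj
      simp only [if_true]
      rw [sub_eq_zero]
      congr 1; ext y
      rw [← hp (j.insertNth ((0 : Fin (n + 1) → ℝ) j) y) j]
      congr 1
      ext l
      refine Fin.succAboveCases j ?_ (fun m => ?_) l
      · simp
      · simp [Fin.succAbove_ne]
    · simp [hj]
  · have e1 : ∀ x : Fin (n + 1) → ℝ, ∑ j, (if j = i then G' else 0) x (Pi.single j 1)
        = G' x (Pi.single i 1) := by
      intro x
      rw [Finset.sum_eq_single i]
      · simp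
      · intro j _ hj; simp [hj]
      · simp
    simp only [e1]
    exact hc.continuousOn.integrableOn_compact isCompact_Icc

lemma fc_partial {f : (Fin d → ℝ) → ℂ} {f' : (Fin d → ℝ) → (Fin d → ℝ) →L[ℝ] ℂ}
    (hf : ∀ x, HasFDerivAt f (f' x) x) (hp : IsPeriodic f) (i : Fin d)
    (hc : Continuous fun x => f' x (Pi.single i 1)) (k : Fin d → ℤ) :
    fc (fun x => f' x (Pi.single i 1)) k = Complex.I * k i * fc f k := by
  have hfc : Continuous f := continuous_iff_continuousAt.2 fun x => (hf x).continuousAt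
  have hG := fun x => (hf x).mul (hasFDerivAt_char (-k) x)
  have hval : ∀ x, (f x • ((Complex.I * char (-k) x) • Complex.ofRealCLM.comp
      (∑ i, ((-k) i : ℝ) • ContinuousLinearMap.proj (R := ℝ) (φ := fun _ => ℝ) i))
      + char (-k) x • f' x) (Pi.single i 1)
      = f' x (Pi.single i 1) * char (-k) x - Complex.I * k i * (f x * char (-k) x) := by
    intro x; simp [Pi.single_apply]; ring
  have h := integral_partial_eq_zero hG (fun x i => by
    simp only [Pi.mul_apply, hp x i, isPeriodic_char (-k) x i]) i (by
    simp only [hval]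
    exact (hc.mul (continuous_char _)).sub
      (continuous_const.mul (hfc.mul (continuous_char _))))
  simp only [hval] at h
  rw [integral_box, integral_sub, integral_const_mul, smul_eq_zero] at h
  · exact sub_eq_zero.1 (h.resolve_left (by positivity))
  · exact integrable_boxMeasure (hc.mul (continuous_char _))
  · exact integrable_boxMeasure (continuous_const.mul (hfc.mul (continuous_char _)))

/-! ### Sobolev bounds and multipliers -/

/-- `f` has `H^σ`-norm at most `F`. -/
def SobolevBound (σ : ℝ) (f : (Fin d → ℝ) → ℂ) (F : ℝ) : Prop :=
  L2Bound (fun k => jap k ^ σ * ‖fc f k‖) F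

namespace SobolevBound

variable {σ F F' : ℝ} {f g : (Fin d → ℝ) → ℂ}

lemma add (hf : SobolevBound σ f F) (hg : SobolevBound σ g F') (cf : Continuous f)
    (cg : Continuous g) : SobolevBound σ (fun x => f x + g x) (F + F') := by
  refine (L2Bound.add hf hg).mono_of_nonneg (fun k => by have := jap_pos k; positivity)
    fun k => ?_
  rw [fc_add cf cg, ← mul_add]
  have := jap_pos k
  gcongr
  exact norm_add_le _ _

lemma const_mul (hf : SobolevBound σ f F) (c : ℂ) :
    SobolevBound σ (fun x => c * f x) (‖c‖ * F) := by
  have := L2Bound.const_mul hf ‖c‖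
  rw [abs_of_nonneg (norm_nonneg c)] at this
  refine this.mono_of_nonneg (fun k => by have := jap_pos k; positivity) fun k => ?_
  rw [fc_const_mul, norm_mul]
  exact le_of_eq (by ring)

lemma mono_right (hf : SobolevBound σ f F) (h : F ≤ F') : SobolevBound σ f F' :=
  L2Bound.mono_right hf h

lemma mono_left {σ' : ℝ} (hf : SobolevBound σ f F) (h : σ' ≤ σ) : SobolevBound σ' f F := by
  refine L2Bound.mono_of_nonneg hf (fun k => by have := jap_pos k; positivity) fun k => ?_
  gcongr
  exact one_le_jap k

end SobolevBound

lemma sobolevBound_one (σ : ℝ) : SobolevBound (d := d) σ (fun _ => 1) 1 := by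
  refine ⟨zero_le_one, fun F => ?_⟩
  have e : ∀ k : Fin d → ℤ, (jap k ^ σ * ‖fc (fun _ => 1) k‖) ^ 2 = if k = 0 then 1 else 0 := by
    intro k
    rw [fc_one]
    split_ifs with h
    · subst h; simp [jap_zero]
    · simp
  simp only [e, Finset.sum_ite_eq']
  split_ifs <;> norm_num

/-- `f` acts by multiplication on `H^σ`, `0 ≤ σ ≤ r`, with norm at most `B`. -/
structure IsMult (r : ℝ) (f : (Fin d → ℝ) → ℂ) (B : ℝ) : Prop where
  cont : Continuous f
  per : IsPeriodic f
  nonneg : 0 ≤ B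
  sup : ∀ x, ‖f x‖ ≤ B
  mult : ∀ (σ : ℝ) (u : (Fin d → ℝ) → ℂ) (F : ℝ), 0 ≤ σ → σ ≤ r → Continuous u →
    SobolevBound σ u F → SobolevBound σ (fun x => u x * f x) (B * F)

namespace IsMult

variable {r B B' : ℝ} {f g : (Fin d → ℝ) → ℂ}

lemma mono (hf : IsMult r f B) (h : B ≤ B') : IsMult r f B' where
  cont := hf.cont
  per := hf.per
  nonneg := hf.nonneg.trans h
  sup x := (hf.sup x).trans h
  mult σ u F h0 h1 cu hu := (hf.mult σ u F h0 h1 cu hu).mono_right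
    (mul_le_mul_of_nonneg_right h hu.1)

lemma mono_left {r' : ℝ} (hf : IsMult r f B) (h : r' ≤ r) : IsMult r' f B where
  cont := hf.cont
  per := hf.per
  nonneg := hf.nonneg
  sup := hf.sup
  mult σ u F h0 h1 cu hu := hf.mult σ u F h0 (h1.trans h) cu hu

lemma add (hf : IsMult r f B) (hg : IsMult r g B') : IsMult r (fun x => f x + g x) (B + B') where
  cont := hf.cont.add hg.cont
  per x i := by simp only [hf.per x i, hg.per x i]
  nonneg := add_nonneg hf.nonneg hg.nonneg
  sup x := (norm_add_le _ _).trans (add_le_add (hf.sup x) (hg.sup x))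
  mult σ u F h0 h1 cu hu := by
    have := (hf.mult σ u F h0 h1 cu hu).add (hg.mult σ u F h0 h1 cu hu) (cu.mul hf.cont)
      (cu.mul hg.cont)
    simpa only [mul_add, add_mul] using this

lemma mul (hf : IsMult r f B) (hg : IsMult r g B') : IsMult r (fun x => f x * g x) (B * B') where
  cont := hf.cont.mul hg.cont
  per x i := by simp only [hf.per x i, hg.per x i]
  nonneg := mul_nonneg hf.nonneg hg.nonneg
  sup x := by
    rw [norm_mul]; exact mul_le_mul (hf.sup x) (hg.sup x) (norm_nonneg _) hf.nonneg
  mult σ u F h0 h1 cu hu := by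
    have := hg.mult σ _ _ h0 h1 (cu.mul hf.cont) (hf.mult σ u F h0 h1 cu hu)
    simp only [Pi.mul_apply, mul_assoc] at this ⊢
    rwa [mul_left_comm]

lemma const (r : ℝ) (c : ℂ) : IsMult (d := d) r (fun _ => c) ‖c‖ where
  cont := continuous_const
  per _ _ := rfl
  nonneg := norm_nonneg c
  sup _ := le_rfl
  mult σ u F _ _ _ hu := by simpa only [mul_comm] using hu.const_mul c

lemma sobolevBound (hf : IsMult r f B) (hr : 0 ≤ r) : SobolevBound r f B := by
  simpa using hf.mult r _ _ hr le_rfl continuous_const (sobolevBound_one r)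

end IsMult

/-- The constant in the product estimate. -/
def multConst (d : ℕ) (r : ℝ) : ℝ := 2 ^ r * (2 * embConst d)

lemma isMult_ser {r : ℝ} (hr : d ≤ r) {c : (Fin d → ℤ) → ℂ} {B : ℝ}
    (hc : L2Bound (fun k => jap k ^ r * ‖c k‖) B) : IsMult r (ser c) (multConst d r * B) := by
  obtain ⟨hs, ht⟩ := summable_of_l2Bound hr (fun k => norm_nonneg (c k)) hc
  have hr0 : 0 ≤ r := d.cast_nonneg.trans hr
  have hle : embConst d ≤ multConst d r := by
    have h1 : (1 : ℝ) ≤ 2 ^ r := one_le_rpow one_le_two hr0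
    have h2 := one_le_embConst d
    unfold multConst; nlinarith
  refine ⟨continuous_ser hs, isPeriodic_ser c, mul_nonneg ((embConst_pos d).le.trans hle) hc.1,
    fun x => (norm_ser_le hs x).trans (ht.trans (mul_le_mul_of_nonneg_right hle hc.1)),
    fun σ u F h0 h1 cu hu => ?_⟩
  refine (L2Bound.sobolev_conv h0 h1 hr (fun k => norm_nonneg (c k)) (fun k => norm_nonneg (fc u k))
    hc hu).mono_of_nonneg (fun k => by have := jap_pos k; positivity) fun k => ?_
  have hj := jap_pos k
  gcongr
  rw [fc_mul_ser hs cu]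
  obtain ⟨K, hK⟩ := (isCompact_Icc (a := (0 : Fin d → ℝ)) (b := fun _ => 2 * π)).exists_bound_of_continuousOn
    cu.continuousOn
  have hub : L2Bound (fun k => ‖fc u k‖) F := L2Bound.mono_of_nonneg hu (fun k => norm_nonneg _)
    fun k => le_mul_of_one_le_left (norm_nonneg _) (one_le_rpow (one_le_jap k) h0)
  have hsum := L2Bound.summable_conv (fun k => norm_nonneg (c k)) hs hub k
  have := norm_tsum_le_tsum_norm (f := fun l => c l * fc u (k - l)) (by simpa using hsum)
  simpa using this

/-! ### Composition with smooth functions -/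

/-- The derivatives of a smooth function near `0` that vanishes at `0` to order `k`. -/
def FlatJet (δ : ℝ) (φ : ℕ → ℝ → ℝ) (k : ℕ) : Prop :=
  ∀ i, (∀ y, |y| ≤ δ → HasDerivAt (φ i) (φ (i + 1) y) y) ∧
    ∃ C, 0 ≤ C ∧ ∀ y, |y| ≤ δ → |φ i y| ≤ C * |y| ^ (k - i)

lemma FlatJet.shift {δ : ℝ} {φ : ℕ → ℝ → ℝ} {k : ℕ} (h : FlatJet δ φ k) :
    FlatJet δ (fun i => φ (i + 1)) (k - 1) := fun i => by
  have := h (i + 1)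
  rwa [show k - (i + 1) = k - 1 - i by omega] at this

/-- A real function of size `B` whose partial derivatives are multipliers of size `B`. -/
structure IsPhase (r B : ℝ) (h : (Fin d → ℝ) → ℝ) (h' : (Fin d → ℝ) → (Fin d → ℝ) →L[ℝ] ℝ) :
    Prop where
  deriv : ∀ x, HasFDerivAt h (h' x) x
  per : IsPeriodic h
  bound : ∀ x, |h x| ≤ B
  mult : ∀ i, IsMult r (fun x => ((h' x (Pi.single i 1) : ℝ) : ℂ)) B

lemma SobolevBound.of_partial {σ F F' : ℝ} {f : (Fin d → ℝ) → ℂ}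
    {f' : (Fin d → ℝ) → (Fin d → ℝ) →L[ℝ] ℂ} (hf : ∀ x, HasFDerivAt f (f' x) x)
    (hp : IsPeriodic f) (hc : ∀ i, Continuous fun x => f' x (Pi.single i 1))
    (h0 : SobolevBound (σ - 1) f F) (hF' : 0 ≤ F')
    (h1 : ∀ i, SobolevBound (σ - 1) (fun x => f' x (Pi.single i 1)) F') :
    SobolevBound σ f (F + d * F') := by
  refine ⟨by have := h0.1; positivity, fun G => ?_⟩
  have e : ∀ k : Fin d → ℤ, (jap k ^ σ * ‖fc f k‖) ^ 2 = (jap k ^ (σ - 1) * ‖fc f k‖) ^ 2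
      + ∑ i, (jap k ^ (σ - 1) * ‖fc (fun x => f' x (Pi.single i 1)) k‖) ^ 2 := by
    intro k
    have hk := jap_pos k
    have e1 : jap k ^ σ = jap k ^ (σ - 1) * jap k := by
      rw [← rpow_add_one hk.ne']; congr 1; ring
    have e2 : ∀ i, ‖fc (fun x => f' x (Pi.single i 1)) k‖ ^ 2 = (k i : ℝ) ^ 2 * ‖fc f k‖ ^ 2 := by
      intro i
      rw [fc_partial hf hp i (hc i), norm_mul, norm_mul, Complex.norm_I, one_mul,
        Complex.norm_intCast, mul_pow, sq_abs]
    simp only [mul_pow, e2, e1, ← Finset.mul_sum, ← Finset.sum_mul, jap_sq]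
    ring
  simp only [e, Finset.sum_add_distrib]
  rw [Finset.sum_comm]
  have h2 : ∑ i : Fin d, ∑ k ∈ G, (jap k ^ (σ - 1) * ‖fc (fun x => f' x (Pi.single i 1)) k‖) ^ 2
      ≤ d * F' ^ 2 := by
    calc _ ≤ ∑ i : Fin d, F' ^ 2 := Finset.sum_le_sum fun i _ => (h1 i).2 G
      _ = _ := by simp
  have h3 := h0.2 G
  have hF := h0.1
  have h4 : (d : ℝ) * F' ^ 2 ≤ (d * F') ^ 2 := by
    have : (d : ℝ) ≤ d ^ 2 := by exact_mod_cast Nat.le_self_pow (by norm_num) d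
    rw [mul_pow]; gcongr
  have h5 : 0 ≤ F * (d * F') := by positivity
  nlinarith

/-- Smooth functions vanishing at `0` to order `k` act on small functions of `H^{r+1}`. -/
theorem exists_comp_bound {r δ : ℝ} (hr : 0 ≤ r) (n : ℕ) : ∀ (k : ℕ) (φ : ℕ → ℝ → ℝ),
    FlatJet δ φ k → ∃ C, 0 ≤ C ∧ ∀ (σ B : ℝ) (h : (Fin d → ℝ) → ℝ)
      (h' : (Fin d → ℝ) → (Fin d → ℝ) →L[ℝ] ℝ), σ ≤ n → σ ≤ r + 1 → B ≤ 1 → B ≤ δ →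
      IsPhase r B h h' → SobolevBound σ (fun x => ((φ 0 (h x) : ℝ) : ℂ)) (C * B ^ k) := by
  have hbase : ∀ (k : ℕ) (φ : ℕ → ℝ → ℝ), FlatJet δ φ k → ∃ C, 0 ≤ C ∧
      ∀ (B : ℝ) (h : (Fin d → ℝ) → ℝ) (h' : (Fin d → ℝ) → (Fin d → ℝ) →L[ℝ] ℝ), B ≤ δ →
      IsPhase r B h h' → (∀ x, HasFDerivAt (fun x => ((φ 0 (h x) : ℝ) : ℂ))
        (Complex.ofRealCLM.comp (φ 1 (h x) • h' x)) x) ∧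
        ∀ x, ‖((φ 0 (h x) : ℝ) : ℂ)‖ ≤ C * B ^ k := by
    intro k φ hφ
    obtain ⟨hd, C, hC, hb⟩ := hφ 0
    refine ⟨C, hC, fun B h h' hB hh => ⟨fun x => ?_, fun x => ?_⟩⟩
    · exact Complex.ofRealCLM.hasFDerivAt.comp x
        ((hd (h x) ((hh.bound x).trans hB)).comp_hasFDerivAt x (hh.deriv x))
    · rw [Complex.norm_real]
      refine (hb _ ((hh.bound x).trans hB)).trans ?_
      have := hh.bound x
      simp only [Nat.sub_zero]
      gcongr
  induction n with
  | zero =>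
    intro k φ hφ
    obtain ⟨C, hC, hb⟩ := hbase k φ hφ
    refine ⟨C, hC, fun σ B h h' hσ _ _ hB hh => ?_⟩
    obtain ⟨hd, hs⟩ := hb B h h' hB hh
    have hc : Continuous (fun x => ((φ 0 (h x) : ℝ) : ℂ)) :=
      continuous_iff_continuousAt.2 fun x => (hd x).continuousAt
    refine (bessel hc hs).mono_of_nonneg (fun k => by have := jap_pos k; positivity) fun k => ?_
    exact mul_le_of_le_one_left (norm_nonneg _)
      (rpow_le_one_of_one_le_of_nonpos (one_le_jap k) (by simpa using hσ))
  | succ n ih =>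
    intro k φ hφ
    obtain ⟨C₀, hC₀, h0⟩ := ih k φ hφ
    obtain ⟨C₁, hC₁, h1⟩ := ih (k - 1) _ hφ.shift
    obtain ⟨_, _, hb⟩ := hbase k φ hφ
    obtain ⟨_, _, hb1⟩ := hbase (k - 1) _ hφ.shift
    refine ⟨C₀ + d * C₁, by positivity, fun σ B h h' hσ hσr hB1 hB hh => ?_⟩
    obtain ⟨hd, -⟩ := hb B h h' hB hh
    obtain ⟨hd1, -⟩ := hb1 B h h' hB hh
    have hc1 : Continuous (fun x => ((φ 1 (h x) : ℝ) : ℂ)) :=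
      continuous_iff_continuousAt.2 fun x => (hd1 x).continuousAt
    have hB0 : 0 ≤ B := (abs_nonneg _).trans (hh.bound 0)
    have e1 : max σ 1 - 1 ≤ n := by
      push_cast at hσ
      have : max σ 1 ≤ n + 1 := max_le hσ (by have := n.cast_nonneg (α := ℝ); linarith)
      linarith
    have e2 : max σ 1 - 1 ≤ r := by
      have : max σ 1 ≤ r + 1 := max_le hσr (by linarith)
      linarith
    have hval : ∀ x i, (Complex.ofRealCLM.comp (φ 1 (h x) • h' x)) (Pi.single i 1)
        = ((φ 1 (h x) : ℝ) : ℂ) * ((h' x (Pi.single i 1) : ℝ) : ℂ) := by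
      intro x i; simp
    have key := SobolevBound.of_partial (σ := max σ 1) hd (fun x i => by simp only [hh.per x i])
      (fun i => by simp only [hval]; exact hc1.mul (hh.mult i).cont)
      (h0 _ B h h' e1 (by linarith) hB1 hB hh) (F' := C₁ * B ^ k) (by positivity) (fun i => by
        simp only [hval]
        refine ((hh.mult i).mult _ _ _ (by linarith [le_max_right σ 1]) e2 hc1
          (h1 _ B h h' e1 (by linarith) hB1 hB hh)).mono_right ?_
        rcases k with _ | k
        · simp only [Nat.zero_sub, pow_zero, mul_one]; nlinarith
        · rw [Nat.add_sub_cancel, pow_succ]; exact le_of_eq (by ring))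
    refine (key.mono_left (le_max_left σ 1)).mono_right (le_of_eq (by ring))

/-! ### Jets of the nonlinearity -/

lemma abs_le_of_deriv_le {f f' : ℝ → ℝ} {δ C : ℝ} {n : ℕ} (hC : 0 ≤ C) (h0 : f 0 = 0)
    (hd : ∀ y, |y| ≤ δ → HasDerivAt f (f' y) y) (hb : ∀ y, |y| ≤ δ → |f' y| ≤ C * |y| ^ n)
    (y : ℝ) (hy : |y| ≤ δ) : |f y| ≤ C * |y| ^ (n + 1) := by
  have hmem : ∀ z ∈ Set.Icc (-|y|) |y|, |z| ≤ |y| := fun z hz => abs_le.2 hz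
  have := Convex.norm_image_sub_le_of_norm_hasDerivWithin_le (f := f) (f' := f')
    (s := Set.Icc (-|y|) |y|) (C := C * |y| ^ n)
    (fun z hz => (hd z ((hmem z hz).trans hy)).hasDerivWithinAt)
    (fun z hz => (hb z ((hmem z hz).trans hy)).trans (by have := hmem z hz; gcongr))
    (convex_Icc _ _) (x := 0) (y := y) (by simp) ⟨neg_abs_le y, le_abs_self y⟩
  simpa [h0, pow_succ, mul_assoc] using this

/-- The remainder of the second order Taylor expansion of `g` at `m`, with its derivatives. -/
def taylorJet (g : ℝ → ℝ) (m : ℝ) : ℕ → ℝ → ℝ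
  | 0 => fun y => g (m + y) - deriv g m * y - iteratedDeriv 2 g m / 2 * y ^ 2
  | 1 => fun y => iteratedDeriv 1 g (m + y) - deriv g m - iteratedDeriv 2 g m * y
  | 2 => fun y => iteratedDeriv 2 g (m + y) - iteratedDeriv 2 g m
  | n + 3 => fun y => iteratedDeriv (n + 3) g (m + y)

lemma hasDerivAt_iteratedDeriv {g : ℝ → ℝ} (hg : ContDiffOn ℝ ∞ g (Set.Ioi 0)) (n : ℕ) {x : ℝ}
    (hx : 0 < x) : HasDerivAt (iteratedDeriv n g) (iteratedDeriv (n + 1) g x) x := by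
  rw [iteratedDeriv_succ]
  apply DifferentiableAt.hasDerivAt
  have h1 := hg.differentiableOn_iteratedDerivWithin (m := n)
    (by exact_mod_cast ENat.natCast_lt_top n) isOpen_Ioi.uniqueDiffOn
  have h2 : DifferentiableAt ℝ (iteratedDerivWithin n g (Set.Ioi 0)) x :=
    (h1 x hx).differentiableAt (isOpen_Ioi.mem_nhds hx)
  refine h2.congr_of_eventuallyEq ?_
  filter_upwards [isOpen_Ioi.mem_nhds hx] with y hy
  exact (iteratedDerivWithin_of_isOpen isOpen_Ioi hy).symm

lemma flatJet_taylorJet {g : ℝ → ℝ} (hg : ContDiffOn ℝ ∞ g (Set.Ioi 0)) {m : ℝ} (hm : 0 < m)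
    (hgm : g m = 0) : FlatJet (m / 2) (taylorJet g m) 3 := by
  have hpos : ∀ y, |y| ≤ m / 2 → 0 < m + y := fun y hy => by
    have := (abs_le.1 hy).1; linarith
  have hit : ∀ n y, |y| ≤ m / 2 → HasDerivAt (fun y => iteratedDeriv n g (m + y))
      (iteratedDeriv (n + 1) g (m + y)) y := fun n y hy => by
    simpa using (hasDerivAt_iteratedDeriv hg n (hpos y hy)).comp_const_add m y
  have hbd : ∀ n, ∃ C, 0 ≤ C ∧ ∀ y, |y| ≤ m / 2 → |iteratedDeriv n g (m + y)| ≤ C := fun n => by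
    obtain ⟨C, hC⟩ := (isCompact_Icc (a := -(m / 2)) (b := m / 2)).exists_bound_of_continuousOn
      (f := fun y => iteratedDeriv n g (m + y)) (fun y hy =>
        (hit n y (abs_le.2 hy)).continuousAt.continuousWithinAt)
    exact ⟨C, (norm_nonneg _).trans (hC 0 (by constructor <;> linarith)),
      fun y hy => hC y (abs_le.1 hy)⟩
  have h1 : iteratedDeriv 1 g m = deriv g m := by rw [iteratedDeriv_one]
  have d0 : ∀ y, |y| ≤ m / 2 → HasDerivAt (taylorJet g m 0) (taylorJet g m 1 y) y := by
    intro y hy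
    have := ((hit 0 y hy).sub ((hasDerivAt_id y).const_mul (deriv g m))).sub
      (((hasDerivAt_id y).pow 2).const_mul (iteratedDeriv 2 g m / 2))
    simp only [iteratedDeriv_zero] at this
    refine this.congr_deriv ?_
    simp [taylorJet]
    ring
  have d1 : ∀ y, |y| ≤ m / 2 → HasDerivAt (taylorJet g m 1) (taylorJet g m 2 y) y := by
    intro y hy
    have := ((hit 1 y hy).sub_const (deriv g m)).sub
      ((hasDerivAt_id y).const_mul (iteratedDeriv 2 g m))
    refine this.congr_deriv ?_
    simp [taylorJet]
  have d2 : ∀ y, |y| ≤ m / 2 → HasDerivAt (taylorJet g m 2) (taylorJet g m 3 y) y := by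
    intro y hy
    exact (hit 2 y hy).sub_const _
  obtain ⟨C, hC, b3⟩ := hbd 3
  have b2 := abs_le_of_deriv_le (f := taylorJet g m 2) hC (by simp [taylorJet]) d2 (n := 0)
    (fun y hy => by simpa [taylorJet] using b3 y hy)
  have b1 := abs_le_of_deriv_le (f := taylorJet g m 1) hC (by simp [taylorJet]) d1 (n := 1) b2
  have b0 := abs_le_of_deriv_le (f := taylorJet g m 0) hC (by simp [taylorJet, hgm]) d0 (n := 2) b1
  intro i
  match i with
  | 0 => exact ⟨d0, C, hC, b0⟩
  | 1 => exact ⟨d1, C, hC, b1⟩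
  | 2 => exact ⟨d2, C, hC, b2⟩
  | n + 3 =>
    refine ⟨fun y hy => hit (n + 3) y hy, ?_⟩
    obtain ⟨C, hC, b⟩ := hbd (n + 3)
    refine ⟨C, hC, fun y hy => ?_⟩
    simpa [taylorJet, show 3 - (n + 3) = 0 by omega] using b y hy

/-! ### Functions with coefficients in `H^s` -/

/-- The normalization `(2π)^{-d/2}` of the Fourier basis. -/
def normConst (d : ℕ) : ℝ := (2 * π) ^ (-(d : ℝ) / 2)

lemma normConst_pos (d : ℕ) : 0 < normConst d := rpow_pos_of_pos (by positivity) _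

lemma normConst_sq (d : ℕ) : normConst d ^ 2 * (2 * π) ^ d = 1 := by
  have h : (0 : ℝ) < 2 * π := by positivity
  rw [normConst, ← rpow_natCast, ← rpow_mul h.le, ← rpow_natCast (2 * π) d, ← rpow_add h]
  norm_num

/-- Extension by zero of a sequence on the nonzero modes. -/
def extend (z : Seq d) (k : Fin d → ℤ) : ℂ := if h : k ≠ 0 then z ⟨k, h⟩ else 0

lemma extend_coe (z : Seq d) (j : Mode d) : extend z j.1 = z j := by
  simp [extend, j.2]

lemma extend_zero (z : Seq d) : extend z 0 = 0 := by simp [extend]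

lemma tsum_mode {E : Type*} [AddCommMonoid E] [TopologicalSpace E]
    {f : (Fin d → ℤ) → E} (hf : f 0 = 0) : ∑' j : Mode d, f j.1 = ∑' k, f k := by
  apply Function.Injective.tsum_eq (Subtype.val_injective (p := fun j : Fin d → ℤ => j ≠ 0))
  intro k hk
  have : k ≠ 0 := by
    rintro rfl; exact hk hf
  exact ⟨⟨k, this⟩, rfl⟩

lemma toFun_eq (z : Seq d) : toFun z = ser fun k => (normConst d : ℂ) * extend z k := by
  ext x
  rw [toFun, ser]
  simp only [mul_assoc, tsum_mul_left]
  rw [← tsum_mode (f := fun k => extend z k * char k x) (by simp [extend_zero])]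
  simp only [extend_coe]
  rfl

/-- The sequence `z` has `H^s`-norm at most `B`. -/
def SeqBound (s : ℝ) (z : Seq d) (B : ℝ) : Prop :=
  L2Bound (fun j : Mode d => jap j.1 ^ s * ‖z j‖) B

lemma L2Bound.of_mode {f : (Fin d → ℤ) → ℝ} {B : ℝ} (hf : f 0 = 0)
    (h : L2Bound (fun j : Mode d => f j.1) B) : L2Bound f B := by
  refine ⟨h.1, fun F => ?_⟩
  have := h.2 (F.subtype fun k => k ≠ 0)
  rw [Finset.sum_subtype_eq_sum_filter (f := fun k => f k ^ 2)] at this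
  rwa [Finset.sum_filter_of_ne] at this
  rintro k - hk rfl
  exact hk (by simp [hf])

lemma SeqBound.extend {s B : ℝ} {z : Seq d} (h : SeqBound s z B) :
    L2Bound (fun k => jap k ^ s * ‖(normConst d : ℂ) * extend z k‖) (normConst d * B) := by
  apply L2Bound.of_mode
  · simp [extend_zero]
  have := L2Bound.const_mul h (normConst d)
  rw [abs_of_pos (normConst_pos d)] at this
  refine this.mono_of_nonneg (fun k => by have := jap_pos k.1; positivity) fun k => le_of_eq ?_
  rw [norm_mul, extend_coe, Complex.norm_real, Real.norm_eq_abs, abs_of_pos (normConst_pos d)]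
  ring

/-- The constant relating the size of a sequence to the size of its function. -/
def funConst (d : ℕ) (s : ℝ) : ℝ := (multConst d s + multConst d (s - 1)) * normConst d

lemma multConst_pos (d : ℕ) (s : ℝ) : 0 < multConst d s := by
  have := embConst_pos d
  unfold multConst; positivity

lemma funConst_pos (d : ℕ) (s : ℝ) : 0 < funConst d s := by
  have := multConst_pos d s
  have := multConst_pos d (s - 1)
  have := normConst_pos d
  unfold funConst; positivity

lemma L2Bound.neg {f : (Fin d → ℤ) → ℝ} {B : ℝ} (h : L2Bound f B) :
    L2Bound (fun k => f (-k)) B := h.comp_injective neg_injective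

lemma IsMult.of_ser {r B : ℝ} (hr : d ≤ r) {c : (Fin d → ℤ) → ℂ}
    (hc : L2Bound (fun k => jap k ^ r * ‖c k‖) B) {K : ℝ} (hK : multConst d r * B ≤ K) :
    IsMult r (ser c) K ∧ IsMult r (fun x => conj (ser c x)) K := by
  refine ⟨(isMult_ser hr hc).mono hK, ?_⟩
  have h1 : (fun x => conj (ser c x)) = ser fun k => conj (c (-k)) := by
    ext x; exact conj_ser c x
  rw [h1]
  refine (isMult_ser hr (B := B) ?_).mono hK
  simpa [jap_neg] using hc.neg

lemma SeqBound.isMult_toFun {s B : ℝ} (hs : d + 1 ≤ s) {z : Seq d} (h : SeqBound s z B) :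
    IsMult s (toFun z) (funConst d s * B) ∧
      IsMult s (fun x => conj (toFun z x)) (funConst d s * B) := by
  rw [toFun_eq]
  refine IsMult.of_ser (by linarith) h.extend ?_
  have := multConst_pos d (s - 1)
  have h1 := normConst_pos d
  have h2 := h.1
  have : 0 ≤ multConst d (s - 1) * (normConst d * B) := by positivity
  unfold funConst; linarith

lemma SeqBound.exists_deriv_toFun {s B : ℝ} (hs : d + 1 ≤ s) {z : Seq d} (h : SeqBound s z B) :
    ∃ L : (Fin d → ℝ) → (Fin d → ℝ) →L[ℝ] ℂ, (∀ x, HasFDerivAt (toFun z) (L x) x) ∧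
      ∀ i, IsMult (s - 1) (fun x => L x (Pi.single i 1)) (funConst d s * B) ∧
        IsMult (s - 1) (fun x => conj (L x (Pi.single i 1))) (funConst d s * B) := by
  set c : (Fin d → ℤ) → ℂ := fun k => (normConst d : ℂ) * QHD.extend z k
  have hc : L2Bound (fun k => jap k ^ s * ‖c k‖) (normConst d * B) := h.extend
  have hsplit : ∀ k : Fin d → ℤ, jap k ^ s = jap k ^ (s - 1) * jap k := fun k => by
    rw [← rpow_add_one (jap_pos k).ne']; congr 1; ring
  have hsum : Summable fun k => jap k * ‖c k‖ := by
    refine (summable_of_l2Bound (r := s - 1) (B := normConst d * B) (by linarith)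
      (fun k => by have := jap_pos k; positivity) ?_).1
    simpa only [hsplit, mul_assoc] using hc
  choose L hL hL' using fun x => hasFDerivAt_ser hsum x
  refine ⟨L, by rw [toFun_eq]; exact hL, fun i => ?_⟩
  have e : (fun x => L x (Pi.single i 1)) = ser fun k => Complex.I * k i * c k := by
    ext x; exact hL' x i
  have e' : (fun x => conj (L x (Pi.single i 1)))
      = fun x => conj (ser (fun k => Complex.I * k i * c k) x) := by
    ext x; rw [hL' x i]
  rw [e, e']
  refine IsMult.of_ser (B := normConst d * B) (by linarith) ?_ ?_
  · refine hc.mono_of_nonneg (fun k => by have := jap_pos k; positivity) fun k => ?_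
    have := jap_pos k
    rw [norm_mul, norm_mul, Complex.norm_I, one_mul, Complex.norm_intCast, hsplit, mul_assoc]
    gcongr
    exact abs_le_jap k i
  · have := multConst_pos d s
    have h1 := normConst_pos d
    have h2 := h.1
    have : 0 ≤ multConst d s * (normConst d * B) := by positivity
    unfold funConst; linarith

lemma SeqBound.summable_sq {s B : ℝ} (hs : 0 ≤ s) {z : Seq d} (h : SeqBound s z B) :
    Summable (fun j => ‖z j‖ ^ 2) ∧ ∑' j, ‖z j‖ ^ 2 ≤ B ^ 2 := by
  have h1 : L2Bound (fun j => ‖z j‖) B := L2Bound.mono_of_nonneg h (fun j => norm_nonneg _)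
    fun j => le_mul_of_one_le_left (norm_nonneg _) (one_le_rpow (one_le_jap _) hs)
  exact ⟨h1.summable_sq, h1.tsum_sq_le⟩

lemma IsMult.const_mul {r B : ℝ} {f : (Fin d → ℝ) → ℂ} (hf : IsMult r f B) (c : ℝ) :
    IsMult r (fun x => (c : ℂ) * f x) (|c| * B) := by
  simpa using (IsMult.const r (c : ℂ)).mul hf

lemma IsMult.ofReal (r c : ℝ) : IsMult (d := d) r (fun _ => (c : ℂ)) |c| := by
  simpa using IsMult.const (d := d) r (c : ℂ)

/-- The nonlinearity `g(|α + z|²)(α + z)`. -/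
def nonlin (g : ℝ → ℝ) (m τ : ℝ) (z : Seq d) (x : Fin d → ℝ) : ℂ :=
  (g (‖(zeroMode m τ z : ℂ) + toFun z x‖ ^ 2) : ℂ) * ((zeroMode m τ z : ℂ) + toFun z x)

/-- The real part of `z(x)`. -/
def rePart (z : Seq d) (x : Fin d → ℝ) : ℂ := ((toFun z x).re : ℂ)

/-- The quadratic part of the nonlinearity. -/
def quadPart (g : ℝ → ℝ) (m : ℝ) (z : Seq d) (x : Fin d → ℝ) : ℂ :=
  (√m : ℂ) * (((deriv g m : ℝ) : ℂ) * (toFun z x * conj (toFun z x) + 2 * toFun z x * rePart z x)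
    + 2 * (m : ℂ) * ((iteratedDeriv 2 g m : ℝ) : ℂ) * rePart z x ^ 2)

lemma rePart_eq (z : Seq d) (x : Fin d → ℝ) :
    rePart z x = ((1 / 2 : ℝ) : ℂ) * (toFun z x + conj (toFun z x)) := by
  rw [rePart, Complex.re_eq_add_conj]; push_cast; ring

lemma SeqBound.isMult_rePart {s B : ℝ} (hs : d + 1 ≤ s) {z : Seq d} (h : SeqBound s z B) :
    IsMult s (rePart z) (funConst d s * B) := by
  obtain ⟨h1, h2⟩ := h.isMult_toFun hs
  have e : rePart z = fun x => ((1 / 2 : ℝ) : ℂ) * (toFun z x + conj (toFun z x)) := by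
    ext x; exact rePart_eq z x
  rw [e]
  refine ((h1.add h2).const_mul (1 / 2)).mono (le_of_eq ?_)
  rw [abs_of_pos (by norm_num)]; ring

/-- Estimates on the zero mode. -/
lemma zeroMode_bounds {m τ q : ℝ} (hm : 0 < m) (hq : 0 ≤ q) (hτq : τ * q ≤ m) (hτ : 0 ≤ τ) :
    √(m - τ * q) ^ 2 = m - τ * q ∧ √(m - τ * q) ≤ √m ∧
      |√(m - τ * q) - √m| ≤ τ * q / √m := by
  have h1 : √(m - τ * q) ^ 2 = m - τ * q := Real.sq_sqrt (by linarith)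
  have h2 : √m ^ 2 = m := Real.sq_sqrt hm.le
  have h3 : √(m - τ * q) ≤ √m := Real.sqrt_le_sqrt (by nlinarith)
  have h4 := Real.sqrt_nonneg (m - τ * q)
  have h5 := Real.sqrt_pos.2 hm
  refine ⟨h1, h3, ?_⟩
  rw [abs_of_nonpos (by linarith), le_div_iff₀ h5]
  nlinarith

set_option maxHeartbeats 1000000 in
/-- Second order expansion of the nonlinearity. -/
theorem exists_nonlin_expansion (d : ℕ) {m τ s : ℝ} {g : ℝ → ℝ} (hm : 0 < m) (hτ : 0 < τ)
    (hg : ContDiffOn ℝ ∞ g (Set.Ioi 0)) (hgm : g m = 0) (hs : d + 1 ≤ s) :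
    ∃ ε C : ℝ, 0 < ε ∧ 0 < C ∧ ∀ (z : Seq d) (B : ℝ), B ≤ ε → SeqBound s z B →
      τ * ∑' j, ‖z j‖ ^ 2 ≤ m / 2 ∧
      (∀ x, |‖(zeroMode m τ z : ℂ) + toFun z x‖ ^ 2 - m| ≤ m / 2) ∧
      Continuous (nonlin g m τ z) ∧ IsMult s (quadPart g m z) (C * B ^ 2) ∧
      ∃ (c : ℂ) (R : (Fin d → ℝ) → ℂ), ‖c‖ ≤ C * B ^ 2 ∧ Continuous R ∧
        SobolevBound s R (C * B ^ 3) ∧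
        ∀ x, nonlin g m τ z x
          = 2 * (m * deriv g m : ℝ) * rePart z x + quadPart g m z x + c + R x := by
  set K := funConst d s
  have hK : 0 < K := funConst_pos d s
  set g₁ := deriv g m
  set g₂ := iteratedDeriv 2 g m
  have hsm : 0 < √m := Real.sqrt_pos.2 hm
  have hs0 : 0 ≤ s := by have := d.cast_nonneg (α := ℝ); linarith
  set t : ℝ := τ / K ^ 2
  have ht : 0 < t := by positivity
  set K₂ : ℝ := t + 2 * √m + 2
  set K₄ : ℝ := 2 * (t / √m) + 1 + t
  set K₅ : ℝ := t / √m
  have hK₂ : 0 < K₂ := by positivity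
  have hK₄ : 0 < K₄ := by positivity
  have hK₅ : 0 < K₅ := by positivity
  obtain ⟨C₃, hC₃, hcomp⟩ := exists_comp_bound (d := d) (r := s - 1) (δ := m / 2)
    (by have := d.cast_nonneg (α := ℝ); linarith) ⌈s⌉₊ 3 _ (flatJet_taylorJet hg hm hgm)
  set Cq : ℝ := √m * (|g₁| * 3 + 2 * m * |g₂|)
  set Cr : ℝ := (√m + 1) * (C₃ * K₂ ^ 3) + (|g₁| * (4 * √m * K₅ + K₄ * K₅ + K₄)
    + |g₂ / 2| * (√m * (4 * √m * K₄ + K₄ * K₄) + K₂ * K₂ * (K₅ + 1)))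
  have hCq : 0 ≤ Cq := by positivity
  have hCr : 0 ≤ Cr := by positivity
  set C : ℝ := 1 + Cq * K ^ 2 + Cr * K ^ 3 + |g₁| * √m * τ
  refine ⟨min (1 / K) (min (1 / (K * K₂)) (min (m / 2 / (K * K₂)) (√(m / 2 / τ)))), C, ?_,
    by positivity, fun z B hB hz => ?_⟩
  · refine lt_min (by positivity) (lt_min (by positivity) (lt_min (by positivity) ?_))
    exact Real.sqrt_pos.2 (by positivity)
  have hB0 : 0 ≤ B := hz.1
  set b := K * B
  have hb0 : 0 ≤ b := by positivity
  have hb1 : b ≤ 1 := by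
    have := hB.trans (min_le_left _ _)
    rw [le_div_iff₀ hK] at this; linarith
  have hb2 : K₂ * b ≤ 1 := by
    have := hB.trans ((min_le_right _ _).trans (min_le_left _ _))
    rw [le_div_iff₀ (by positivity)] at this
    calc K₂ * b = B * (K * K₂) := by ring
      _ ≤ 1 := this
  have hb3 : K₂ * b ≤ m / 2 := by
    have := hB.trans ((min_le_right _ _).trans ((min_le_right _ _).trans (min_le_left _ _)))
    rw [le_div_iff₀ (by positivity)] at this
    calc K₂ * b = B * (K * K₂) := by ring
      _ ≤ _ := this
  have hb4 : τ * B ^ 2 ≤ m / 2 := by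
    have := hB.trans ((min_le_right _ _).trans ((min_le_right _ _).trans (min_le_right _ _)))
    have := pow_le_pow_left₀ hB0 this 2
    rw [Real.sq_sqrt (by positivity), le_div_iff₀ hτ] at this
    linarith
  have hbb : b ^ 2 ≤ b := by nlinarith
  obtain ⟨hzs, hzq⟩ := hz.summable_sq hs0
  set q := ∑' j, ‖z j‖ ^ 2
  have hq0 : 0 ≤ q := tsum_nonneg fun _ => sq_nonneg _
  have hτq : τ * q ≤ t * b ^ 2 := by
    have : t * b ^ 2 = τ * B ^ 2 := by simp only [t, b]; field_simp
    rw [this]; gcongr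
  have hτq2 : τ * q ≤ m / 2 := (mul_le_mul_of_nonneg_left hzq hτ.le).trans hb4
  set α := zeroMode m τ z
  obtain ⟨hα2, hαle, hδ⟩ := zeroMode_bounds (τ := τ) hm hq0 (by linarith) hτ.le
  change α ^ 2 = _ at hα2
  change α ≤ _ at hαle
  change |α - √m| ≤ _ at hδ
  have hα0 : 0 ≤ α := Real.sqrt_nonneg _
  set δ := α - √m with hδdef
  have hδ2 : |δ| ≤ K₅ * b ^ 2 := hδ.trans (by
    simp only [K₅]; rw [div_mul_eq_mul_div]; gcongr)
  have hδ1 : |δ| ≤ K₅ * b := hδ2.trans (by gcongr)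
  obtain ⟨mz, mzc⟩ := hz.isMult_toFun hs
  have mX := hz.isMult_rePart hs
  change IsMult s (toFun z) b at mz
  change IsMult s (fun x => conj (toFun z x)) b at mzc
  change IsMult s (rePart z) b at mX
  obtain ⟨L, hL, hLm⟩ := hz.exists_deriv_toFun hs
  set h : (Fin d → ℝ) → ℝ := fun x => ‖(α : ℂ) + toFun z x‖ ^ 2 - m with hh
  have hnorm : ∀ x, h x = -(τ * q) + 2 * α * (toFun z x).re + ‖toFun z x‖ ^ 2 := by
    intro x
    simp only [hh, ← Complex.normSq_eq_norm_sq, Complex.normSq_apply, Complex.add_re,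
      Complex.add_im, Complex.ofReal_re, Complex.ofReal_im]
    linear_combination hα2
  set Y : (Fin d → ℝ) → ℂ := fun x => ((2 * δ : ℝ) : ℂ) * rePart z x
    + (toFun z x * conj (toFun z x) + ((-(τ * q) : ℝ) : ℂ)) with hY
  have hhY : ∀ x, (h x : ℂ) = ((2 * √m : ℝ) : ℂ) * rePart z x + Y x := by
    intro x
    rw [hnorm, hY]
    simp only [Complex.mul_conj, Complex.normSq_eq_norm_sq, hδdef, rePart]
    push_cast; ring
  have mY2 : IsMult s Y (K₄ * b ^ 2) := by
    refine ((mX.const_mul (2 * δ)).add ((mz.mul mzc).add (IsMult.ofReal s (-(τ * q))))).mono ?_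
    rw [abs_mul, abs_two, abs_neg, abs_of_nonneg (by positivity : 0 ≤ τ * q)]
    have h1 : |δ| * b ≤ K₅ * b ^ 2 := by
      calc |δ| * b ≤ K₅ * b ^ 2 * 1 := mul_le_mul hδ2 hb1 hb0 (by positivity)
        _ = _ := mul_one _
    have : K₄ * b ^ 2 = 2 * (K₅ * b ^ 2) + b ^ 2 + t * b ^ 2 := by simp only [K₄, K₅]; ring
    rw [this]
    linarith [show 2 * |δ| * b = 2 * (|δ| * b) by ring, show b * b = b ^ 2 by ring]
  have mY1 : IsMult s Y (K₄ * b) := mY2.mono (by gcongr)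
  have mh : IsMult s (fun x => (h x : ℂ)) (K₂ * b) := by
    have e : (fun x => (h x : ℂ)) = fun x => ((-(τ * q) : ℝ) : ℂ) + (((2 * α : ℝ) : ℂ) * rePart z x
        + toFun z x * conj (toFun z x)) := by
      ext x
      rw [hnorm, Complex.mul_conj, Complex.normSq_eq_norm_sq, rePart]; push_cast; ring
    rw [e]
    refine ((IsMult.ofReal s (-(τ * q))).add ((mX.const_mul (2 * α)).add (mz.mul mzc))).mono ?_
    rw [abs_neg, abs_of_nonneg (by positivity : 0 ≤ τ * q), abs_of_nonneg (by positivity : 0 ≤ 2 * α)]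
    have h1 : α * b ≤ √m * b := by gcongr
    have h2 : t * b ^ 2 ≤ t * b := by gcongr
    have : K₂ * b = t * b + 2 * (√m * b) + 2 * b := by simp only [K₂]; ring
    rw [this]
    linarith [show 2 * α * b = 2 * (α * b) by ring, show b * b = b ^ 2 by ring]
  set h' : (Fin d → ℝ) → (Fin d → ℝ) →L[ℝ] ℝ := fun x =>
    (2 * α) • Complex.reCLM.comp (L x) +
      (2 * (toFun z x).re) • Complex.reCLM.comp (L x)
      + (2 * (toFun z x).im) • Complex.imCLM.comp (L x) with hh'
  have hderiv : ∀ x, HasFDerivAt h (h' x) x := by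
    intro x
    have hre : HasFDerivAt (fun x => (toFun z x).re) (Complex.reCLM.comp (L x)) x :=
      Complex.reCLM.hasFDerivAt.comp x (hL x)
    have him : HasFDerivAt (fun x => (toFun z x).im) (Complex.imCLM.comp (L x)) x :=
      Complex.imCLM.hasFDerivAt.comp x (hL x)
    have := ((hre.const_mul (2 * α)).const_add (-(τ * q))).add ((hre.pow 2).add (him.pow 2))
    have e : h = fun x => (-(τ * q) + 2 * α * (toFun z x).re)
        + ((toFun z x).re ^ 2 + (toFun z x).im ^ 2) := by
      ext x; rw [hnorm, ← Complex.normSq_eq_norm_sq, Complex.normSq_apply]; ring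
    rw [e]
    refine this.congr_fderiv ?_
    ext v; simp [hh']; ring
  have hphase : IsPhase (s - 1) (K₂ * b) h h' := by
    refine ⟨hderiv, fun x i => by simp only [hh, mz.per x i], fun x => ?_, fun i => ?_⟩
    · simpa using mh.sup x
    · obtain ⟨l1, l2⟩ := hLm i
      change IsMult _ _ b at l1
      change IsMult _ _ b at l2
      have e : (fun x => ((h' x (Pi.single i 1) : ℝ) : ℂ)) = fun x =>
          (α : ℂ) * (L x (Pi.single i 1) + conj (L x (Pi.single i 1)))
          + (conj (toFun z x) * L x (Pi.single i 1) + toFun z x * conj (L x (Pi.single i 1))) := by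
        ext x
        apply Complex.ext <;> simp [hh'] <;> ring
      rw [e]
      have n1 := mz.mono_left (show s - 1 ≤ s by linarith)
      have n2 := mzc.mono_left (show s - 1 ≤ s by linarith)
      refine (((l1.add l2).const_mul α).add ((n2.mul l1).add (n1.mul l2))).mono ?_
      rw [abs_of_nonneg hα0]
      have h1 : α * b ≤ √m * b := by gcongr
      have h2 : 0 ≤ t * b := by positivity
      have : K₂ * b = t * b + 2 * (√m * b) + 2 * b := by simp only [K₂]; ring
      rw [this]
      linarith [show α * (b + b) = 2 * (α * b) by ring, show b * b = b ^ 2 by ring]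
  have hφ := hcomp s (K₂ * b) h h' (Nat.le_ceil s) (by linarith) hb2 hb3 hphase
  have hφc : Continuous fun x => ((taylorJet g m 0 (h x) : ℝ) : ℂ) := by
    have hj := (flatJet_taylorJet hg hm hgm 0).1
    refine Complex.continuous_ofReal.comp (continuous_iff_continuousAt.2 fun x => ?_)
    exact ((hj (h x) ((hphase.bound x).trans hb3)).continuousAt).comp (hderiv x).continuousAt
  have hgh : ∀ x, (g (‖(α : ℂ) + toFun z x‖ ^ 2) : ℂ) = (taylorJet g m 0 (h x) : ℝ)
      + ((g₁ : ℂ) * (h x : ℂ) + ((g₂ / 2 : ℝ) : ℂ) * (h x : ℂ) ^ 2) := by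
    intro x
    have : g (‖(α : ℂ) + toFun z x‖ ^ 2) = taylorJet g m 0 (h x) + (g₁ * h x + g₂ / 2 * h x ^ 2) := by
      simp only [taylorJet, hh]
      rw [add_sub_cancel]; ring
    rw [this]; push_cast; ring
  set R₂ : (Fin d → ℝ) → ℂ := fun x => (g₁ : ℂ) * (((4 * √m : ℝ) : ℂ) * ((δ : ℂ) * rePart z x)
      + Y x * (δ : ℂ) + Y x * toFun z x)
      + ((g₂ / 2 : ℝ) : ℂ) * ((√m : ℂ) * (((4 * √m : ℝ) : ℂ) * (rePart z x * Y x) + Y x * Y x)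
        + (h x : ℂ) * (h x : ℂ) * ((δ : ℂ) + toFun z x)) with hR₂
  have mδ2 : IsMult (d := d) s (fun _ => (δ : ℂ)) (K₅ * b ^ 2) := (IsMult.ofReal s δ).mono hδ2
  have mδ1 : IsMult (d := d) s (fun _ => (δ : ℂ)) (K₅ * b) := (IsMult.ofReal s δ).mono hδ1
  have mR₂ : IsMult s R₂ ((|g₁| * (4 * √m * K₅ + K₄ * K₅ + K₄)
      + |g₂ / 2| * (√m * (4 * √m * K₄ + K₄ * K₄) + K₂ * K₂ * (K₅ + 1))) * b ^ 3) := by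
    refine ((((((mδ2.mul mX).const_mul (4 * √m)).add (mY2.mul mδ1)).add (mY2.mul mz)).const_mul
      g₁).add ((((((mX.mul mY2).const_mul (4 * √m)).add (mY2.mul mY1)).const_mul √m).add
      ((mh.mul mh).mul (mδ1.add mz))).const_mul (g₂ / 2))).mono (le_of_eq ?_)
    rw [abs_of_pos hsm, abs_of_pos (by positivity : 0 < 4 * √m)]
    ring
  have mαz : IsMult s (fun x => (α : ℂ) + toFun z x) (√m + 1) := by
    refine ((IsMult.ofReal s α).add mz).mono ?_
    rw [abs_of_nonneg hα0]; linarith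
  have bR₁ := mαz.mult s _ _ hs0 le_rfl hφc hφ
  refine ⟨hτq2, fun x => ?_, ?_, ?_, ((-(g₁ * √m * (τ * q)) : ℝ) : ℂ),
    fun x => (taylorJet g m 0 (h x) : ℝ) * ((α : ℂ) + toFun z x) + R₂ x, ?_,
    (hφc.mul mαz.cont).add mR₂.cont, ?_, fun x => ?_⟩
  · exact (hphase.bound x).trans hb3
  · have e : nonlin g m τ z = fun x => ((taylorJet g m 0 (h x) : ℝ)
      + ((g₁ : ℂ) * (h x : ℂ) + ((g₂ / 2 : ℝ) : ℂ) * (h x : ℂ) ^ 2)) * ((α : ℂ) + toFun z x) := by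
      ext x; rw [nonlin, hgh]
    rw [e]
    exact (hφc.add ((continuous_const.mul mh.cont).add (continuous_const.mul (mh.cont.pow 2)))).mul
      mαz.cont
  · have e : quadPart g m z = fun x => (√m : ℂ) * ((g₁ : ℂ) * (toFun z x * conj (toFun z x)
        + ((2 : ℝ) : ℂ) * (toFun z x * rePart z x))
        + ((2 * m : ℝ) : ℂ) * ((g₂ : ℂ) * (rePart z x * rePart z x))) := by
      ext x; rw [quadPart]; push_cast; ring
    rw [e]
    refine (((((mz.mul mzc).add ((mz.mul mX).const_mul 2)).const_mul g₁).add
      (((mX.mul mX).const_mul g₂).const_mul (2 * m))).const_mul √m).mono ?_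
    rw [abs_of_pos hsm, abs_two, abs_of_pos (by positivity : 0 < 2 * m)]
    have e1 : √m * (|g₁| * (b * b + 2 * (b * b)) + 2 * m * (|g₂| * (b * b)))
        = Cq * K ^ 2 * B ^ 2 := by simp only [Cq, b]; ring
    rw [e1]
    gcongr
    have : 0 ≤ Cr * K ^ 3 + |g₁| * √m * τ := by positivity
    simp only [C]; linarith
  · rw [Complex.norm_real, Real.norm_eq_abs, abs_neg, abs_mul, abs_mul, abs_of_pos hsm,
      abs_of_nonneg (by positivity : 0 ≤ τ * q)]
    calc |g₁| * √m * (τ * q) ≤ |g₁| * √m * (τ * B ^ 2) := by gcongr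
      _ = |g₁| * √m * τ * B ^ 2 := by ring
      _ ≤ C * B ^ 2 := by
        gcongr
        have : 0 ≤ 1 + Cq * K ^ 2 + Cr * K ^ 3 := by positivity
        simp only [C]; linarith
  · refine (bR₁.add (mR₂.sobolevBound hs0) (hφc.mul mαz.cont) mR₂.cont).mono_right ?_
    have e1 : (√m + 1) * (C₃ * (K₂ * b) ^ 3) + (|g₁| * (4 * √m * K₅ + K₄ * K₅ + K₄)
      + |g₂ / 2| * (√m * (4 * √m * K₄ + K₄ * K₄) + K₂ * K₂ * (K₅ + 1))) * b ^ 3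
        = Cr * K ^ 3 * B ^ 3 := by simp only [Cr, b]; ring
    rw [e1]
    gcongr
    have : 0 ≤ 1 + Cq * K ^ 2 + |g₁| * √m * τ := by positivity
    simp only [C]; linarith
  · have hsq : (√m : ℂ) ^ 2 = m := by exact_mod_cast Real.sq_sqrt hm.le
    have hαδ : (α : ℂ) = (√m : ℂ) + (δ : ℂ) := by rw [hδdef]; push_cast; ring
    rw [nonlin, hgh]
    simp only [quadPart, hR₂]
    rw [hhY]
    have hYx : Y x = 2 * (δ : ℂ) * rePart z x + (toFun z x * conj (toFun z x) - τ * q) := by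
      simp only [hY]; push_cast; ring
    rw [hαδ]
    generalize hT : ((taylorJet g m 0 (h x) : ℝ) : ℂ) = T
    push_cast
    set X := rePart z x
    set Z := toFun z x
    have hzz : Z * conj Z = Y x - 2 * (δ : ℂ) * X + τ * q := by rw [hYx]; ring
    rw [hzz]
    linear_combination (2 * (g₁ : ℂ) * X + (g₂ : ℂ) * (2 * X ^ 2 * √m)) * hsq

/-! ### Derivative of the Hamiltonian -/

/-- The real differential of `η ↦ ‖η‖²` at `y`. -/
def normSqDeriv (y : ℂ) : ℂ →L[ℝ] ℝ := (2 * y.re) • Complex.reCLM + (2 * y.im) • Complex.imCLM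

lemma normSqDeriv_apply (y v : ℂ) : normSqDeriv y v = 2 * (conj y * v).re := by
  simp [normSqDeriv]; ring

lemma hasFDerivAt_normSq (y : ℂ) : HasFDerivAt (fun η : ℂ => ‖η‖ ^ 2) (normSqDeriv y) y := by
  have e : (fun η : ℂ => ‖η‖ ^ 2) = fun η => η.re ^ 2 + η.im ^ 2 := by
    ext η; rw [← Complex.normSq_eq_norm_sq, Complex.normSq_apply]; ring
  rw [e]
  have h1 := (Complex.reCLM.hasFDerivAt (x := y)).pow 2
  have h2 := (Complex.imCLM.hasFDerivAt (x := y)).pow 2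
  refine (h1.add h2).congr_fderiv ?_
  ext v; simp [normSqDeriv]

lemma norm_normSqDeriv_le (y : ℂ) : ‖normSqDeriv y‖ ≤ 2 * ‖y‖ := by
  refine ContinuousLinearMap.opNorm_le_bound _ (by positivity) fun v => ?_
  rw [normSqDeriv_apply, norm_mul, Real.norm_two, mul_assoc]
  have := Complex.abs_re_le_norm (conj y * v)
  rw [norm_mul, Complex.norm_conj] at this
  rw [Real.norm_eq_abs]; linarith

lemma continuous_normSqDeriv : Continuous normSqDeriv := by
  unfold normSqDeriv; fun_prop

lemma annulus_of_perturb {m : ℝ} {y η : ℂ} (hb : |‖y‖ ^ 2 - m| ≤ m / 2)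
    (hη : ‖η‖ ^ 2 ≤ m / 100) : ‖y + η‖ ^ 2 ∈ Set.Icc (m / 4) (2 * m) := by
  have h1 := norm_add_le y η
  have h2 : ‖y‖ ≤ ‖y + η‖ + ‖η‖ := by simpa using norm_sub_le (y + η) η
  have h3 := abs_le.1 hb
  have := norm_nonneg y
  have := norm_nonneg η
  have := norm_nonneg (y + η)
  constructor
  · have : ‖y‖ ^ 2 ≤ (‖y + η‖ + ‖η‖) ^ 2 := by gcongr
    nlinarith [sq_nonneg (‖y + η‖ - 10 * ‖η‖)]
  · have : ‖y + η‖ ^ 2 ≤ (‖y‖ + ‖η‖) ^ 2 := by gcongr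
    nlinarith [sq_nonneg (‖y‖ - 10 * ‖η‖)]

section
variable {V : Type*} [NormedAddCommGroup V] [NormedSpace ℝ V]

/-- Differentiation of `∫ G(|y + ℓ v|²)` with respect to `v`. -/
theorem hasFDerivAt_integral_normSq {m K : ℝ} {g G : ℝ → ℝ} (hm : 0 < m)
    (hg : ContinuousOn g (Set.Ioi 0)) (hG : ∀ x : ℝ, 0 < x → HasDerivAt G (g x) x)
    {y : (Fin d → ℝ) → ℂ} (hy : Continuous y) (hb : ∀ x, |‖y x‖ ^ 2 - m| ≤ m / 2)
    {l : (Fin d → ℝ) → V →L[ℝ] ℂ} (hl : Continuous l) (hK : ∀ x, ‖l x‖ ≤ K) :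
    Integrable (fun x => g (‖y x‖ ^ 2) • (normSqDeriv (y x)).comp (l x)) (boxMeasure d) ∧
    HasFDerivAt (fun v => ∫ x, G (‖y x + l x v‖ ^ 2) ∂boxMeasure d)
      (∫ x, g (‖y x‖ ^ 2) • (normSqDeriv (y x)).comp (l x) ∂boxMeasure d) 0 := by
  have hK0 : 0 ≤ K := (norm_nonneg _).trans (hK 0)
  have hIcc : Set.Icc (m / 4) (2 * m) ⊆ Set.Ioi 0 := fun t ht => lt_of_lt_of_le (by linarith) ht.1
  obtain ⟨Kg, hKg⟩ := (isCompact_Icc (a := m / 4) (b := 2 * m)).exists_bound_of_continuousOn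
    (hg.mono hIcc)
  have hKg0 : 0 ≤ Kg := (norm_nonneg _).trans (hKg m ⟨by linarith, by linarith⟩)
  have hGc : ContinuousOn G (Set.Ioi 0) := fun t ht => (hG t ht).continuousAt.continuousWithinAt
  set δ : ℝ := √(m / 100) / (K + 1) with hδ
  have hδ0 : 0 < δ := by positivity
  have hann : ∀ x, ∀ v ∈ Metric.ball (0 : V) δ,
      ‖y x + l x v‖ ^ 2 ∈ Set.Icc (m / 4) (2 * m) := by
    intro x v hv
    apply annulus_of_perturb (hb x)
    have h1 : ‖l x v‖ ≤ √(m / 100) := by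
      calc ‖l x v‖ ≤ ‖l x‖ * ‖v‖ := (l x).le_opNorm v
        _ ≤ (K + 1) * δ := by
          gcongr
          · linarith [hK x]
          · exact (mem_ball_zero_iff.1 hv).le
        _ = _ := by rw [hδ]; field_simp
    calc ‖l x v‖ ^ 2 ≤ √(m / 100) ^ 2 := by gcongr
      _ = _ := Real.sq_sqrt (by positivity)
  have hder : ∀ x, ∀ v ∈ Metric.ball (0 : V) δ, HasFDerivAt (fun v => G (‖y x + l x v‖ ^ 2))
      (g (‖y x + l x v‖ ^ 2) • (normSqDeriv (y x + l x v)).comp (l x)) v := by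
    intro x v hv
    have h1 : HasFDerivAt (fun v => y x + l x v) (l x) v := (l x).hasFDerivAt.const_add _
    exact (hG _ (hIcc (hann x v hv))).comp_hasFDerivAt v ((hasFDerivAt_normSq _).comp v h1)
  have h0 : (0 : V) ∈ Metric.ball (0 : V) δ := Metric.mem_ball_self hδ0
  have hcont : ∀ v ∈ Metric.ball (0 : V) δ, Continuous fun x => G (‖y x + l x v‖ ^ 2) :=
    fun v hv => hGc.comp_continuous (by fun_prop) fun x => hIcc (hann x v hv)
  have hF' : Continuous fun x => g (‖y x‖ ^ 2) • (normSqDeriv (y x)).comp (l x) := by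
    have h1 : Continuous fun x => g (‖y x‖ ^ 2) :=
      hg.comp_continuous (by fun_prop) fun x => by simpa using hIcc (hann x 0 h0)
    exact h1.smul ((continuous_normSqDeriv.comp hy).clm_comp hl)
  refine hasFDerivAt_integral_of_dominated_loc_of_lip' (s := Metric.ball 0 δ)
    (bound := fun _ => Kg * (2 * (2 * m + 1) * K))
    (Metric.ball_mem_nhds _ hδ0) (fun v hv => (hcont v hv).aestronglyMeasurable)
    (integrable_boxMeasure (hcont 0 h0)) hF'.aestronglyMeasurable
    (Filter.Eventually.of_forall fun x v hv => ?_) (integrable_const _)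
    (Filter.Eventually.of_forall fun x => by simpa using hder x 0 h0)
  refine (convex_ball (0 : V) δ).norm_image_sub_le_of_norm_hasFDerivWithin_le
    (fun w hw => (hder x w hw).hasFDerivWithinAt) (fun w hw => ?_) h0 hv
  have h2 := (hann x w hw).2
  rw [norm_smul]
  have h3 : ‖y x + l x w‖ ≤ 2 * m + 1 := by nlinarith [sq_nonneg (‖y x + l x w‖ - 1 / 2)]
  gcongr
  · exact hKg _ (hann x w hw)
  · refine (ContinuousLinearMap.opNorm_comp_le _ _).trans ?_
    gcongr
    · refine (norm_normSqDeriv_le _).trans (by gcongr)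
    · exact hK x
end

lemma Mode.neg_ne (j : Mode d) : j.neg ≠ j := by
  intro h
  have h1 : -j.1 = j.1 := congrArg Subtype.val h
  exact j.2 (self_eq_neg.1 h1.symm)

lemma Mode.neg_neg (j : Mode d) : j.neg.neg = j := Subtype.ext (_root_.neg_neg j.1)

/-- The sequence `z` with `p` added to the coefficient `j` and `q` to the coefficient `-j`. -/
def shift (z : Seq d) (j : Mode d) (p q : ℂ) : Seq d := fun k =>
  z k + if k = j then p else if k = j.neg then q else 0

lemma tsum_shift {E : Type*} [NormedAddCommGroup E] [CompleteSpace E] (f : Mode d → ℂ → E)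
    (z : Seq d) (hf : Summable fun k => f k (z k)) (j : Mode d) (p q : ℂ) :
    ∑' k, f k (shift z j p q k) = ∑' k, f k (z k)
      + ((f j (z j + p) - f j (z j)) + (f j.neg (z j.neg + q) - f j.neg (z j.neg))) := by
  have h : HasSum (fun k => f k (shift z j p q k) - f k (z k))
      ((f j (z j + p) - f j (z j)) + (f j.neg (z j.neg + q) - f j.neg (z j.neg))) := by
    have : HasSum (fun k => f k (shift z j p q k) - f k (z k)) _ :=
      hasSum_sum_of_ne_finset_zero (s := {j, j.neg}) fun k hk => by
        simp only [Finset.mem_insert, Finset.mem_singleton, not_or] at hk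
        simp [shift, hk.1, hk.2]
    rw [Finset.sum_pair j.neg_ne.symm] at this
    simpa [shift, j.neg_ne] using this
  have := (hf.hasSum.add h).tsum_eq
  simpa using this

/-- `∂K/∂z̄_k`, where `F` is the nonlinearity. -/
def zGrad (κ m τ : ℝ) (g : ℝ → ℝ) (a : Fin d → ℝ) (z : Seq d) (k : Mode d) : ℂ :=
  ((hbar κ / 2 * k.lenSq a : ℝ) : ℂ) * z k + ((1 / hbar κ : ℝ) : ℂ) *
    (((normConst d)⁻¹ : ℝ) * fc (nonlin g m τ z) k.1
      - ((τ / zeroMode m τ z * ((2 * π) ^ d * (fc (nonlin g m τ z) 0).re) : ℝ) : ℂ) * z k)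

lemma toFun_shift {z : Seq d} (hz : Summable fun k => ‖z k‖) (j : Mode d) (p q : ℂ)
    (x : Fin d → ℝ) : toFun (shift z j p q) x = toFun z x
      + (normConst d : ℂ) * (p * char j.1 x + q * char (-j.1) x) := by
  have h := tsum_shift (fun k c => c * char k.1 x) z
    (Summable.of_norm (by simpa [norm_char] using hz)) j p q
  have e : ∀ z : Seq d, toFun z x = (normConst d : ℂ) * ∑' k : Mode d, z k * char k.1 x :=
    fun _ => rfl
  rw [e, e, h]
  simp only [Mode.neg]
  ring

lemma Mode.lenSq_le {a : Fin d → ℝ} (ha : a ∈ cube d) (j : Mode d) : j.lenSq a ≤ 4 * j.len ^ 2 := by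
  rw [j.len_sq]; exact latticeSq_le (fun i => (ha i (Set.mem_univ i)).2.le) j.1

lemma Mode.le_lenSq {a : Fin d → ℝ} (ha : a ∈ cube d) (j : Mode d) : j.len ^ 2 ≤ j.lenSq a := by
  have := le_latticeSq (b := 1) (fun i => (ha i (Set.mem_univ i)).1.le) j.1
  rwa [one_mul, ← j.len_sq] at this

lemma Mode.jap_sq (j : Mode d) : jap j.1 ^ 2 = 1 + j.len ^ 2 := by
  rw [QHD.jap_sq, j.len_sq]

lemma SeqBound.summable_norm {s B : ℝ} (hs : d ≤ s) {z : Seq d} (h : SeqBound s z B) :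
    Summable fun j => ‖z j‖ := by
  have h1 : L2Bound (fun j : Mode d => jap j.1 ^ (-s)) (embConst d) :=
    (l2Bound_jap hs).comp_injective (Subtype.val_injective (p := fun j : Fin d → ℤ => j ≠ 0))
  refine (h1.summable_mul h).congr fun j => ?_
  have := jap_pos j.1
  rw [← mul_assoc, ← rpow_add this, neg_add_cancel, rpow_zero, one_mul, abs_norm]

lemma SeqBound.summable_lenSq {s B : ℝ} (hs : 1 ≤ s) {z : Seq d} (h : SeqBound s z B)
    {a : Fin d → ℝ} (ha : a ∈ cube d) : Summable fun j => j.lenSq a * ‖z j‖ ^ 2 := by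
  refine Summable.of_nonneg_of_le (fun j => ?_) (fun j => ?_) ((L2Bound.summable_sq h).mul_left 4)
  · exact mul_nonneg ((sq_nonneg _).trans (j.le_lenSq ha)) (sq_nonneg _)
  · have h1 := j.lenSq_le ha
    have h2 : jap j.1 ^ 2 ≤ (jap j.1 ^ s) ^ 2 := by
      have := one_le_jap j.1
      gcongr
      calc jap j.1 = jap j.1 ^ (1 : ℝ) := (rpow_one _).symm
        _ ≤ _ := rpow_le_rpow_of_exponent_le this hs
    rw [j.jap_sq] at h2
    rw [mul_pow, ← mul_assoc]
    gcongr
    linarith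

set_option maxHeartbeats 1000000 in
theorem hasFDerivAt_hamiltonianZ {κ m τ s B : ℝ} {g G : ℝ → ℝ} {a : Fin d → ℝ} (hm : 0 < m)
    (hg : ContinuousOn g (Set.Ioi 0)) (hG : ∀ x : ℝ, 0 < x → HasDerivAt G (g x) x)
    (ha : a ∈ cube d) {z : Seq d} (hs : d + 1 ≤ s) (hz : SeqBound s z B)
    (hτz : τ * ∑' j, ‖z j‖ ^ 2 ≤ m / 2)
    (hb : ∀ x, |‖(zeroMode m τ z : ℂ) + toFun z x‖ ^ 2 - m| ≤ m / 2)
    (hnl : Continuous (nonlin g m τ z)) (j : Mode d) :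
    HasFDerivAt (fun v : ℂ × ℂ => hamiltonianZ κ m τ G a (shift z j v.1 v.2))
      ((2 : ℝ) • Complex.reCLM.comp
        (conj (zGrad κ m τ g a z j) • ContinuousLinearMap.fst ℝ ℂ ℂ
          + conj (zGrad κ m τ g a z j.neg) • ContinuousLinearMap.snd ℝ ℂ ℂ)) 0 := by
  have hd0 : (0 : ℝ) ≤ d := d.cast_nonneg
  have hz1 := hz.summable_norm (by linarith)
  have hz2 := (hz.summable_sq (by linarith)).1
  have hz3 := hz.summable_lenSq (by linarith) ha
  set α := zeroMode m τ z with hα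
  set y : (Fin d → ℝ) → ℂ := fun x => (α : ℂ) + toFun z x with hy
  have hyc : Continuous y := continuous_const.add (hz.isMult_toFun hs).1.cont
  have hα0 : 0 < α := Real.sqrt_pos.2 (by linarith)
  set l : (Fin d → ℝ) → ℝ × ℂ × ℂ →L[ℝ] ℂ := fun x =>
    Complex.ofRealCLM.comp (ContinuousLinearMap.fst ℝ ℝ (ℂ × ℂ))
      + ((normConst d : ℂ) * char j.1 x) •
        (ContinuousLinearMap.fst ℝ ℂ ℂ).comp (ContinuousLinearMap.snd ℝ ℝ (ℂ × ℂ))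
      + ((normConst d : ℂ) * char (-j.1) x) •
        (ContinuousLinearMap.snd ℝ ℂ ℂ).comp (ContinuousLinearMap.snd ℝ ℝ (ℂ × ℂ)) with hl
  have hlapp : ∀ x v, l x v = (v.1 : ℂ)
      + (normConst d : ℂ) * (v.2.1 * char j.1 x + v.2.2 * char (-j.1) x) := by
    intro x v; simp [hl]; ring
  have hlc : Continuous l := by
    have := continuous_char j.1
    have := continuous_char (-j.1)
    fun_prop
  obtain ⟨K, hK⟩ : ∃ K, ∀ x, ‖l x‖ ≤ K := by
    refine ⟨1 + 2 * normConst d, fun x => ?_⟩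
    have h0 := (normConst_pos d).le
    refine ContinuousLinearMap.opNorm_le_bound _ (by positivity) fun v => ?_
    rw [hlapp]
    have h1 : ‖v.1‖ ≤ ‖v‖ := norm_fst_le v
    have h2 : ‖v.2.1‖ ≤ ‖v‖ := (norm_fst_le v.2).trans (norm_snd_le v)
    have h3 : ‖v.2.2‖ ≤ ‖v‖ := (norm_snd_le v.2).trans (norm_snd_le v)
    calc _ ≤ ‖(v.1 : ℂ)‖ + normConst d * (‖v.2.1‖ + ‖v.2.2‖) := by
          refine (norm_add_le _ _).trans ?_
          rw [norm_mul, Complex.norm_real (normConst d), Real.norm_eq_abs, abs_of_nonneg h0]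
          gcongr
          refine (norm_add_le _ _).trans ?_
          rw [norm_mul, norm_mul, norm_char, norm_char, mul_one, mul_one]
      _ ≤ ‖v‖ + normConst d * (‖v‖ + ‖v‖) := by
          rw [Complex.norm_real]; gcongr
      _ = _ := by ring
  obtain ⟨hint, hder⟩ := hasFDerivAt_integral_normSq hm hg hG hyc hb hlc hK
  have hmass : HasFDerivAt (fun v : ℂ × ℂ => (‖z j + v.1‖ ^ 2 - ‖z j‖ ^ 2)
      + (‖z j.neg + v.2‖ ^ 2 - ‖z j.neg‖ ^ 2))
      ((normSqDeriv (z j)).comp (ContinuousLinearMap.fst ℝ ℂ ℂ)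
        + (normSqDeriv (z j.neg)).comp (ContinuousLinearMap.snd ℝ ℂ ℂ)) 0 := by
    have h1 : HasFDerivAt (fun v : ℂ × ℂ => z j + v.1) (ContinuousLinearMap.fst ℝ ℂ ℂ) 0 :=
      hasFDerivAt_fst.const_add _
    have h2 : HasFDerivAt (fun v : ℂ × ℂ => z j.neg + v.2) (ContinuousLinearMap.snd ℝ ℂ ℂ) 0 :=
      hasFDerivAt_snd.const_add _
    have h3 := HasFDerivAt.comp (0 : ℂ × ℂ) (g := fun η : ℂ => ‖η‖ ^ 2)
      (hasFDerivAt_normSq (z j + (0 : ℂ × ℂ).1)) h1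
    have h4 := HasFDerivAt.comp (0 : ℂ × ℂ) (g := fun η : ℂ => ‖η‖ ^ 2)
      (hasFDerivAt_normSq (z j.neg + (0 : ℂ × ℂ).2)) h2
    have h5 := (h3.sub_const (‖z j‖ ^ 2)).add (h4.sub_const (‖z j.neg‖ ^ 2))
    simp only [Prod.fst_zero, Prod.snd_zero, add_zero] at h5
    exact h5
  have hkin : HasFDerivAt (fun v : ℂ × ℂ => j.lenSq a * (‖z j + v.1‖ ^ 2 - ‖z j‖ ^ 2)
      + j.neg.lenSq a * (‖z j.neg + v.2‖ ^ 2 - ‖z j.neg‖ ^ 2))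
      (j.lenSq a • (normSqDeriv (z j)).comp (ContinuousLinearMap.fst ℝ ℂ ℂ)
        + j.neg.lenSq a • (normSqDeriv (z j.neg)).comp (ContinuousLinearMap.snd ℝ ℂ ℂ)) 0 := by
    have h1 : HasFDerivAt (fun v : ℂ × ℂ => z j + v.1) (ContinuousLinearMap.fst ℝ ℂ ℂ) 0 :=
      hasFDerivAt_fst.const_add _
    have h2 : HasFDerivAt (fun v : ℂ × ℂ => z j.neg + v.2) (ContinuousLinearMap.snd ℝ ℂ ℂ) 0 :=
      hasFDerivAt_snd.const_add _
    have h3 := HasFDerivAt.comp (0 : ℂ × ℂ) (g := fun η : ℂ => ‖η‖ ^ 2)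
      (hasFDerivAt_normSq (z j + (0 : ℂ × ℂ).1)) h1
    have h4 := HasFDerivAt.comp (0 : ℂ × ℂ) (g := fun η : ℂ => ‖η‖ ^ 2)
      (hasFDerivAt_normSq (z j.neg + (0 : ℂ × ℂ).2)) h2
    have h5 := ((h3.sub_const (‖z j‖ ^ 2)).const_mul (j.lenSq a)).add
      ((h4.sub_const (‖z j.neg‖ ^ 2)).const_mul (j.neg.lenSq a))
    simp only [Prod.fst_zero, Prod.snd_zero, add_zero] at h5
    exact h5
  set ms : ℂ × ℂ → ℝ := fun v => (‖z j + v.1‖ ^ 2 - ‖z j‖ ^ 2)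
      + (‖z j.neg + v.2‖ ^ 2 - ‖z j.neg‖ ^ 2) with hms
  have hms0 : ms 0 = 0 := by simp [hms]
  set S := ∑' k, ‖z k‖ ^ 2 with hS
  have hαv : ∀ v : ℂ × ℂ, zeroMode m τ (shift z j v.1 v.2) = √(m - τ * (S + ms v)) := by
    intro v
    rw [zeroMode, tsum_shift (fun _ c => ‖c‖ ^ 2) z hz2]
  have hroot : HasFDerivAt (fun v => √(m - τ * (S + ms v))) ((-(τ / (2 * α))) •
      ((normSqDeriv (z j)).comp (ContinuousLinearMap.fst ℝ ℂ ℂ)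
        + (normSqDeriv (z j.neg)).comp (ContinuousLinearMap.snd ℝ ℂ ℂ))) 0 := by
    have h1 := ((hmass.const_add S).const_mul τ).const_sub m
    have h2 := h1.sqrt (by rw [hms0, add_zero]; linarith)
    refine h2.congr_fderiv ?_
    have h3 : √(m - τ * (S + ms 0)) = α := by rw [hms0, add_zero]; rfl
    rw [h3]
    refine ContinuousLinearMap.ext fun v => ?_
    simp only [_root_.smul_apply, _root_.neg_apply, smul_eq_mul]
    ring
  set W : ℂ × ℂ → ℝ × ℂ × ℂ := fun v => (√(m - τ * (S + ms v)) - α, v) with hW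
  have hW0 : W 0 = 0 := by
    simp only [hW, hms0, add_zero]
    have : √(m - τ * S) = α := rfl
    rw [this, sub_self]; rfl
  have hWd := (hroot.sub_const α).prodMk (hasFDerivAt_id (𝕜 := ℝ) (0 : ℂ × ℂ))
  change HasFDerivAt W _ 0 at hWd
  have hder' : HasFDerivAt (fun v => ∫ x, G (‖y x + l x v‖ ^ 2) ∂boxMeasure d)
      (∫ x, g (‖y x‖ ^ 2) • (normSqDeriv (y x)).comp (l x) ∂boxMeasure d) (W 0) := by
    rw [hW0]; exact hder
  have hcomp := hder'.comp 0 hWd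
  have hfun : (fun v : ℂ × ℂ => hamiltonianZ κ m τ G a (shift z j v.1 v.2)) = fun v =>
      hbar κ / 2 * (∑' k, k.lenSq a * ‖z k‖ ^ 2 + (j.lenSq a * (‖z j + v.1‖ ^ 2 - ‖z j‖ ^ 2)
      + j.neg.lenSq a * (‖z j.neg + v.2‖ ^ 2 - ‖z j.neg‖ ^ 2)))
      + 1 / hbar κ * ((2 * π) ^ d * ∫ x, G (‖y x + l x (W v)‖ ^ 2) ∂boxMeasure d) := by
    ext v
    have h1 := tsum_shift (fun k c => k.lenSq a * ‖c‖ ^ 2) z hz3 j v.1 v.2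
    rw [← mul_sub, ← mul_sub] at h1
    rw [hamiltonianZ, h1]
    congr 2
    change ∫ x in box d, _ = _
    rw [integral_box, smul_eq_mul]
    congr 2
    ext x
    congr 3
    rw [hαv, toFun_shift hz1, hlapp]
    simp only [hy, hW]
    push_cast; ring
  rw [hfun]
  have htot := ((hkin.const_add (∑' k, k.lenSq a * ‖z k‖ ^ 2)).const_mul (hbar κ / 2)).add
    ((hcomp.const_mul ((2 * π) ^ d)).const_mul (1 / hbar κ))
  refine htot.congr_fderiv ?_
  refine ContinuousLinearMap.ext fun v => ?_
  have hev : ∀ w : ℝ × ℂ × ℂ, (∫ x, g (‖y x‖ ^ 2) • (normSqDeriv (y x)).comp (l x) ∂boxMeasure d) w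
      = 2 * (w.1 * (fc (nonlin g m τ z) 0).re
        + normConst d * (conj (fc (nonlin g m τ z) j.1) * w.2.1
          + conj (fc (nonlin g m τ z) j.neg.1) * w.2.2).re) := by
    intro w
    rw [ContinuousLinearMap.integral_apply hint]
    have hi : ∀ k : Fin d → ℤ, Integrable (fun x => nonlin g m τ z x * char (-k) x) (boxMeasure d) :=
      fun k => integrable_boxMeasure (hnl.mul (continuous_char _))
    have e : ∀ x, (g (‖y x‖ ^ 2) • (normSqDeriv (y x)).comp (l x)) w
        = 2 * (w.1 * nonlin g m τ z x * char (-0) x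
          + normConst d * (nonlin g m τ z x * char (-j.1) x * conj w.2.1
          + nonlin g m τ z x * char (-j.neg.1) x * conj w.2.2)).re := by
      intro x
      rw [_root_.smul_apply, ContinuousLinearMap.comp_apply, normSqDeriv_apply, hlapp,
        smul_eq_mul, mul_left_comm, ← Complex.re_ofReal_mul, ← Complex.conj_re]
      congr 2
      simp only [map_mul, map_add, conj_char, Complex.conj_ofReal, Complex.conj_conj, nonlin,
        Mode.neg, neg_zero, char_zero, neg_neg]
      ring
    simp only [e]
    rw [integral_const_mul]
    congr 1
    have := integral_re (𝕜 := ℂ) (μ := boxMeasure d) (f := fun x => w.1 * nonlin g m τ z x * char (-0) x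
          + normConst d * (nonlin g m τ z x * char (-j.1) x * conj w.2.1
          + nonlin g m τ z x * char (-j.neg.1) x * conj w.2.2))
      (integrable_boxMeasure (by
        have := hnl
        have := continuous_char (-j.1)
        have := continuous_char (-j.neg.1)
        have := continuous_char (d := d) (-0)
        fun_prop))
    refine this.trans ?_
    simp only [mul_assoc (w.1 : ℂ)]
    have i₁ := (hi j.1).mul_const (conj w.2.1)
    have i₂ := (hi j.neg.1).mul_const (conj w.2.2)
    have i₃ : Integrable (fun x => nonlin g m τ z x * char (-j.1) x * conj w.2.1
          + nonlin g m τ z x * char (-j.neg.1) x * conj w.2.2) (boxMeasure d) := i₁.add i₂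
    rw [integral_add ((hi 0).const_mul _) (i₃.const_mul _), integral_const_mul, integral_const_mul,
      integral_add i₁ i₂, integral_mul_const, integral_mul_const]
    change Complex.re ((w.1 : ℂ) * fc _ 0 + (normConst d : ℂ) * (fc _ j.1 * conj w.2.1 + fc _ j.neg.1 * conj w.2.2)) = _
    rw [Complex.add_re, Complex.re_ofReal_mul, Complex.re_ofReal_mul, ← Complex.conj_re (_ + _)]
    simp
  have hc0 := normConst_pos d
  have hc := normConst_sq d
  have hcinv : (normConst d)⁻¹ = (2 * π) ^ d * normConst d := by
    field_simp; linarith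
  simp only [_root_.add_apply, _root_.smul_apply,
    ContinuousLinearMap.comp_apply, ContinuousLinearMap.coe_fst', ContinuousLinearMap.coe_snd',
    ContinuousLinearMap.prod_apply, hev, normSqDeriv_apply, smul_eq_mul, ContinuousLinearMap.id_apply,
    Complex.reCLM_apply]
  simp only [zGrad, hcinv]
  rw [← hα]
  simp only [map_add, map_mul, map_sub, Complex.conj_ofReal, Complex.add_re, Complex.mul_re, Complex.sub_re,
    Complex.ofReal_re, Complex.ofReal_im, Complex.add_im, Complex.mul_im, Complex.sub_im, Complex.conj_re,
    Complex.conj_im]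
  ring

/-! ### The diagonalizing change of variables -/

lemma SeqBound.of_le {s B B' K K' : ℝ} {y z z' : Seq d} (h : SeqBound s z B)
    (h' : SeqBound s z' B') (hK : 0 ≤ K) (hK' : 0 ≤ K')
    (hy : ∀ j, ‖y j‖ ≤ K * ‖z j‖ + K' * ‖z' j‖) : SeqBound s y (K * B + K' * B') := by
  have h1 := (L2Bound.const_mul h K).add (L2Bound.const_mul h' K')
  rw [abs_of_nonneg hK, abs_of_nonneg hK'] at h1
  refine h1.mono_of_nonneg (fun j => by have := jap_pos j.1; positivity) fun j => ?_
  have := jap_pos j.1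
  calc jap j.1 ^ s * ‖y j‖ ≤ jap j.1 ^ s * (K * ‖z j‖ + K' * ‖z' j‖) := by gcongr; exact hy j
    _ = _ := by ring

lemma SeqBound.comp_neg {s B : ℝ} {z : Seq d} (h : SeqBound s z B) :
    SeqBound s (fun j => z j.neg) B := by
  have hinj : Function.Injective (Mode.neg (d := d)) :=
    Function.LeftInverse.injective Mode.neg_neg
  have := L2Bound.comp_injective h hinj
  refine this.mono_of_nonneg (fun j => by have := jap_pos j.1; positivity) fun j => ?_
  simp only [Mode.neg, jap_neg]
  exact le_rfl

lemma SobolevBound.seqBound {s F : ℝ} {f : (Fin d → ℝ) → ℂ} (h : SobolevBound s f F) :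
    SeqBound s (fun j => fc f j.1) F :=
  L2Bound.comp_injective h (Subtype.val_injective (p := fun j : Fin d → ℤ => j ≠ 0))

lemma SeqBound.mono_right {s B B' : ℝ} {z : Seq d} (h : SeqBound s z B) (hB : B ≤ B') :
    SeqBound s z B' := L2Bound.mono_right h hB

/-- The diagonal entry of the change of variables. -/
def symbolU (κ p : ℝ) (a : Fin d → ℝ) (j : Mode d) : ℝ :=
  symbolA κ p a j / √(2 * omega κ p a j * symbolA κ p a j)

/-- The off-diagonal entry of the change of variables. -/
def symbolV (κ p : ℝ) (a : Fin d → ℝ) (j : Mode d) : ℝ :=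
  -(p / hbar κ) / √(2 * omega κ p a j * symbolA κ p a j)

lemma Mode.lenSq_neg (a : Fin d → ℝ) (j : Mode d) : j.neg.lenSq a = j.lenSq a := by
  simp [Mode.lenSq, Mode.neg]

lemma symbolU_neg (κ p : ℝ) (a : Fin d → ℝ) (j : Mode d) :
    symbolU κ p a j.neg = symbolU κ p a j := by
  simp only [symbolU, symbolA, omega, Mode.lenSq_neg]

lemma symbolV_neg (κ p : ℝ) (a : Fin d → ℝ) (j : Mode d) :
    symbolV κ p a j.neg = symbolV κ p a j := by
  simp only [symbolV, symbolA, omega, Mode.lenSq_neg]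

lemma diagonalize_eq (κ p : ℝ) (a : Fin d → ℝ) (w : Seq d) (j : Mode d) :
    diagonalize κ p a w j = (symbolU κ p a j : ℂ) * w j + (symbolV κ p a j : ℂ) * conj (w j.neg) := by
  rw [diagonalize, symbolU, symbolV]; push_cast; ring

lemma symbol_facts {κ p : ℝ} (hκ : 0 < κ) (hp : 0 < p) {a : Fin d → ℝ} (ha : a ∈ cube d)
    (j : Mode d) :
    let U := symbolU κ p a j
    let V := symbolV κ p a j
    let θ := p / hbar κ
    let β := hbar κ / 2 * j.lenSq a + θ
    ((U * β + V * θ) * U + (U * θ + V * β) * V = omega κ p a j ∧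
      (U * β + V * θ) * V + (U * θ + V * β) * U = 0) ∧
      |U| ≤ 1 + p / (4 * κ) ∧ |V| ≤ 1 + p / (4 * κ) := by
  intro U V θ β
  have hk : 0 < √κ := Real.sqrt_pos.2 hκ
  have hk2 : √κ ^ 2 = κ := Real.sq_sqrt hκ.le
  have hL : 0 < j.lenSq a := lt_of_lt_of_le (by have := j.len_pos; positivity) (j.le_lenSq ha)
  have hω0 : √κ ≤ omega κ p a j := sqrt_le_omega hκ.le hp.le ha j
  have hωL : √κ * j.lenSq a ≤ omega κ p a j := sqrt_mul_le_dispersion hκ.le hp.le hL.le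
  have hθ : 0 < θ := by simp only [θ, hbar]; positivity
  have hβ : β = √κ * j.lenSq a + θ := by simp only [β, hbar]; ring
  have hpθ : p = 2 * √κ * θ := by simp only [θ, hbar]; field_simp
  have hω2 : omega κ p a j ^ 2 = β ^ 2 - θ ^ 2 := by
    rw [omega, Real.sq_sqrt (by positivity), hβ]
    linear_combination (-(j.lenSq a) ^ 2) * hk2 + j.lenSq a * hpθ
  have hA : symbolA κ p a j = omega κ p a j + β := by simp only [symbolA, β, θ]; ring
  set Ω := omega κ p a j
  have hΩ : 0 < Ω := hk.trans_le hω0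
  have hβ0 : 0 < β := by rw [hβ]; positivity
  set D := √(2 * Ω * (Ω + β)) with hD
  have hD0 : 0 < D := Real.sqrt_pos.2 (by positivity)
  have hD2 : D ^ 2 = 2 * Ω * (Ω + β) := Real.sq_sqrt (by positivity)
  have hU : U = (Ω + β) / D := by simp only [U, symbolU, hA]; rfl
  have hV : V = -θ / D := by simp only [V, symbolV, hA]; rfl
  have hc : p / (4 * κ) = θ / (2 * √κ) := by
    rw [hpθ, div_eq_div_iff (by positivity) (by positivity)]
    linear_combination (4 * θ) * hk2
  have hb : ∀ t : ℝ, t ^ 2 ≤ 1 + θ / (2 * √κ) → |t| ≤ 1 + p / (4 * κ) := by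
    intro t ht
    rw [hc]
    have h0 : 0 ≤ θ / (2 * √κ) := by positivity
    apply abs_le_of_sq_le_sq _ (by positivity)
    nlinarith
  have hθΩ : θ / (2 * Ω) ≤ θ / (2 * √κ) := by gcongr
  refine ⟨⟨?_, ?_⟩, hb U ?_, hb V ?_⟩
  · rw [hU, hV]
    have : ((Ω + β) / D * β + -θ / D * θ) * ((Ω + β) / D) + ((Ω + β) / D * θ + -θ / D * β) * (-θ / D)
      = (β * (Ω + β) ^ 2 - 2 * θ ^ 2 * (Ω + β) + β * θ ^ 2) / D ^ 2 := by field_simp; ring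
    rw [this, hD2, div_eq_iff (by positivity)]
    linear_combination (-2 * Ω - β) * hω2
  · rw [hU, hV]
    have : ((Ω + β) / D * β + -θ / D * θ) * (-θ / D) + ((Ω + β) / D * θ + -θ / D * β) * ((Ω + β) / D)
      = θ * ((Ω + β) ^ 2 + θ ^ 2 - 2 * β * (Ω + β)) / D ^ 2 := by field_simp; ring
    rw [this, div_eq_zero_iff]
    left
    linear_combination θ * hω2
  · rw [hU, div_pow, hD2]
    have : (Ω + β) ^ 2 / (2 * Ω * (Ω + β)) = (Ω + √κ * j.lenSq a) / (2 * Ω) + θ / (2 * Ω) := by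
      rw [hβ] at hβ0 ⊢
      have : Ω + (√κ * j.lenSq a + θ) ≠ 0 := by positivity
      field_simp; ring
    rw [this]
    have : (Ω + √κ * j.lenSq a) / (2 * Ω) ≤ 1 := by
      rw [div_le_one (by positivity)]; linarith
    linarith
  · rw [hV, div_pow, hD2, neg_sq]
    have : θ ^ 2 / (2 * Ω * (Ω + β)) ≤ θ / (2 * Ω) := by
      rw [div_le_div_iff₀ (by positivity) (by positivity)]
      have h1 : θ ≤ Ω + β := by rw [hβ]; have : 0 < √κ * j.lenSq a := by positivity
                                linarith
      calc θ ^ 2 * (2 * Ω) = θ * (2 * Ω) * θ := by ring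
        _ ≤ θ * (2 * Ω) * (Ω + β) := by gcongr
        _ = _ := by ring
    linarith

lemma SeqBound.diagonalize {κ p s B : ℝ} (hκ : 0 < κ) (hp : 0 < p) {a : Fin d → ℝ} (ha : a ∈ cube d)
    {w : Seq d} (h : SeqBound s w B) :
    SeqBound s (diagonalize κ p a w) (2 * (1 + p / (4 * κ)) * B) := by
  have hK : 0 ≤ 1 + p / (4 * κ) := by positivity
  refine (h.of_le h.comp_neg hK hK fun j => ?_).mono_right (le_of_eq (by ring))
  obtain ⟨-, h1, h2⟩ := symbol_facts hκ hp ha j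
  rw [diagonalize_eq]
  refine (norm_add_le _ _).trans ?_
  rw [norm_mul, norm_mul, Complex.norm_conj, Complex.norm_real, Complex.norm_real]
  gcongr <;> assumption

lemma diagonalize_update (κ p : ℝ) (a : Fin d → ℝ) (w : Seq d) (j : Mode d) (ζ : ℂ) :
    diagonalize κ p a (Function.update w j (w j + ζ)) =
      shift (diagonalize κ p a w) j (symbolU κ p a j * ζ) (symbolV κ p a j * conj ζ) := by
  ext k
  simp only [shift, diagonalize_eq]
  by_cases h1 : k = j
  · subst h1
    rw [Function.update_self, Function.update_of_ne k.neg_ne]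
    simp; ring
  by_cases h2 : k = j.neg
  · subst h2
    rw [Function.update_of_ne h1, Mode.neg_neg, Function.update_self, symbolV_neg]
    simp [h1]; ring
  have h3 : k.neg ≠ j := by
    rintro rfl; exact h2 k.neg_neg.symm
  rw [Function.update_of_ne h1, Function.update_of_ne h3]
  simp [h1, h2]

/-- `∂K̃/∂w_j`. -/
def hamGrad (κ m τ : ℝ) (g : ℝ → ℝ) (a : Fin d → ℝ) (w : Seq d) (j : Mode d) : ℂ :=
  symbolU κ (m * deriv g m) a j *
      conj (zGrad κ m τ g a (diagonalize κ (m * deriv g m) a w) j)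
    + symbolV κ (m * deriv g m) a j * zGrad κ m τ g a (diagonalize κ (m * deriv g m) a w) j.neg

theorem hasWirtingerDerivAt_hamiltonianW {κ m τ s B : ℝ} {g G : ℝ → ℝ} {a : Fin d → ℝ}
    (hm : 0 < m)
    (hg : ContinuousOn g (Set.Ioi 0)) (hG : ∀ x : ℝ, 0 < x → HasDerivAt G (g x) x)
    (ha : a ∈ cube d) {w z : Seq d} (hzw : diagonalize κ (m * deriv g m) a w = z)
    (hs : d + 1 ≤ s) (hz : SeqBound s z B)
    (hτz : τ * ∑' j, ‖z j‖ ^ 2 ≤ m / 2)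
    (hb : ∀ x, |‖(zeroMode m τ z : ℂ) + toFun z x‖ ^ 2 - m| ≤ m / 2)
    (hnl : Continuous (nonlin g m τ z)) (j : Mode d) :
    HasWirtingerDerivAt (fun v => (hamiltonianW κ m τ g G a v : ℂ)) w j
      (hamGrad κ m τ g a w j) (conj (hamGrad κ m τ g a w j)) := by
  set p := m * deriv g m
  have h := hasFDerivAt_hamiltonianZ (κ := κ) hm hg hG ha hs hz hτz hb hnl j
  set l : ℂ →L[ℝ] ℂ × ℂ := ContinuousLinearMap.prod
    ((symbolU κ p a j : ℂ) • ContinuousLinearMap.id ℝ ℂ)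
    ((symbolV κ p a j : ℂ) • (Complex.conjCLE : ℂ →L[ℝ] ℂ)) with hl
  have h0 : l 0 = 0 := map_zero l
  rw [← h0] at h
  have h1 := Complex.ofRealCLM.hasFDerivAt.comp (0 : ℂ) (h.comp (0 : ℂ) l.hasFDerivAt)
  have e : (fun ζ : ℂ => (hamiltonianW κ m τ g G a (Function.update w j (w j + ζ)) : ℂ))
      = fun ζ => Complex.ofRealCLM (hamiltonianZ κ m τ G a (shift z j (l ζ).1 (l ζ).2)) := by
    ext ζ
    rw [hamiltonianW, diagonalize_update, hzw]
    rfl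
  rw [HasWirtingerDerivAt, e]
  refine h1.congr_fderiv (ContinuousLinearMap.ext fun ζ => ?_)
  rw [hamGrad, hzw]
  apply Complex.ext <;> simp [hl, p] <;> ring

/-- The quadratic part of `∂K̃/∂w_j`. -/
def quadGrad (κ m : ℝ) (g : ℝ → ℝ) (a : Fin d → ℝ) (w : Seq d) (j : Mode d) : ℂ :=
  ((1 / hbar κ * (normConst d)⁻¹ : ℝ) : ℂ) *
    (symbolU κ (m * deriv g m) a j *
      conj (fc (quadPart g m (diagonalize κ (m * deriv g m) a w)) j.1)
    + symbolV κ (m * deriv g m) a j *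
      fc (quadPart g m (diagonalize κ (m * deriv g m) a w)) j.neg.1)

lemma SeqBound.summable_extend {s B : ℝ} (hs : d ≤ s) {z : Seq d} (h : SeqBound s z B) :
    Summable fun k => ‖(normConst d : ℂ) * QHD.extend z k‖ :=
  (summable_of_l2Bound hs (fun _ => norm_nonneg _) h.extend).1

lemma fc_rePart {s B : ℝ} (hs : d + 1 ≤ s) {z : Seq d} (h : SeqBound s z B) (k : Fin d → ℤ) :
    fc (rePart z) k = normConst d * ((QHD.extend z k + conj (QHD.extend z (-k))) / 2) := by
  have hsum := h.summable_extend (by linarith)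
  obtain ⟨h1, h2⟩ := h.isMult_toFun hs
  have e : rePart z = fun x => ((1 / 2 : ℝ) : ℂ) * (toFun z x + conj (toFun z x)) := by
    ext x; exact rePart_eq z x
  have e2 : fc (toFun z) k = normConst d * QHD.extend z k := by rw [toFun_eq, fc_ser hsum]
  have e3 : fc (fun x => conj (toFun z x)) k = normConst d * conj (QHD.extend z (-k)) := by
    have := conj_fc (toFun z) (-k)
    rw [neg_neg] at this
    rw [← this, toFun_eq, fc_ser hsum, map_mul, Complex.conj_ofReal]
  rw [e, fc_const_mul, fc_add h1.cont h2.cont, e2, e3]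
  push_cast; ring

set_option maxHeartbeats 1000000 in
/-- Expansion of the gradient of the Hamiltonian to second order, with cubic remainder. -/
theorem exists_hamGrad_expansion (d : ℕ) {κ m τ s : ℝ} {g G : ℝ → ℝ} (hκ : 0 < κ) (hm : 0 < m)
    (hτ : 0 < τ) (hg : ContDiffOn ℝ ∞ g (Set.Ioi 0)) (hgm : g m = 0) (hg' : 0 < deriv g m)
    (hG : ∀ x : ℝ, 0 < x → HasDerivAt G (g x) x) (hs : d + 1 ≤ s) :
    ∃ ε C : ℝ, 0 < ε ∧ 0 < C ∧ ∀ a ∈ cube d, ∀ (w : Seq d) (B : ℝ), B ≤ ε → SeqBound s w B →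
      SeqBound s (quadGrad κ m g a w) (C * B ^ 2) ∧
      ∃ r : Seq d, SeqBound s r (C * B ^ 3) ∧ ∀ j,
        HasWirtingerDerivAt (fun v => (hamiltonianW κ m τ g G a v : ℂ)) w j
          (hamGrad κ m τ g a w j) (conj (hamGrad κ m τ g a w j)) ∧
        hamGrad κ m τ g a w j
          = omega κ (m * deriv g m) a j * conj (w j) + quadGrad κ m g a w j + r j := by
  set p := m * deriv g m with hpdef
  have hp : 0 < p := mul_pos hm hg'
  obtain ⟨ε, C, hε, hC, hexp⟩ := exists_nonlin_expansion d hm hτ hg hgm hs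
  have hs0 : 0 ≤ s := by have := d.cast_nonneg (α := ℝ); linarith
  set K := 1 + p / (4 * κ) with hK
  have hK1 : 1 ≤ K := by rw [hK]; have : 0 < p / (4 * κ) := by positivity
                         linarith
  have hK0 : 0 < K := by linarith
  set c₀ := normConst d
  have hc₀ : 0 < c₀ := normConst_pos d
  have hh : 0 < hbar κ := by unfold hbar; positivity
  set n : ℝ := 1 / hbar κ * c₀⁻¹ with hn
  have hn0 : 0 < n := by positivity
  set I₁ : ℝ := 1 / hbar κ * (τ / √(m / 2) * ((2 * π) ^ d * (3 * C))) with hI₁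
  have hI₁0 : 0 < I₁ := by positivity
  set C₁ : ℝ := 2 * K * (n * C + I₁) * (2 * K) ^ 3 with hC₁
  set C₂ : ℝ := 2 * K * (n * C) * (2 * K) ^ 2 with hC₂
  have hC₁0 : 0 < C₁ := by positivity
  have hC₂0 : 0 < C₂ := by positivity
  refine ⟨min ε 1 / (2 * K), C₁ + C₂, by positivity, by positivity, fun a ha w b hb hw => ?_⟩
  set z := diagonalize κ p a w with hzdef
  have hz : SeqBound s z (2 * K * b) := hw.diagonalize hκ hp ha
  set B := 2 * K * b with hB
  have hBε : B ≤ min ε 1 := by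
    rw [le_div_iff₀ (by positivity)] at hb; rw [hB]; linarith
  have hB0 : 0 ≤ B := hz.1
  have hb0 : 0 ≤ b := hw.1
  have hB1 : B ≤ 1 := hBε.trans (min_le_right _ _)
  obtain ⟨h1, h2, h3, h4, c, R, hc, hRc, hR, hnl⟩ := hexp z B (hBε.trans (min_le_left _ _)) hz
  have mX := hz.isMult_rePart hs
  have hQs : SobolevBound s (quadPart g m z) (C * B ^ 2) := h4.sobolevBound hs0
  have hUV := fun j => (symbol_facts hκ hp ha j).2
  set α := zeroMode m τ z with hα
  have hαm : √(m / 2) ≤ α := Real.sqrt_le_sqrt (by linarith)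
  have hfc : ∀ k, fc (nonlin g m τ z) k = 2 * p * fc (rePart z) k + fc (quadPart g m z) k
      + (if k = 0 then c else 0) + fc R k := by
    intro k
    have e : nonlin g m τ z = fun x => ((((2 * p : ℝ) : ℂ) * rePart z x + quadPart g m z x)
        + c * 1) + R x := by
      ext x; rw [hnl, ← hpdef]; push_cast; ring
    have k1 : Continuous fun x => ((2 * p : ℝ) : ℂ) * rePart z x := continuous_const.mul mX.cont
    have k2 : Continuous fun x => ((2 * p : ℝ) : ℂ) * rePart z x + quadPart g m z x := k1.add h4.cont
    have k3 : Continuous fun _ : Fin d → ℝ => c * 1 := continuous_const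
    have k4 : Continuous fun x => (((2 * p : ℝ) : ℂ) * rePart z x + quadPart g m z x) + c * 1 :=
      k2.add k3
    rw [e, fc_add k4 hRc, fc_add k2 k3, fc_add k1 h4.cont, fc_const_mul, fc_const_mul, fc_one]
    push_cast; simp
  set I := (2 * π) ^ d * (fc (nonlin g m τ z) 0).re with hI
  have hIb : |1 / hbar κ * (τ / α * I)| ≤ I₁ * B ^ 2 := by
    have k1 : fc (rePart z) 0 = 0 := by rw [fc_rePart hs hz]; simp [extend_zero]
    have k2 : ‖fc (nonlin g m τ z) 0‖ ≤ 3 * C * B ^ 2 := by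
      rw [hfc, k1, if_pos rfl, mul_zero, zero_add]
      have n1 : ‖fc (quadPart g m z) 0‖ ≤ C * B ^ 2 := norm_fc_le h4.sup 0
      have n2 : ‖fc R 0‖ ≤ C * B ^ 3 := by
        have := L2Bound.abs_le hR 0
        rwa [jap_zero, one_rpow, one_mul, abs_norm] at this
      have n3 : C * B ^ 3 ≤ C * B ^ 2 := by
        gcongr ?_ * ?_
        exact pow_le_pow_of_le_one hB0 hB1 (by norm_num)
      calc _ ≤ ‖fc (quadPart g m z) 0‖ + ‖c‖ + ‖fc R 0‖ := norm_add₃_le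
        _ ≤ _ := by linarith
    have k3 : |(fc (nonlin g m τ z) 0).re| ≤ 3 * C * B ^ 2 := (Complex.abs_re_le_norm _).trans k2
    have hα0 : 0 < α := lt_of_lt_of_le (by positivity) hαm
    rw [abs_mul, abs_mul, hI, abs_mul, abs_of_pos (by positivity : 0 < 1 / hbar κ),
      abs_of_pos (by positivity : 0 < τ / α), abs_of_pos (by positivity : 0 < (2 * π) ^ d)]
    calc _ ≤ 1 / hbar κ * (τ / √(m / 2) * ((2 * π) ^ d * (3 * C * B ^ 2))) := by gcongr
      _ = _ := by rw [hI₁]; ring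
  set ρ : Seq d := fun k => (n : ℂ) * fc R k.1 - ((1 / hbar κ * (τ / α * I) : ℝ) : ℂ) * z k with hρ
  have hρB : SeqBound s ρ ((n * C + I₁) * B ^ 3) := by
    refine (hR.seqBound.of_le hz hn0.le (by positivity : 0 ≤ I₁ * B ^ 2) fun k => ?_).mono_right
      (le_of_eq (by ring))
    refine (norm_sub_le _ _).trans ?_
    rw [norm_mul, norm_mul, Complex.norm_real, Complex.norm_real, Real.norm_eq_abs, Real.norm_eq_abs,
      abs_of_pos hn0]
    gcongr
  have hzG : ∀ k : Mode d, zGrad κ m τ g a z k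
      = ((hbar κ / 2 * k.lenSq a + p / hbar κ : ℝ) : ℂ) * z k + ((p / hbar κ : ℝ) : ℂ) * conj (z k.neg)
        + (n : ℂ) * fc (quadPart g m z) k.1 + ρ k := by
    intro k
    rw [zGrad, ← hα, ← hI, hfc, if_neg k.2, fc_rePart hs hz]
    have e1 : QHD.extend z k.1 = z k := extend_coe z k
    have e2 : QHD.extend z (-k.1) = z k.neg := extend_coe z k.neg
    rw [e1, e2, hρ, hn]
    have hc' : (c₀ : ℂ) ≠ 0 := by exact_mod_cast hc₀.ne'
    have hh' : (hbar κ : ℂ) ≠ 0 := by exact_mod_cast hh.ne'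
    push_cast
    change _ + _ * ((c₀ : ℂ)⁻¹ * (_ * ((c₀ : ℂ) * _) + _ + _ + _) - _) = _
    field_simp
    ring
  have two : ∀ {y : Seq d} {A : ℝ}, SeqBound s y A →
      SeqBound s (fun j => (symbolU κ p a j : ℂ) * conj (y j) + (symbolV κ p a j : ℂ) * y j.neg)
        (2 * K * A) := by
    intro y A hy
    refine (hy.of_le hy.comp_neg hK0.le hK0.le fun j => ?_).mono_right (le_of_eq (by ring))
    refine (norm_add_le _ _).trans ?_
    rw [norm_mul, norm_mul, Complex.norm_conj, Complex.norm_real, Complex.norm_real]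
    gcongr
    · exact (hUV j).1
    · exact (hUV j).2
  refine ⟨?_, fun j => (symbolU κ p a j : ℂ) * conj (ρ j) + (symbolV κ p a j : ℂ) * ρ j.neg, ?_,
    fun j => ⟨hasWirtingerDerivAt_hamiltonianW hm hg.continuousOn hG ha rfl hs hz h1 h2 h3 j, ?_⟩⟩
  · have k1 := two (hQs.seqBound)
    refine (k1.of_le k1 hn0.le le_rfl fun j => ?_).mono_right (B' := (C₁ + C₂) * b ^ 2) ?_
    · rw [quadGrad, norm_mul, Complex.norm_real, Real.norm_eq_abs, abs_of_pos hn0]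
      simp only [zero_mul, add_zero]
      exact le_rfl
    · have : n * (2 * K * (C * B ^ 2)) + 0 * (2 * K * (C * B ^ 2)) = C₂ * b ^ 2 := by
        rw [hC₂, hB]; ring
      rw [this]; gcongr; linarith
  · refine (two hρB).mono_right ?_
    have : 2 * K * ((n * C + I₁) * B ^ 3) = C₁ * b ^ 3 := by rw [hC₁, hB]; ring
    rw [this]; gcongr; linarith
  · obtain ⟨⟨i1, i2⟩, -⟩ := symbol_facts hκ hp ha j
    have i1' : (((symbolU κ p a j * (hbar κ / 2 * j.lenSq a + p / hbar κ) + symbolV κ p a j * (p / hbar κ))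
      * symbolU κ p a j + (symbolU κ p a j * (p / hbar κ) + symbolV κ p a j *
        (hbar κ / 2 * j.lenSq a + p / hbar κ)) * symbolV κ p a j : ℝ) : ℂ) = (omega κ p a j : ℂ) := by
      rw [← i1]
    have i2' : (((symbolU κ p a j * (hbar κ / 2 * j.lenSq a + p / hbar κ) + symbolV κ p a j * (p / hbar κ))
      * symbolV κ p a j + (symbolU κ p a j * (p / hbar κ) + symbolV κ p a j *
        (hbar κ / 2 * j.lenSq a + p / hbar κ)) * symbolU κ p a j : ℝ) : ℂ) = 0 := by
      exact_mod_cast i2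
    have z1 : z j = symbolU κ p a j * w j + symbolV κ p a j * conj (w j.neg) := diagonalize_eq κ p a w j
    have z2 : z j.neg = symbolU κ p a j * w j.neg + symbolV κ p a j * conj (w j) := by
      rw [hzdef, diagonalize_eq, symbolU_neg, symbolV_neg, Mode.neg_neg]
    rw [hamGrad, quadGrad, ← hzdef, hzG, hzG, Mode.neg_neg, Mode.lenSq_neg, z1, z2, ← i1']
    simp only [map_add, map_mul, Complex.conj_ofReal, Complex.conj_conj]
    push_cast at i2' ⊢
    rw [← hpdef]
    simp only [hn]
    push_cast
    change _ = _ + 1 / _ * (c₀ : ℂ)⁻¹ * _ + _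
    linear_combination w j.neg * i2'

/-! ### Trilinear sums -/

/-- Indices of cubic monomials. -/
abbrev Triad (d : ℕ) : Type := (Fin 3 → ℤˣ) × (Fin 3 → Mode d)

lemma signs_smul_injective (σ : ℤˣ) {v v' : Fin d → ℤ} (h : (σ : ℤ) • v = (σ : ℤ) • v') : v = v' := by
  have := congrArg (fun u => (σ : ℤ) • u) h
  rcases Int.units_eq_one_or σ with rfl | rfl <;> simpa using h

lemma eq_of_momentum {σ : Fin 3 → ℤˣ} {j j' : Fin 3 → Mode d} (h : momentum σ j = 0)
    (h' : momentum σ j' = 0) (b : Fin 3) (hb : ∀ i, i ≠ b → j i = j' i) : j = j' := by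
  have h1 : ∑ i, ((σ i : ℤ) • (j i).1 - (σ i : ℤ) • (j' i).1) = 0 := by
    rw [Finset.sum_sub_distrib]
    unfold momentum at h h'
    rw [h, h', sub_zero]
  rw [Finset.sum_eq_single b (fun i _ hi => by rw [hb i hi, sub_self]) (by simp), sub_eq_zero] at h1
  funext i
  by_cases hi : i = b
  · subst hi; exact Subtype.ext (signs_smul_injective _ h1)
  · exact hb i hi

lemma len_le_of_momentum {σ : Fin 3 → ℤˣ} {j : Fin 3 → Mode d} (h : momentum σ j = 0) (i : Fin 3) :
    (j i).len ≤ (j (i + 1)).len + (j (i + 2)).len := by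
  set e : Mode d → EuclideanSpace ℝ (Fin d) := fun k => WithLp.toLp 2 fun i => (k.1 i : ℝ) with he
  have hlen : ∀ k, ‖e k‖ = k.len := fun k => by
    rw [EuclideanSpace.norm_eq, Mode.len]
    simp [he]
  have hmom : ∑ i, ((σ i : ℤ) : ℝ) • e (j i) = 0 := by
    ext l
    have := congrFun h l
    simp only [momentum, Finset.sum_apply, Pi.smul_apply, smul_eq_mul, Pi.zero_apply] at this
    have h2 : ∑ i, ((σ i : ℤ) : ℝ) * ((j i).1 l : ℝ) = 0 := by exact_mod_cast this
    simpa [he, Finset.sum_apply] using h2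
  have habs : ∀ i, ‖((σ i : ℤ) : ℝ) • e (j i)‖ = (j i).len := fun i => by
    rw [norm_smul, hlen]
    rcases Int.units_eq_one_or (σ i) with h | h <;> simp [h]
  have h3 : ((σ i : ℤ) : ℝ) • e (j i) = -(((σ (i + 1) : ℤ) : ℝ) • e (j (i + 1))
      + ((σ (i + 2) : ℤ) : ℝ) • e (j (i + 2))) := by
    rw [eq_neg_iff_add_eq_zero, ← hmom, Fin.sum_univ_three]
    fin_cases i
    · simp only [Fin.zero_eta, Fin.reduceAdd]; abel
    · simp only [Fin.mk_one, Fin.reduceAdd]; abel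
    · simp only [Fin.reduceFinMk, Fin.reduceAdd]; abel
  rw [← habs, h3, norm_neg, ← habs (i + 1), ← habs (i + 2)]
  exact norm_add_le _ _

lemma weight_split_aux {x y z s M : ℝ} (hs : 0 ≤ s) (hx : 0 < x) (hy : 0 < y) (hz : 0 < z)
    (hzx : z ≤ x) (hzy : z ≤ y) (h1 : x ≤ y + z) (h2 : y ≤ x + z) :
    (max x y) ^ (2 * s) * z ^ M ≤ 2 ^ s * (x ^ s * y ^ s * z ^ M) := by
  have h : (max x y) ^ 2 ≤ 2 * (x * y) := by
    rcases le_total x y with h | h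
    · rw [max_eq_right h]; nlinarith
    · rw [max_eq_left h]; nlinarith
  have hm : 0 < max x y := lt_max_of_lt_left hx
  rw [rpow_mul hm.le, rpow_two, ← mul_rpow hx.le hy.le, ← mul_assoc,
    ← mul_rpow zero_le_two (by positivity)]
  gcongr

lemma weight_split {x y z s M : ℝ} (hs : 0 ≤ s) (hx : 0 < x) (hy : 0 < y) (hz : 0 < z)
    (h1 : x ≤ y + z) (h2 : y ≤ z + x) (h3 : z ≤ x + y) :
    (max x (max y z)) ^ (2 * s) * (min x (min y z)) ^ M ≤
      2 ^ s * (y ^ s * z ^ s * x ^ M + z ^ s * x ^ s * y ^ M + x ^ s * y ^ s * z ^ M) := by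
  have p1 : 0 ≤ y ^ s * z ^ s * x ^ M := by positivity
  have p2 : 0 ≤ z ^ s * x ^ s * y ^ M := by positivity
  have p3 : 0 ≤ x ^ s * y ^ s * z ^ M := by positivity
  have p4 : (0 : ℝ) ≤ 2 ^ s := by positivity
  rcases le_total x y with hxy | hxy
  · rcases le_total x z with hxz | hxz
    · have := weight_split_aux (M := M) hs hy hz hx hxy hxz (by linarith) (by linarith)
      rw [max_eq_right (hxy.trans (le_max_left _ _)), min_eq_left (le_min hxy hxz)]
      refine this.trans (mul_le_mul_of_nonneg_left (by linarith) p4)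
    · have := weight_split_aux (M := M) hs hx hy hz hxz (hxz.trans hxy) (by linarith) (by linarith)
      rw [max_eq_left (hxz.trans hxy), min_eq_right (hxz.trans hxy), min_eq_right hxz]
      refine this.trans (mul_le_mul_of_nonneg_left (by linarith) p4)
  · rcases le_total y z with hyz | hyz
    · have := weight_split_aux (M := M) hs hz hx hy hyz hxy (by linarith) (by linarith)
      rw [max_eq_right hyz, max_comm, min_eq_left hyz, min_eq_right hxy]
      refine this.trans (mul_le_mul_of_nonneg_left (by linarith) p4)
    · have := weight_split_aux (M := M) hs hx hy hz (hyz.trans hxy) hyz (by linarith) (by linarith)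
      rw [max_eq_left hyz, min_eq_right hyz, min_eq_right (hyz.trans hxy)]
      refine this.trans (mul_le_mul_of_nonneg_left (by linarith) p4)

lemma sum_triad_sq_le {f h : Mode d → ℝ} {A H : ℝ} (hf : L2Bound f A) (h0 : ∀ k, 0 ≤ h k)
    (hh : Summable h) (hH : ∑' k, h k ≤ H) {u v c : Fin 3} (huv : ∀ i, i ≠ v → i = u ∨ i = c)
    (F : Finset (Triad d)) (hF : ∀ p ∈ F, momentum p.1 p.2 = 0) :
    ∑ p ∈ F, f (p.2 u) ^ 2 * h (p.2 c) ≤ 8 * (A ^ 2 * H) := by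
  classical
  set e : Triad d → (Fin 3 → ℤˣ) × Mode d × Mode d := fun p => (p.1, p.2 u, p.2 c) with he
  have hinj : Set.InjOn e F := by
    rintro ⟨σ, j⟩ hp ⟨σ', j'⟩ hp' heq
    simp only [he, Prod.mk.injEq] at heq
    obtain ⟨rfl, h1, h2⟩ := heq
    have := eq_of_momentum (j := j) (j' := j') (hF _ hp) (hF _ hp') v fun i hi => by
      rcases huv i hi with rfl | rfl <;> assumption
    rw [Prod.mk.injEq]
    exact ⟨rfl, this⟩
  have e1 : ∑ p ∈ F, f (p.2 u) ^ 2 * h (p.2 c) = ∑ q ∈ F.image e, f q.2.1 ^ 2 * h q.2.2 := by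
    rw [Finset.sum_image hinj]
  have hsub : F.image e ⊆ Finset.univ ×ˢ (F.image fun p => p.2 u) ×ˢ (F.image fun p => p.2 c) := by
    intro q hq
    obtain ⟨p, hp, rfl⟩ := Finset.mem_image.1 hq
    simp only [he, Finset.mem_product, Finset.mem_univ, true_and]
    exact ⟨Finset.mem_image_of_mem _ hp, Finset.mem_image_of_mem _ hp⟩
  rw [e1]
  refine (Finset.sum_le_sum_of_subset_of_nonneg hsub fun q _ _ =>
    mul_nonneg (sq_nonneg _) (h0 _)).trans ?_
  simp only [Finset.sum_product, Finset.sum_const]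
  have hcard : (Finset.univ : Finset (Fin 3 → ℤˣ)).card = 8 := by
    rw [Finset.card_univ, Fintype.card_fun, Fintype.card_units_int]; rfl
  rw [hcard, nsmul_eq_mul]
  simp only [← Finset.mul_sum, ← Finset.sum_mul]
  push_cast
  gcongr
  · exact Finset.sum_nonneg fun k _ => h0 k
  · exact hf.2 _
  · exact (hh.sum_le_tsum _ fun k _ => h0 k).trans hH

lemma sum_triad_le {f g h : Mode d → ℝ} {A B H : ℝ} (hf : L2Bound f A) (hg : L2Bound g B)
    (h0 : ∀ k, 0 ≤ h k) (hh : Summable h) (hH : ∑' k, h k ≤ H)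
    (c : Fin 3) (F : Finset (Triad d)) (hF : ∀ p ∈ F, momentum p.1 p.2 = 0) :
    ∑ p ∈ F, f (p.2 (c + 1)) * g (p.2 (c + 2)) * h (p.2 c) ≤ 8 * (A * B * H) := by
  have hH0 : 0 ≤ H := (tsum_nonneg h0).trans hH
  have h1 := sum_triad_sq_le hf h0 hh hH (u := c + 1) (v := c + 2) (c := c)
    (by intro i hi; fin_cases c <;> fin_cases i <;> simp_all) F hF
  have h2 := sum_triad_sq_le hg h0 hh hH (u := c + 2) (v := c + 1) (c := c)
    (by intro i hi; fin_cases c <;> fin_cases i <;> simp_all) F hF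
  have h3 := Finset.sum_mul_sq_le_sq_mul_sq F (fun p => f (p.2 (c + 1)) * √(h (p.2 c)))
    (fun p => g (p.2 (c + 2)) * √(h (p.2 c)))
  have e1 : ∀ p : Triad d, f (p.2 (c + 1)) * √(h (p.2 c)) * (g (p.2 (c + 2)) * √(h (p.2 c)))
      = f (p.2 (c + 1)) * g (p.2 (c + 2)) * h (p.2 c) := fun p => by
    linear_combination f (p.2 (c + 1)) * g (p.2 (c + 2)) * Real.sq_sqrt (h0 (p.2 c))
  simp only [e1, mul_pow, Real.sq_sqrt (h0 _)] at h3
  have hA := hf.1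
  have hB := hg.1
  refine (abs_le_of_sq_le_sq' (h3.trans ((mul_le_mul h1 h2 (Finset.sum_nonneg fun p _ =>
    mul_nonneg (sq_nonneg _) (h0 _)) (by positivity)).trans (le_of_eq ?_))) (by positivity)).2
  ring

/-- The constant in the trilinear estimate. -/
def triConst (d : ℕ) (s : ℝ) : ℝ := 2 ^ s * (24 * embConst d)

lemma triConst_pos (d : ℕ) (s : ℝ) : 0 < triConst d s := by
  have := embConst_pos d
  unfold triConst; positivity

lemma norm_signedCoeff (w : Seq d) (σ : ℤˣ) (j : Mode d) : ‖signedCoeff w σ j‖ = ‖w j‖ := by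
  unfold signedCoeff
  split_ifs
  · rfl
  · exact Complex.norm_conj _

lemma Mode.len_le_jap (j : Mode d) : j.len ≤ jap j.1 := by
  apply abs_le_of_sq_le_sq' _ (jap_pos _).le |>.2
  rw [j.jap_sq]; linarith

/-- The trilinear form with coefficients `c`. -/
def triTerm (c : Triad d → ℂ) (x : Fin 3 → Seq d) (p : Triad d) : ℂ :=
  c p * ∏ i, signedCoeff (x i) (p.1 i) (p.2 i)

theorem summable_triTerm {s M K : ℝ} (hM : 0 ≤ M) (hs : M + 1 + d ≤ s) (hK : 0 ≤ K)
    {c : Triad d → ℂ} (hmom : ∀ p, momentum p.1 p.2 ≠ 0 → c p = 0)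
    (hc : ∀ p, momentum p.1 p.2 = 0 → ‖c p‖ ≤ K * (mu3 p.2 ^ (M + 1) * mu1 p.2 ^ (2 * s)))
    {x : Fin 3 → Seq d} {A : Fin 3 → ℝ} (hx : ∀ i, SeqBound s (x i) (A i)) :
    Summable (fun p => ‖triTerm c x p‖) ∧
      ∑' p, ‖triTerm c x p‖ ≤ triConst d s * K * (A 0 * A 1 * A 2) := by
  have hs0 : 0 ≤ s := by have := d.cast_nonneg (α := ℝ); linarith
  set f : Fin 3 → Mode d → ℝ := fun i k => jap k.1 ^ s * ‖x i k‖ with hf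
  set h : Fin 3 → Mode d → ℝ := fun i k => jap k.1 ^ (M + 1) * ‖x i k‖ with hh
  have h0 : ∀ i k, 0 ≤ h i k := fun i k => by have := jap_pos k.1; simp only [hh]; positivity
  have hsum : ∀ i, Summable (h i) ∧ ∑' k, h i k ≤ embConst d * A i := by
    intro i
    have l1 : L2Bound (fun k : Mode d => jap k.1 ^ (-(s - M - 1))) (embConst d) :=
      (l2Bound_jap (by linarith)).comp_injective
        (Subtype.val_injective (p := fun j : Fin d → ℤ => j ≠ 0))
    have e : ∀ k : Mode d, |jap k.1 ^ (-(s - M - 1)) * (jap k.1 ^ s * ‖x i k‖)| = h i k := fun k => by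
      rw [← mul_assoc, ← rpow_add (jap_pos _), show -(s - M - 1) + s = M + 1 by ring]
      exact abs_of_nonneg (h0 i k)
    have k1 := l1.summable_mul (hx i)
    have k2 := l1.tsum_mul_le (hx i)
    simp only [e] at k1 k2
    exact ⟨k1, k2⟩
  have hpt : ∀ p : Triad d, momentum p.1 p.2 = 0 → ‖triTerm c x p‖ ≤ 2 ^ s * K *
      ∑ i : Fin 3, f (i + 1) (p.2 (i + 1)) * f (i + 2) (p.2 (i + 2)) * h i (p.2 i) := by
    intro p hp
    have t0 := len_le_of_momentum hp 0
    have t1 := len_le_of_momentum hp 1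
    have t2 := len_le_of_momentum hp 2
    simp only [Fin.reduceAdd, zero_add] at t0 t1 t2
    have hw := weight_split (M := M + 1) hs0 (p.2 0).len_pos (p.2 1).len_pos (p.2 2).len_pos t0 t1 t2
    have hpos := fun i => (p.2 i).len_pos
    have hle := fun i => (p.2 i).len_le_jap
    have hj := fun i => jap_pos (p.2 i).1
    rw [triTerm, norm_mul, norm_prod]
    simp only [norm_signedCoeff]
    refine (mul_le_mul_of_nonneg_right (hc p hp) (Finset.prod_nonneg fun i _ => norm_nonneg _)).trans ?_
    have hw2 : mu3 p.2 ^ (M + 1) * mu1 p.2 ^ (2 * s) ≤ 2 ^ s *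
        (jap (p.2 1).1 ^ s * jap (p.2 2).1 ^ s * jap (p.2 0).1 ^ (M + 1)
        + jap (p.2 2).1 ^ s * jap (p.2 0).1 ^ s * jap (p.2 1).1 ^ (M + 1)
        + jap (p.2 0).1 ^ s * jap (p.2 1).1 ^ s * jap (p.2 2).1 ^ (M + 1)) := by
      rw [mul_comm, mu1, mu3]
      refine hw.trans ?_
      have := hpos 0; have := hpos 1; have := hpos 2
      have := hj 0; have := hj 1; have := hj 2
      have := hle 0; have := hle 1; have := hle 2
      gcongr
    calc _ ≤ K * (2 ^ s *
        (jap (p.2 1).1 ^ s * jap (p.2 2).1 ^ s * jap (p.2 0).1 ^ (M + 1)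
        + jap (p.2 2).1 ^ s * jap (p.2 0).1 ^ s * jap (p.2 1).1 ^ (M + 1)
        + jap (p.2 0).1 ^ s * jap (p.2 1).1 ^ s * jap (p.2 2).1 ^ (M + 1)))
          * ∏ i, ‖x i (p.2 i)‖ := by gcongr
      _ = _ := by
        simp only [Fin.prod_univ_three, Fin.sum_univ_three, hf, hh, Fin.reduceAdd, zero_add]
        ring
  have hfin : ∀ F : Finset (Triad d), ∑ p ∈ F, ‖triTerm c x p‖
      ≤ triConst d s * K * (A 0 * A 1 * A 2) := by
    intro F
    classical
    have e1 : ∑ p ∈ F, ‖triTerm c x p‖ = ∑ p ∈ F with momentum p.1 p.2 = 0, ‖triTerm c x p‖ := by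
      rw [Finset.sum_filter_of_ne]
      intro p _ hne
      by_contra hp
      exact hne (by rw [triTerm, hmom p hp, zero_mul, norm_zero])
    rw [e1]
    have hF : ∀ p ∈ F.filter (fun p => momentum p.1 p.2 = 0), momentum p.1 p.2 = 0 :=
      fun p hp => (Finset.mem_filter.1 hp).2
    refine (Finset.sum_le_sum fun p hp => hpt p (hF p hp)).trans ?_
    rw [← Finset.mul_sum, Finset.sum_comm]
    have hi : ∀ i ∈ (Finset.univ : Finset (Fin 3)), ∑ p ∈ F with momentum p.1 p.2 = 0,
        f (i + 1) (p.2 (i + 1)) * f (i + 2) (p.2 (i + 2)) * h i (p.2 i)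
        ≤ 8 * (embConst d * (A 0 * A 1 * A 2)) := by
      intro i _
      refine (sum_triad_le (hx (i + 1)) (hx (i + 2)) (h0 i) (hsum i).1 (hsum i).2 i _ hF).trans
        (le_of_eq ?_)
      fin_cases i
      · simp only [Fin.zero_eta, Fin.reduceAdd]; ring
      · simp only [Fin.mk_one, Fin.reduceAdd]; ring
      · simp only [Fin.reduceFinMk, Fin.reduceAdd]; ring
    refine (mul_le_mul_of_nonneg_left (Finset.sum_le_sum hi) (by positivity)).trans (le_of_eq ?_)
    rw [Finset.sum_const, Finset.card_univ, Fintype.card_fin, nsmul_eq_mul, triConst]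
    push_cast; ring
  have hS : Summable (fun p => ‖triTerm c x p‖) := summable_of_sum_le (fun _ => norm_nonneg _) hfin
  exact ⟨hS, hS.tsum_le_of_sum_le hfin⟩

/-! ### Gradients of trilinear Hamiltonians -/

/-- Signed modes index the variables `w_j` and `conj (w_j)`. -/
abbrev SMode (d : ℕ) : Type := Mode d × ℤˣ

/-- The variable attached to a signed mode. -/
def sval (w : Seq d) (x : SMode d) : ℂ := signedCoeff w x.2 x.1

lemma norm_sval (w : Seq d) (x : SMode d) : ‖sval w x‖ = ‖w x.1‖ := norm_signedCoeff w x.2 x.1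

/-- Triples of signed modes. -/
def triadEquiv : SMode d × SMode d × SMode d ≃ Triad d where
  toFun q := (![q.1.2, q.2.1.2, q.2.2.2], ![q.1.1, q.2.1.1, q.2.2.1])
  invFun p := ((p.2 0, p.1 0), (p.2 1, p.1 1), (p.2 2, p.1 2))
  left_inv q := rfl
  right_inv p := by
    ext i <;> fin_cases i <;> rfl

/-- Permutations act on triples. -/
def permEquiv (ρ : Equiv.Perm (Fin 3)) : Triad d ≃ Triad d where
  toFun p := (p.1 ∘ ρ, p.2 ∘ ρ)
  invFun p := (p.1 ∘ ρ.symm, p.2 ∘ ρ.symm)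
  left_inv p := by ext i <;> simp
  right_inv p := by ext i <;> simp

/-- Change of all the signs in a signed mode. -/
def flip : SMode d ≃ SMode d := Equiv.prodCongr (Equiv.refl _) (Equiv.neg ℤˣ)

lemma sval_flip (w : Seq d) (x : SMode d) : sval w (flip x) = conj (sval w x) := by
  obtain ⟨j, σ⟩ := x
  rcases Int.units_eq_one_or σ with rfl | rfl <;> simp [sval, signedCoeff, flip]

/-- The coefficients of a trilinear Hamiltonian, as a function of triples. -/
def TrilinearHamiltonian.cf (E : TrilinearHamiltonian d) (p : Triad d) : ℂ := E.coeff p.1 p.2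

lemma TrilinearHamiltonian.cf_perm (E : TrilinearHamiltonian d) (ρ : Equiv.Perm (Fin 3))
    (p : Triad d) : E.cf (permEquiv ρ p) = E.cf p := E.symmetric ρ p.1 p.2

/-- `∂E/∂w_j` for `x = (j, 1)` and `∂E/∂w̄_j` for `x = (j, -1)`. -/
def triGrad (E : TrilinearHamiltonian d) (w : Seq d) (x : SMode d) : ℂ :=
  3 * ∑' y : SMode d × SMode d, E.cf (triadEquiv (x, y)) * (sval w y.1 * sval w y.2)

lemma hasSum_mul_triGrad (E : TrilinearHamiltonian d) (w : Seq d) (X : SMode d → ℂ)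
    (hX : Summable fun p : Triad d =>
      ‖X (p.2 0, p.1 0) * (E.cf p * (signedCoeff w (p.1 1) (p.2 1) * signedCoeff w (p.1 2) (p.2 2)))‖) :
    HasSum (fun x => X x * triGrad E w x) (3 * ∑' p : Triad d,
      X (p.2 0, p.1 0) * (E.cf p * (signedCoeff w (p.1 1) (p.2 1) * signedCoeff w (p.1 2) (p.2 2)))) := by
  have h1 := (triadEquiv.summable_iff.2 hX.of_norm)
  have h2 := h1.hasSum.prod_fiberwise fun x => (h1.prod_factor x).hasSum
  rw [← triadEquiv.tsum_eq]
  refine ((h2.mul_left 3).congr_fun fun x => ?_)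
  rw [triGrad, mul_left_comm, ← tsum_mul_left]
  rfl

lemma triGrad_flip (E : TrilinearHamiltonian d) (w : Seq d) (x : SMode d) :
    triGrad E w (flip x) = conj (triGrad E w x) := by
  rw [triGrad, triGrad, map_mul, Complex.conj_tsum, map_ofNat,
    ← (Equiv.prodCongr flip flip).tsum_eq]
  congr 1
  refine tsum_congr fun y => ?_
  simp only [Equiv.prodCongr_apply, Prod.map_fst, Prod.map_snd, sval_flip, map_mul]
  congr 1
  rw [TrilinearHamiltonian.cf, TrilinearHamiltonian.cf, ← E.reality]
  congr 1
  · funext i; fin_cases i <;> rfl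

lemma TrilinearHamiltonian.triTerm_perm (E : TrilinearHamiltonian d) (ρ : Equiv.Perm (Fin 3))
    (x : Fin 3 → Seq d) (p : Triad d) :
    triTerm E.cf (x ∘ ρ) (permEquiv ρ p) = triTerm E.cf x p := by
  rw [triTerm, triTerm, E.cf_perm]
  congr 1
  exact Equiv.prod_comp ρ fun i => signedCoeff (x i) (p.1 i) (p.2 i)

lemma TrilinearHamiltonian.tsum_perm (E : TrilinearHamiltonian d) (ρ : Equiv.Perm (Fin 3))
    (x : Fin 3 → Seq d) : ∑' p, triTerm E.cf (x ∘ ρ) p = ∑' p, triTerm E.cf x p := by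
  rw [← (permEquiv ρ).tsum_eq]
  exact tsum_congr fun p => E.triTerm_perm ρ x p

/-- Trilinear Hamiltonians bounded on `H^s`. -/
def TrilinearHamiltonian.IsBdd (E : TrilinearHamiltonian d) (s M K : ℝ) : Prop :=
  ∀ σ j, ‖E.coeff σ j‖ ≤ K * (mu3 j ^ (M + 1) * mu1 j ^ (2 * s))

lemma TrilinearHamiltonian.summable_triTerm (E : TrilinearHamiltonian d) {s M K : ℝ}
    (hM : 0 ≤ M) (hs : M + 1 + d ≤ s) (hK : 0 ≤ K) (hE : E.IsBdd s M K)
    {x : Fin 3 → Seq d} {A : Fin 3 → ℝ} (hx : ∀ i, SeqBound s (x i) (A i)) :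
    Summable (fun p => ‖triTerm E.cf x p‖) ∧
      ∑' p, ‖triTerm E.cf x p‖ ≤ triConst d s * K * (A 0 * A 1 * A 2) :=
  QHD.summable_triTerm hM hs hK (fun p hp => E.momentum_support p.1 p.2 hp)
    (fun p _ => hE p.1 p.2) hx

lemma signedCoeff_add (w v : Seq d) (σ : ℤˣ) (j : Mode d) :
    signedCoeff (w + v) σ j = signedCoeff w σ j + signedCoeff v σ j := by
  unfold signedCoeff; split_ifs <;> simp

lemma seqBound_single (s : ℝ) (j : Mode d) (ζ : ℂ) :
    SeqBound s (Pi.single j ζ) (jap j.1 ^ s * ‖ζ‖) := by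
  classical
  have := jap_pos j.1
  refine ⟨by positivity, fun F => ?_⟩
  have e : ∀ k : Mode d, (jap k.1 ^ s * ‖(Pi.single j ζ : Seq d) k‖) ^ 2
      = if k = j then (jap j.1 ^ s * ‖ζ‖) ^ 2 else 0 := fun k => by
    by_cases h : k = j
    · subst h; simp
    · simp [h]
  simp only [e, Finset.sum_ite_eq']
  split_ifs
  · exact le_rfl
  · positivity

lemma hasWirtingerDerivAt_eval (E : TrilinearHamiltonian d) {s M K B : ℝ}
    (hM : 0 ≤ M) (hs : M + 1 + d ≤ s) (hK : 0 ≤ K) (hE : E.IsBdd s M K) {w : Seq d}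
    (hw : SeqBound s w B) (j : Mode d) :
    HasWirtingerDerivAt E.eval w j (triGrad E w (j, 1)) (triGrad E w (j, -1)) := by
  classical
  have hB := hw.1
  set J := jap j.1 ^ s
  have hJ : 0 ≤ J := by have := jap_pos j.1; positivity
  set T : (Fin 3 → Seq d) → ℂ := fun x => ∑' p, triTerm E.cf x p with hT
  set e : ℂ → Seq d := fun ζ => Pi.single j ζ with he
  have hsum : ∀ x y z : Seq d, ∀ A A' A'' : ℝ, SeqBound s x A → SeqBound s y A' → SeqBound s z A'' →
      Summable (fun p => ‖triTerm E.cf ![x, y, z] p‖) ∧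
      ‖T ![x, y, z]‖ ≤ triConst d s * K * (A * A' * A'') := by
    intro x y z A A' A'' hx hy hz
    have := E.summable_triTerm hM hs hK hE (x := ![x, y, z]) (A := ![A, A', A''])
      (by intro i; fin_cases i <;> assumption)
    exact ⟨this.1, (norm_tsum_le_tsum_norm this.1).trans this.2⟩
  have hexp : ∀ ζ, E.eval (w + e ζ) = T ![w, w, w] + 3 * T ![e ζ, w, w]
      + (3 * T ![e ζ, e ζ, w] + T ![e ζ, e ζ, e ζ]) := by
    intro ζ
    have he' := seqBound_single s j ζ
    have s1 := (hsum w w w _ _ _ hw hw hw).1.of_norm.hasSum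
    have s2 := (hsum (e ζ) w w _ _ _ he' hw hw).1.of_norm.hasSum
    have s3 := (hsum w (e ζ) w _ _ _ hw he' hw).1.of_norm.hasSum
    have s4 := (hsum w w (e ζ) _ _ _ hw hw he').1.of_norm.hasSum
    have s5 := (hsum (e ζ) (e ζ) w _ _ _ he' he' hw).1.of_norm.hasSum
    have s6 := (hsum (e ζ) w (e ζ) _ _ _ he' hw he').1.of_norm.hasSum
    have s7 := (hsum w (e ζ) (e ζ) _ _ _ hw he' he').1.of_norm.hasSum
    have s8 := (hsum (e ζ) (e ζ) (e ζ) _ _ _ he' he' he').1.of_norm.hasSum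
    have hs := (((s1.add s2).add (s3.add s4)).add ((s5.add s6).add (s7.add s8))).tsum_eq
    have p1 : T ![w, e ζ, w] = T ![e ζ, w, w] := by
      rw [hT]; simp only []
      rw [← E.tsum_perm (Equiv.swap 0 1) ![e ζ, w, w]]
      congr 2
    have p2 : T ![w, w, e ζ] = T ![e ζ, w, w] := by
      rw [hT]; simp only []
      rw [← E.tsum_perm (Equiv.swap 0 2) ![e ζ, w, w]]
      congr 2
    have p3 : T ![e ζ, w, e ζ] = T ![e ζ, e ζ, w] := by
      rw [hT]; simp only []
      rw [← E.tsum_perm (Equiv.swap 1 2) ![e ζ, e ζ, w]]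
      congr 2
    have p4 : T ![w, e ζ, e ζ] = T ![e ζ, e ζ, w] := by
      rw [hT]; simp only []
      rw [← E.tsum_perm (Equiv.swap 0 2) ![e ζ, e ζ, w]]
      congr 2
    have e1 : E.eval (w + e ζ) = (T ![w, w, w] + T ![e ζ, w, w] + (T ![w, e ζ, w] + T ![w, w, e ζ]))
        + ((T ![e ζ, e ζ, w] + T ![e ζ, w, e ζ]) + (T ![w, e ζ, e ζ] + T ![e ζ, e ζ, e ζ])) := by
      rw [hT, ← hs, TrilinearHamiltonian.eval]
      refine tsum_congr fun p => ?_
      simp only [TrilinearHamiltonian.term, triTerm, Fin.prod_univ_three, signedCoeff_add,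
        TrilinearHamiltonian.cf, Matrix.cons_val_zero, Matrix.cons_val_one, Matrix.cons_val]
      ring
    rw [e1, p1, p2, p3, p4]; ring
  have hlin : ∀ ζ, 3 * T ![e ζ, w, w] = triGrad E w (j, 1) * ζ + triGrad E w (j, -1) * conj ζ := by
    intro ζ
    have he' := seqBound_single s j ζ
    have s2 := (hsum (e ζ) w w _ _ _ he' hw hw).1
    have ee : ∀ p : Triad d, triTerm E.cf ![e ζ, w, w] p = sval (e ζ) (p.2 0, p.1 0) * (E.cf p *
        (signedCoeff w (p.1 1) (p.2 1) * signedCoeff w (p.1 2) (p.2 2))) := by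
      intro p
      simp only [triTerm, sval, Fin.prod_univ_three, Matrix.cons_val_zero, Matrix.cons_val_one,
        Matrix.cons_val]
      ring
    have := hasSum_mul_triGrad E w (sval (e ζ)) (by simpa only [ee] using s2)
    simp only [← ee] at this
    refine this.unique ?_
    have hf := hasSum_sum_of_ne_finset_zero (s := {((j, 1) : SMode d), (j, -1)})
      (f := fun x => sval (e ζ) x * triGrad E w x) (L := .unconditional _) fun x hx => by
        simp only [Finset.mem_insert, Finset.mem_singleton, not_or] at hx
        obtain ⟨k, σ⟩ := x
        have hk : k ≠ j := by
          rintro rfl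
          rcases Int.units_eq_one_or σ with rfl | rfl
          · exact hx.1 rfl
          · exact hx.2 rfl
        simp [sval, signedCoeff, he, hk]
    rw [Finset.sum_pair (by simp)] at hf
    convert hf using 1
    simp [sval, signedCoeff, he]
    ring
  have hupd : ∀ ζ, Function.update w j (w j + ζ) = w + e ζ := by
    intro ζ; ext k
    by_cases h : k = j
    · subst h; simp [he]
    · simp [he, h]
  have hrem : HasFDerivAt (𝕜 := ℝ) (fun ζ => 3 * T ![e ζ, e ζ, w] + T ![e ζ, e ζ, e ζ])
      (0 : ℂ →L[ℝ] ℂ) 0 := by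
    refine Asymptotics.IsBigO.hasFDerivAt (n := 2) (Asymptotics.IsBigO.of_bound
      (triConst d s * K * (3 * (J * J * B) + J * J * J)) ?_) (by norm_num)
    filter_upwards [Metric.ball_mem_nhds (0 : ℂ) one_pos] with ζ hζ
    have hζ1 : ‖ζ‖ ≤ 1 := (mem_ball_zero_iff.1 hζ).le
    have he' := seqBound_single s j ζ
    have b1 := (hsum (e ζ) (e ζ) w _ _ _ he' he' hw).2
    have b2 := (hsum (e ζ) (e ζ) (e ζ) _ _ _ he' he' he').2
    have hk := (triConst_pos d s).le
    rw [sub_zero, norm_pow, norm_norm]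
    calc _ ≤ 3 * ‖T ![e ζ, e ζ, w]‖ + ‖T ![e ζ, e ζ, e ζ]‖ := by
          refine (norm_add_le _ _).trans ?_
          rw [norm_mul]; norm_num
      _ ≤ 3 * (triConst d s * K * (J * ‖ζ‖ * (J * ‖ζ‖) * B))
          + triConst d s * K * (J * ‖ζ‖ * (J * ‖ζ‖) * (J * 1)) := by
          gcongr
          exact b2.trans (by gcongr)
      _ = _ := by ring
  rw [HasWirtingerDerivAt]
  have hl : HasFDerivAt (𝕜 := ℝ) (fun ζ : ℂ => triGrad E w (j, 1) * ζ + triGrad E w (j, -1) * conj ζ)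
      (triGrad E w (j, 1) • (ContinuousLinearMap.id ℝ ℂ)
        + triGrad E w (j, -1) • (Complex.conjCLE : ℂ →L[ℝ] ℂ)) 0 :=
    (triGrad E w (j, 1) • (ContinuousLinearMap.id ℝ ℂ)
        + triGrad E w (j, -1) • (Complex.conjCLE : ℂ →L[ℝ] ℂ)).hasFDerivAt
  have := (hl.const_add (T ![w, w, w])).add hrem
  rw [add_zero] at this
  refine this.congr_of_eventuallyEq (Filter.Eventually.of_forall fun ζ => ?_)
  simp only [hupd, hexp, hlin, Pi.add_apply]

/-- Summation of the gradient against a real diagonal operator. -/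
lemma hasSum_weighted_triGrad (E : TrilinearHamiltonian d) (w : Seq d) (l : Mode d → ℝ)
    (hl : Summable fun p : Triad d => ‖(l (p.2 0) : ℂ) * E.term w p‖) :
    Summable (fun p : Triad d => ((∑ i, ((p.1 i : ℤ) : ℝ) * l (p.2 i) : ℝ) : ℂ) * E.term w p) ∧
    HasSum (fun x : SMode d => (((x.2 : ℤ) : ℝ) * l x.1 : ℝ) * sval w x * triGrad E w x)
      (∑' p : Triad d, ((∑ i, ((p.1 i : ℤ) : ℝ) * l (p.2 i) : ℝ) : ℂ) * E.term w p) := by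
  set t : Fin 3 → Triad d → ℂ := fun i p => ((((p.1 i : ℤ) : ℝ) * l (p.2 i) : ℝ) : ℂ) * E.term w p
    with ht
  have hterm : ∀ ρ (p : Triad d), E.term w (permEquiv ρ p) = E.term w p := by
    intro ρ p
    exact E.triTerm_perm ρ (fun _ => w) p
  have hperm : ∀ i p, t 0 (permEquiv (Equiv.swap 0 i) p) = t i p := by
    intro i p
    simp only [ht, hterm]
    simp [permEquiv]
  have h0 : Summable fun p => ‖t 0 p‖ := by
    refine hl.congr fun p => ?_
    simp only [ht, norm_mul, Complex.norm_real, Real.norm_eq_abs]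
    rcases Int.units_eq_one_or (p.1 0) with h | h <;> simp [h]
  have hi : ∀ i, HasSum (t i) (∑' p, t 0 p) := by
    intro i
    have := (permEquiv (Equiv.swap 0 i)).hasSum_iff.2 h0.of_norm.hasSum
    exact this.congr_fun fun p => (hperm i p).symm
  have hsum := hasSum_sum (s := Finset.univ) (f := t) fun i _ => hi i
  have e : ∀ p : Triad d, ((∑ i, ((p.1 i : ℤ) : ℝ) * l (p.2 i) : ℝ) : ℂ) * E.term w p
      = ∑ i, t i p := by
    intro p
    simp only [ht]
    rw [← Finset.sum_mul]; push_cast; rfl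
  simp only [e]
  refine ⟨hsum.summable, ?_⟩
  rw [hsum.tsum_eq]
  have ee : ∀ p : Triad d, t 0 p = (fun x : SMode d => (((x.2 : ℤ) : ℝ) * l x.1 : ℝ) * sval w x)
      (p.2 0, p.1 0) * (E.cf p *
        (signedCoeff w (p.1 1) (p.2 1) * signedCoeff w (p.1 2) (p.2 2))) := by
    intro p
    simp only [ht, TrilinearHamiltonian.term, TrilinearHamiltonian.cf, sval, Fin.prod_univ_three]
    ring
  have := hasSum_mul_triGrad E w (fun x : SMode d => (((x.2 : ℤ) : ℝ) * l x.1 : ℝ) * sval w x)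
    (by simpa only [ee] using h0)
  simp only [← ee] at this
  simpa using this

/-- The gradient of a bounded trilinear Hamiltonian against a sequence. -/
lemma summable_sval_triGrad (E : TrilinearHamiltonian d) {s M K A B : ℝ}
    (hM : 0 ≤ M) (hs : M + 1 + d ≤ s) (hK : 0 ≤ K) (hE : E.IsBdd s M K) {w y : Seq d}
    (hw : SeqBound s w B) (hy : SeqBound s y A) (σ : SMode d → ℂ) (hσ : ∀ x, ‖σ x‖ ≤ 1) :
    Summable (fun x => σ x * sval y x * triGrad E w x) ∧
      ‖∑' x, σ x * sval y x * triGrad E w x‖ ≤ 3 * (triConst d s * K * (A * B * B)) := by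
  obtain ⟨h1, h2⟩ := E.summable_triTerm hM hs hK hE (x := ![y, w, w]) (A := ![A, B, B])
      (by intro i; fin_cases i <;> assumption)
  have ee : ∀ p : Triad d, ‖(σ (p.2 0, p.1 0) * sval y (p.2 0, p.1 0)) * (E.cf p *
        (signedCoeff w (p.1 1) (p.2 1) * signedCoeff w (p.1 2) (p.2 2)))‖
      ≤ ‖triTerm E.cf ![y, w, w] p‖ := by
    intro p
    simp only [triTerm, sval, Fin.prod_univ_three, Matrix.cons_val_zero, Matrix.cons_val_one,
      Matrix.cons_val, norm_mul]
    have := hσ (p.2 0, p.1 0)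
    calc _ ≤ 1 * ‖signedCoeff y (p.1 0) (p.2 0)‖ * (‖E.cf p‖ *
        (‖signedCoeff w (p.1 1) (p.2 1)‖ * ‖signedCoeff w (p.1 2) (p.2 2)‖)) := by gcongr
      _ = _ := by ring
  have h3 := Summable.of_nonneg_of_le (fun _ => norm_nonneg _) ee h1
  have h4 := hasSum_mul_triGrad E w (fun x => σ x * sval y x) h3
  refine ⟨h4.summable, ?_⟩
  rw [h4.tsum_eq, norm_mul]
  have h5 := (norm_tsum_le_tsum_norm h3).trans ((h3.tsum_le_tsum ee h1).trans h2)
  simp only [Matrix.cons_val_zero, Matrix.cons_val_one, Matrix.cons_val] at h5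
  norm_num
  exact h5

lemma hasWirtingerDerivAt_sobolevEnergy {s B : ℝ} {w : Seq d} (hw : SeqBound s w B) (j : Mode d) :
    HasWirtingerDerivAt (fun v => (sobolevEnergy s v : ℂ)) w j (j.weight s * conj (w j))
      (j.weight s * w j) := by
  have hsum : Summable fun k : Mode d => k.weight s * ‖w k‖ ^ 2 := by
    refine (L2Bound.summable_sq hw).congr fun k => ?_
    rw [k.weight_eq]; ring
  have e : (fun ζ : ℂ => (sobolevEnergy s (Function.update w j (w j + ζ)) : ℂ))
      = fun ζ => Complex.ofRealCLM (sobolevEnergy s w + j.weight s * (‖w j + ζ‖ ^ 2 - ‖w j‖ ^ 2)) := by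
    ext ζ
    have h := tsum_shift (fun k c => k.weight s * ‖c‖ ^ 2) w hsum j ζ 0
    have e2 : shift w j ζ 0 = Function.update w j (w j + ζ) := by
      ext k
      by_cases hk : k = j
      · subst hk; simp [shift]
      · simp [shift, hk]
    rw [e2] at h
    rw [sobolevEnergy, h, sobolevEnergy]
    simp [mul_sub]
  rw [HasWirtingerDerivAt, e]
  have h1 : HasFDerivAt (fun ζ : ℂ => ‖w j + ζ‖ ^ 2) (normSqDeriv (w j)) 0 := by
    have h2 : HasFDerivAt (fun ζ : ℂ => w j + ζ) (ContinuousLinearMap.id ℝ ℂ) 0 :=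
      (hasFDerivAt_id (𝕜 := ℝ) (0 : ℂ)).const_add _
    have h3 := HasFDerivAt.comp (0 : ℂ) (g := fun η : ℂ => ‖η‖ ^ 2)
      (hasFDerivAt_normSq (w j + 0)) h2
    simpa [Function.comp_def] using h3
  have h4 := Complex.ofRealCLM.hasFDerivAt.comp (0 : ℂ)
    (((h1.sub_const (‖w j‖ ^ 2)).const_mul (j.weight s)).const_add (sobolevEnergy s w))
  refine h4.congr_fderiv (ContinuousLinearMap.ext fun ζ => ?_)
  apply Complex.ext <;> simp [normSqDeriv] <;> ring

/-! ### The cubic part of the Hamiltonian -/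

/-- The lattice vector of a signed mode. -/
def svec (y : SMode d) : Fin d → ℤ := (y.2 : ℤ) • y.1.1

lemma svec_flip (y : SMode d) : svec (flip y) = -svec y := by
  simp [svec, flip]

/-- The Fourier symbol of `w ↦ z` on signed modes. -/
def symbolE (κ p : ℝ) (a : Fin d → ℝ) (σ : ℤˣ) (j : Mode d) : ℝ :=
  if σ = 1 then symbolU κ p a j else symbolV κ p a j

lemma fc_tsum_char {ι : Type*} [Countable ι] {c : ι → ℂ} (hc : Summable fun i => ‖c i‖)
    (v : ι → Fin d → ℤ) (k : Fin d → ℤ) :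
    fc (fun x => ∑' i, c i * char (v i) x) k = ∑' i, if v i = k then c i else 0 := by
  have hF : ∀ i, Continuous fun x => c i * char (v i) x * char (-k) x := fun i =>
    (continuous_const.mul (continuous_char _)).mul (continuous_char _)
  have h := hasSum_integral_of_summable_integral_norm (μ := boxMeasure d)
    (F := fun i x => c i * char (v i) x * char (-k) x)
    (fun i => integrable_boxMeasure (hF i)) (by simpa [norm_char] using hc)
  rw [fc]
  simp only [← tsum_mul_right]
  rw [← h.tsum_eq]
  refine tsum_congr fun i => ?_
  simp only [mul_assoc, ← char_add]
  rw [integral_const_mul, integral_char]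
  by_cases hk : v i = k
  · simp [hk]
  · have : v i + -k ≠ 0 := by
      intro h0; exact hk (by rw [← sub_eq_zero, sub_eq_add_neg]; exact h0)
    simp [hk, this]

lemma summable_smode {f : SMode d → ℝ} (h1 : Summable fun j => f (j, 1))
    (h2 : Summable fun j => f (j, -1)) (h0 : ∀ x, 0 ≤ f x) : Summable f := by
  refine (summable_prod_of_nonneg h0).2 ⟨fun j => (hasSum_fintype _).summable, ?_⟩
  refine (h1.add h2).congr fun j => ?_
  rw [tsum_fintype, UnitsInt.univ, Finset.sum_pair (by decide)]

lemma symbolE_abs_le {κ p : ℝ} (hκ : 0 < κ) (hp : 0 < p) {a : Fin d → ℝ} (ha : a ∈ cube d)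
    (σ : ℤˣ) (j : Mode d) : |symbolE κ p a σ j| ≤ 1 + p / (4 * κ) := by
  obtain ⟨-, h1, h2⟩ := symbol_facts hκ hp ha j
  unfold symbolE; split_ifs <;> assumption

lemma summable_sval {s B : ℝ} (hs : d ≤ s) {w : Seq d} (hw : SeqBound s w B) :
    Summable fun y : SMode d => ‖sval w y‖ := by
  have := hw.summable_norm hs
  exact summable_smode (by simpa only [norm_sval] using this)
    (by simpa only [norm_sval] using this) fun _ => norm_nonneg _

lemma hasSum_toFun {κ p s B : ℝ} (hκ : 0 < κ) (hp : 0 < p) {a : Fin d → ℝ} (ha : a ∈ cube d)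
    (hs : d ≤ s) {w : Seq d} (hw : SeqBound s w B) (x : Fin d → ℝ) :
    HasSum (fun y : SMode d => (normConst d : ℂ) * ((symbolE κ p a y.2 y.1 : ℝ) * sval w y)
      * char (svec y) x) (toFun (diagonalize κ p a w) x) := by
  set K := 1 + p / (4 * κ)
  have hw1 := hw.summable_norm hs
  have hsum : Summable (fun y : SMode d => (normConst d : ℂ) *
      ((symbolE κ p a y.2 y.1 : ℝ) * sval w y) * char (svec y) x) := by
    refine Summable.of_norm_bounded (((summable_sval hs hw).mul_left K).mul_left (normConst d))
      fun y => ?_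
    rw [norm_mul, norm_char, mul_one, norm_mul, norm_mul, Complex.norm_real, Complex.norm_real,
      Real.norm_eq_abs, abs_of_pos (normConst_pos d)]
    have := symbolE_abs_le hκ hp ha y.2 y.1
    have := normConst_pos d
    rw [Real.norm_eq_abs]
    gcongr
  have h1 : Summable fun j : Mode d => (symbolU κ p a j : ℂ) * w j * char j.1 x := by
    refine Summable.of_norm_bounded (hw1.mul_left K) fun j => ?_
    obtain ⟨-, h1, h2⟩ := symbol_facts hκ hp ha j
    rw [norm_mul, norm_char, mul_one, norm_mul, Complex.norm_real]
    gcongr; exact h1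
  have h2 : Summable fun j : Mode d => (symbolV κ p a j : ℂ) * conj (w j) * char (-j.1) x := by
    refine Summable.of_norm_bounded (hw1.mul_left K) fun j => ?_
    obtain ⟨-, h1, h2⟩ := symbol_facts hκ hp ha j
    rw [norm_mul, norm_char, mul_one, norm_mul, Complex.norm_real, Complex.norm_conj]
    gcongr; exact h2
  let negEquiv : Mode d ≃ Mode d := ⟨Mode.neg, Mode.neg, Mode.neg_neg, Mode.neg_neg⟩
  have h3 : HasSum (fun j : Mode d => (symbolV κ p a j : ℂ) * conj (w j.neg) * char j.1 x)
      (∑' j : Mode d, (symbolV κ p a j : ℂ) * conj (w j) * char (-j.1) x) := by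
    refine (negEquiv.hasSum_iff.2 h2.hasSum).congr_fun fun j => ?_
    change _ = (symbolV κ p a j.neg : ℂ) * conj (w j.neg) * char (-(-j.1)) x
    rw [symbolV_neg, neg_neg]
  have e : toFun (diagonalize κ p a w) x = (normConst d : ℂ) *
      (∑' j : Mode d, (symbolU κ p a j : ℂ) * w j * char j.1 x
        + ∑' j : Mode d, (symbolV κ p a j : ℂ) * conj (w j) * char (-j.1) x) := by
    rw [← (h1.hasSum.add h3).tsum_eq]
    change (normConst d : ℂ) * ∑' j : Mode d, _ * char j.1 x = _
    congr 1
    refine tsum_congr fun j => ?_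
    rw [diagonalize_eq]; ring
  rw [e, ← h1.tsum_add h2, ← tsum_mul_left]
  have h4 := hsum.hasSum.prod_fiberwise fun j => hasSum_fintype _
  convert hsum.hasSum using 1
  rw [← h4.tsum_eq]
  refine tsum_congr fun j => ?_
  rw [UnitsInt.univ, Finset.sum_pair (by decide)]
  simp [symbolE, sval, signedCoeff, svec]
  ring

/-- The constant of the cubic part. -/
def cubicConst (d : ℕ) (κ m : ℝ) : ℝ := 2 / 3 * (√m * normConst d / hbar κ)

/-- The coefficients of the cubic part. -/
def cubicCoeff (κ m : ℝ) (g : ℝ → ℝ) (a : Fin d → ℝ) (σ : Fin 3 → ℤˣ) (j : Fin 3 → Mode d) : ℝ :=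
  cubicConst d κ m * ((4 * deriv g m + 2 * m * iteratedDeriv 2 g m) *
      ∏ i, ((symbolE κ (m * deriv g m) a (σ i) (j i) + symbolE κ (m * deriv g m) a (-σ i) (j i)) / 2)
    - deriv g m / 2 * (∏ i, symbolE κ (m * deriv g m) a (σ i) (j i)
      + ∏ i, symbolE κ (m * deriv g m) a (-σ i) (j i)))

lemma momentum_perm (ρ : Equiv.Perm (Fin 3)) (σ : Fin 3 → ℤˣ) (j : Fin 3 → Mode d) :
    momentum (σ ∘ ρ) (j ∘ ρ) = momentum σ j :=
  Equiv.sum_comp ρ fun i => (σ i : ℤ) • (j i).1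

lemma momentum_neg (σ : Fin 3 → ℤˣ) (j : Fin 3 → Mode d) :
    momentum (fun i => -σ i) j = -momentum σ j := by
  simp [momentum]

/-- The cubic part of the Hamiltonian. -/
def cubicHam (κ m : ℝ) (g : ℝ → ℝ) (a : Fin d → ℝ) : TrilinearHamiltonian d where
  coeff σ j := if momentum σ j = 0 then (cubicCoeff κ m g a σ j : ℂ) else 0
  symmetric ρ σ j := by
    rw [momentum_perm]
    congr 2
    simp only [cubicCoeff, Function.comp_apply]
    rw [Equiv.prod_comp ρ fun i => ((symbolE κ (m * deriv g m) a (σ i) (j i)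
        + symbolE κ (m * deriv g m) a (-σ i) (j i)) / 2),
      Equiv.prod_comp ρ fun i => symbolE κ (m * deriv g m) a (σ i) (j i),
      Equiv.prod_comp ρ fun i => symbolE κ (m * deriv g m) a (-σ i) (j i)]
  momentum_support σ j h := if_neg h
  reality σ j := by
    simp only [momentum_neg, neg_eq_zero]
    have : cubicCoeff κ m g a (fun i => -σ i) j = cubicCoeff κ m g a σ j := by
      simp only [cubicCoeff, neg_neg]
      simp only [add_comm]
    rw [this]
    split_ifs <;> simp

lemma exists_cubicHam_bound (d : ℕ) {κ m : ℝ} {g : ℝ → ℝ} (hκ : 0 < κ) (hm : 0 < m)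
    (hg' : 0 < deriv g m) : ∃ C : ℝ, 0 < C ∧ ∀ a ∈ cube d, ∀ σ j,
      ‖(cubicHam κ m g a).coeff σ j‖ ≤ C := by
  have hp : 0 < m * deriv g m := mul_pos hm hg'
  set K := 1 + m * deriv g m / (4 * κ)
  have hK : 0 < K := by positivity
  set G := 4 * deriv g m + 2 * m * iteratedDeriv 2 g m
  refine ⟨|cubicConst d κ m| * (|G| * K ^ 3 + deriv g m / 2 * (K ^ 3 + K ^ 3)) + 1, by positivity,
    fun a ha σ j => ?_⟩
  have hE := fun σ j => symbolE_abs_le hκ hp ha σ j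
  have hprod : ∀ f : Fin 3 → ℝ, (∀ i, |f i| ≤ K) → |∏ i, f i| ≤ K ^ 3 := by
    intro f hf
    rw [Finset.abs_prod]
    calc _ ≤ ∏ _i : Fin 3, K := Finset.prod_le_prod (fun i _ => abs_nonneg _) fun i _ => hf i
      _ = _ := by simp
  have h1 := hprod (fun i => (symbolE κ (m * deriv g m) a (σ i) (j i)
    + symbolE κ (m * deriv g m) a (-σ i) (j i)) / 2) fun i => by
      have := abs_le.1 (hE (σ i) (j i)); have := abs_le.1 (hE (-σ i) (j i))
      rw [abs_le]; constructor <;> linarith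
  have h2 := hprod (fun i => symbolE κ (m * deriv g m) a (σ i) (j i)) fun i => hE _ _
  have h3 := hprod (fun i => symbolE κ (m * deriv g m) a (-σ i) (j i)) fun i => hE _ _
  simp only [cubicHam]
  split_ifs
  · rw [Complex.norm_real, Real.norm_eq_abs, cubicCoeff, abs_mul]
    have : |G * ∏ i, ((symbolE κ (m * deriv g m) a (σ i) (j i)
        + symbolE κ (m * deriv g m) a (-σ i) (j i)) / 2)
      - deriv g m / 2 * (∏ i, symbolE κ (m * deriv g m) a (σ i) (j i)
      + ∏ i, symbolE κ (m * deriv g m) a (-σ i) (j i))|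
        ≤ |G| * K ^ 3 + deriv g m / 2 * (K ^ 3 + K ^ 3) := by
      refine (abs_sub _ _).trans ?_
      rw [abs_mul, abs_mul, abs_of_pos (by positivity : 0 < deriv g m / 2)]
      gcongr
      exact (abs_add_le _ _).trans (add_le_add h2 h3)
    have := mul_le_mul_of_nonneg_left this (abs_nonneg (cubicConst d κ m))
    linarith
  · rw [norm_zero]; positivity

set_option maxHeartbeats 1000000 in
/-- The quadratic part of the gradient is the gradient of the cubic part. -/
theorem quadGrad_eq_triGrad {κ m s B : ℝ} {g : ℝ → ℝ} (hκ : 0 < κ) (hm : 0 < m)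
    (hg' : 0 < deriv g m) {a : Fin d → ℝ} (ha : a ∈ cube d) (hs : d ≤ s) {w : Seq d}
    (hw : SeqBound s w B) (j : Mode d) :
    quadGrad κ m g a w j = triGrad (cubicHam κ m g a) w (j, 1) := by
  set p := m * deriv g m with hpdef
  have hp : 0 < p := mul_pos hm hg'
  set K := 1 + p / (4 * κ) with hK
  have hK0 : 0 < K := by positivity
  set c₀ := normConst d with hc₀def
  have hc₀ : 0 < c₀ := normConst_pos d
  set z := diagonalize κ p a w with hz
  set ξ : SMode d → ℝ := fun y => symbolE κ p a y.2 y.1 with hξ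
  set η : SMode d → ℝ := fun y => symbolE κ p a (-y.2) y.1 with hη
  have hξK : ∀ y, |ξ y| ≤ K := fun y => symbolE_abs_le hκ hp ha _ _
  have hηK : ∀ y, |η y| ≤ K := fun y => symbolE_abs_le hκ hp ha _ _
  have hflip1 : ∀ y, ξ (flip y) = η y := fun y => rfl
  have hflip2 : ∀ y, η (flip y) = ξ y := fun y => by
    change symbolE κ p a (- -y.2) y.1 = _; rw [neg_neg]
  have hsv := summable_sval hs hw
  set X : SMode d → ℂ := fun y => (c₀ : ℂ) * (((ξ y + η y) / 2 : ℝ) * sval w y) with hX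
  set Y : SMode d → ℂ := fun y => (c₀ : ℂ) * (((ξ y - η y) / 2 : ℝ) * sval w y) with hY
  have hXs : Summable fun y => ‖X y‖ := by
    refine Summable.of_nonneg_of_le (fun _ => norm_nonneg _) (fun y => ?_)
      ((hsv.mul_left K).mul_left c₀)
    simp only [hX, norm_mul, Complex.norm_real, Real.norm_eq_abs, abs_of_pos hc₀]
    gcongr
    have := abs_le.1 (hξK y); have := abs_le.1 (hηK y)
    rw [abs_le]; constructor <;> linarith
  have hYs : Summable fun y => ‖Y y‖ := by
    refine Summable.of_nonneg_of_le (fun _ => norm_nonneg _) (fun y => ?_)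
      ((hsv.mul_left K).mul_left c₀)
    simp only [hY, norm_mul, Complex.norm_real, Real.norm_eq_abs, abs_of_pos hc₀]
    gcongr
    have := abs_le.1 (hξK y); have := abs_le.1 (hηK y)
    rw [abs_le]; constructor <;> linarith
  have hchar : ∀ {f : SMode d → ℂ}, (Summable fun y => ‖f y‖) → ∀ x,
      Summable fun y => ‖f y * char (svec y) x‖ := by
    intro f hf x; simpa [norm_char] using hf
  have hz1 : ∀ x, toFun z x = (∑' y, X y * char (svec y) x) + ∑' y, Y y * char (svec y) x := by
    intro x
    rw [← (hasSum_toFun hκ hp ha hs hw x).tsum_eq,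
      ← (hchar hXs x).of_norm.tsum_add (hchar hYs x).of_norm]
    refine tsum_congr fun y => ?_
    simp only [hX, hY, hξ]; push_cast; ring
  have hz2 : ∀ x, conj (toFun z x)
      = (∑' y, X y * char (svec y) x) - ∑' y, Y y * char (svec y) x := by
    intro x
    rw [← (hasSum_toFun hκ hp ha hs hw x).tsum_eq, Complex.conj_tsum, ← flip.tsum_eq,
      ← (hchar hXs x).of_norm.tsum_sub (hchar hYs x).of_norm]
    refine tsum_congr fun y => ?_
    rw [map_mul, conj_char, svec_flip, neg_neg, map_mul, map_mul, sval_flip, Complex.conj_conj,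
      Complex.conj_ofReal, Complex.conj_ofReal]
    change (c₀ : ℂ) * ((ξ (flip y) : ℂ) * _) * _ = _
    rw [hflip1]
    simp only [hX, hY]; push_cast; ring
  set g₁ := deriv g m
  set g₂ := iteratedDeriv 2 g m
  set q : SMode d × SMode d → ℂ := fun y => (√m : ℂ) * (((3 * g₁ + 2 * m * g₂ : ℝ) : ℂ) * (X y.1 * X y.2)
    - (g₁ : ℂ) * (Y y.1 * Y y.2) + (g₁ : ℂ) * (X y.1 * Y y.2 + Y y.1 * X y.2)) with hq
  have hqs : Summable fun y => ‖q y‖ := by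
    have h1 := (hXs.mul_norm hXs)
    have h2 := (hYs.mul_norm hYs)
    have h3 := (hXs.mul_norm hYs)
    have h4 := (hYs.mul_norm hXs)
    refine Summable.of_nonneg_of_le (fun _ => norm_nonneg _) (fun y => ?_)
      ((((h1.mul_left ‖((3 * g₁ + 2 * m * g₂ : ℝ) : ℂ)‖).add (h2.mul_left ‖(g₁ : ℂ)‖)).add
        ((h3.add h4).mul_left ‖(g₁ : ℂ)‖)).mul_left ‖(√m : ℂ)‖)
    simp only [hq]
    rw [norm_mul]
    gcongr
    refine (norm_add_le _ _).trans (add_le_add ((norm_sub_le _ _).trans ?_) ?_)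
    · rw [norm_mul, norm_mul _ (Y _ * Y _)]
    · rw [norm_mul]; gcongr; exact norm_add_le _ _
  have hQ : quadPart g m z = fun x => ∑' y : SMode d × SMode d, q y * char (svec y.1 + svec y.2) x := by
    ext x
    have hx := (hchar hXs x)
    have hy := (hchar hYs x)
    have m1 := tsum_mul_tsum_of_summable_norm hx hx
    have m2 := tsum_mul_tsum_of_summable_norm hy hy
    have m3 := tsum_mul_tsum_of_summable_norm hx hy
    have m4 := tsum_mul_tsum_of_summable_norm hy hx
    have h1 := (hx.mul_norm hx).of_norm
    have h2 := (hy.mul_norm hy).of_norm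
    have h3 := (hx.mul_norm hy).of_norm
    have h4 := (hy.mul_norm hx).of_norm
    have hS := ((((h1.hasSum.mul_left ((3 * g₁ + 2 * m * g₂ : ℝ) : ℂ)).sub (h2.hasSum.mul_left (g₁ : ℂ))).add
        ((h3.hasSum.add h4.hasSum).mul_left (g₁ : ℂ))).mul_left (√m : ℂ)).tsum_eq
    rw [← m1, ← m2, ← m3, ← m4] at hS
    refine Eq.symm ((tsum_congr fun y => ?_).trans (hS.trans ?_))
    · simp only [hq, char_add]; ring
    · rw [quadPart, rePart_eq, hz2, hz1]
      push_cast; ring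
  have hfc : ∀ k, fc (quadPart g m z) k
      = ∑' y : SMode d × SMode d, if svec y.1 + svec y.2 = k then q y else 0 := by
    intro k; rw [hQ]; exact fc_tsum_char hqs _ k
  have hfcc : conj (fc (quadPart g m z) j.1) = ∑' y : SMode d × SMode d,
      if svec y.1 + svec y.2 = -j.1 then conj (q (flip y.1, flip y.2)) else 0 := by
    rw [hfc, Complex.conj_tsum, ← (Equiv.prodCongr flip flip).tsum_eq]
    refine tsum_congr fun y => ?_
    simp only [Equiv.prodCongr_apply, Prod.map_fst, Prod.map_snd, svec_flip]
    have : (-svec y.1 + -svec y.2 = j.1) ↔ (svec y.1 + svec y.2 = -j.1) := by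
      rw [← neg_add, neg_eq_iff_eq_neg]
    simp only [this]
    split_ifs
    · rfl
    · simp
  have hsu : ∀ k, Summable fun y : SMode d × SMode d => if svec y.1 + svec y.2 = k then q y else 0 := by
    intro k
    refine Summable.of_norm_bounded hqs fun y => ?_
    split_ifs
    · exact le_rfl
    · simp
  have hsc : Summable fun y : SMode d × SMode d =>
      if svec y.1 + svec y.2 = -j.1 then conj (q (flip y.1, flip y.2)) else 0 := by
    refine Summable.of_norm_bounded ((Equiv.prodCongr flip flip).summable_iff.2 hqs) fun y => ?_
    split_ifs
    · rw [Complex.norm_conj]; exact le_rfl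
    · simp
  rw [quadGrad, triGrad, hfcc]
  change _ * (_ + _ * fc (quadPart g m z) (-j.1)) = _
  rw [hfc, ← tsum_mul_left, ← tsum_mul_left, ← (hsc.mul_left _).tsum_add ((hsu _).mul_left _),
    ← tsum_mul_left, ← tsum_mul_left]
  refine tsum_congr fun y => ?_
  have hmom : momentum ![1, y.1.2, y.2.2] ![j, y.1.1, y.2.1] = j.1 + (svec y.1 + svec y.2) := by
    simp [momentum, Fin.sum_univ_three, svec, add_assoc]
  have hcf : (cubicHam κ m g a).cf (triadEquiv ((j, 1), y))
      = if svec y.1 + svec y.2 = -j.1 then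
        (cubicCoeff κ m g a ![1, y.1.2, y.2.2] ![j, y.1.1, y.2.1] : ℂ) else 0 := by
    change (if momentum ![1, y.1.2, y.2.2] ![j, y.1.1, y.2.1] = 0 then _ else _) = _
    rw [hmom]
    have : (j.1 + (svec y.1 + svec y.2) = 0) ↔ (svec y.1 + svec y.2 = -j.1) := by
      rw [add_eq_zero_iff_neg_eq, eq_comm]
    simp only [this]
    rfl
  rw [hcf]
  split_ifs with hy
  · have hc0' : (c₀ : ℂ) ≠ 0 := by exact_mod_cast hc₀.ne'
    have hh : (hbar κ : ℂ) ≠ 0 := by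
      have : hbar κ ≠ 0 := by unfold hbar; positivity
      exact_mod_cast this
    have hU : symbolU κ p a j = symbolE κ p a 1 j := rfl
    have hV : symbolV κ p a j = symbolE κ p a (-1) j := rfl
    simp only [cubicCoeff, Fin.prod_univ_three, Matrix.cons_val_zero, Matrix.cons_val_one,
      Matrix.cons_val, cubicConst, hq, hX, hY, hflip1, hflip2, map_mul, map_add, map_sub,
      Complex.conj_ofReal, sval_flip, Complex.conj_conj]
    have e₁ : symbolE κ (m * deriv g m) a y.1.2 y.1.1 = ξ y.1 := rfl
    have e₂ : symbolE κ (m * deriv g m) a y.2.2 y.2.1 = ξ y.2 := rfl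
    have e₃ : symbolE κ (m * deriv g m) a (-y.1.2) y.1.1 = η y.1 := rfl
    have e₄ : symbolE κ (m * deriv g m) a (-y.2.2) y.2.1 = η y.2 := rfl
    have e₅ : deriv g m = g₁ := rfl
    have e₆ : iteratedDeriv 2 g m = g₂ := rfl
    rw [hU, hV, e₁, e₂, e₃, e₄, ← hpdef, e₅, e₆, ← hc₀def]
    push_cast
    field_simp
    ring
  · simp

/-! ### Three-wave divisors -/

/-- The weighted sum `∑ σ_i l(j_i)`. -/
def signedSum (l : Mode d → ℝ) (σ : Fin 3 → ℤˣ) (j : Fin 3 → Mode d) : ℝ :=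
  ∑ i, ((σ i : ℤ) : ℝ) * l (j i)

lemma signedSum_perm (l : Mode d → ℝ) (ρ : Equiv.Perm (Fin 3)) (σ : Fin 3 → ℤˣ)
    (j : Fin 3 → Mode d) : signedSum l (σ ∘ ρ) (j ∘ ρ) = signedSum l σ j :=
  Equiv.sum_comp ρ fun i => ((σ i : ℤ) : ℝ) * l (j i)

lemma signedSum_neg (l : Mode d → ℝ) (σ : Fin 3 → ℤˣ) (j : Fin 3 → Mode d) :
    signedSum l (fun i => -σ i) j = -signedSum l σ j := by
  simp [signedSum]

lemma mu1_le_iff {j : Fin 3 → Mode d} {R : ℝ} : mu1 j ≤ R ↔ ∀ i, (j i).len ≤ R := by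
  simp [mu1, Fin.forall_fin_succ]

lemma le_mu3_iff {j : Fin 3 → Mode d} {R : ℝ} : R ≤ mu3 j ↔ ∀ i, R ≤ (j i).len := by
  simp [mu3, Fin.forall_fin_succ]

lemma mu1_perm (ρ : Equiv.Perm (Fin 3)) (j : Fin 3 → Mode d) : mu1 (j ∘ ρ) = mu1 j :=
  eq_of_forall_ge_iff fun R => by
    rw [mu1_le_iff, mu1_le_iff]
    exact ρ.forall_congr_left.trans (by simp)

lemma mu3_perm (ρ : Equiv.Perm (Fin 3)) (j : Fin 3 → Mode d) : mu3 (j ∘ ρ) = mu3 j :=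
  eq_of_forall_le_iff fun R => by
    rw [le_mu3_iff, le_mu3_iff]
    exact ρ.forall_congr_left.trans (by simp)

lemma len_le_mu1 (j : Fin 3 → Mode d) (i : Fin 3) : (j i).len ≤ mu1 j := mu1_le_iff.1 le_rfl i

lemma mu3_le_len (j : Fin 3 → Mode d) (i : Fin 3) : mu3 j ≤ (j i).len := le_mu3_iff.1 le_rfl i

lemma one_le_mu3 (j : Fin 3 → Mode d) : 1 ≤ mu3 j := le_mu3_iff.2 fun i => (j i).one_le_len

lemma mu3_le_mu1 (j : Fin 3 → Mode d) : mu3 j ≤ mu1 j := (mu3_le_len j 0).trans (len_le_mu1 j 0)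

lemma one_le_mu1 (j : Fin 3 → Mode d) : 1 ≤ mu1 j := (one_le_mu3 j).trans (mu3_le_mu1 j)

lemma exists_sort (a : Fin d → ℝ) (j : Fin 3 → Mode d) : ∃ ρ : Equiv.Perm (Fin 3),
    (j (ρ 1)).lenSq a ≤ (j (ρ 0)).lenSq a ∧ (j (ρ 2)).lenSq a ≤ (j (ρ 1)).lenSq a := by
  have h := Tuple.monotone_sort fun i => -(j i).lenSq a
  refine ⟨Tuple.sort fun i => -(j i).lenSq a, ?_, ?_⟩
  · exact neg_le_neg_iff.1 (h (by decide : (0 : Fin 3) ≤ 1))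
  · exact neg_le_neg_iff.1 (h (by decide : (1 : Fin 3) ≤ 2))

lemma rpow_sub_rpow_le {x y s : ℝ} (hy : 0 < y) (hyx : y ≤ x) (hs : 1 ≤ s) :
    x ^ s - y ^ s ≤ s * x ^ (s - 1) * (x - y) := by
  have hx : 0 < x := hy.trans_le hyx
  have h := one_add_mul_self_le_rpow_one_add (s := y / x - 1) (by
    have : 0 < y / x := by positivity
    linarith) hs
  rw [add_sub_cancel, div_rpow hy.le hx.le, le_div_iff₀ (rpow_pos_of_pos hx s)] at h
  have e : x ^ s = x ^ (s - 1) * x := by rw [← rpow_add_one hx.ne']; congr 1; ring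
  have e2 : (1 + s * (y / x - 1)) * x ^ s = x ^ s - s * x ^ (s - 1) * (x - y) := by
    rw [e]; field_simp; ring
  linarith

lemma Mode.weight_le {s R : ℝ} (hs : 0 ≤ s) (k : Mode d) (hk : k.len ≤ R) :
    k.weight s ≤ 2 ^ s * R ^ (2 * s) := by
  have h1 := k.one_le_len
  have hR : 0 ≤ R := by linarith
  rw [Mode.weight, rpow_mul hR, rpow_two, ← mul_rpow zero_le_two (by positivity)]
  have : k.len ^ 2 ≤ R ^ 2 := by gcongr
  gcongr
  nlinarith

lemma Mode.weight_nonneg (s : ℝ) (k : Mode d) : 0 ≤ k.weight s := by unfold Mode.weight; positivity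

lemma abs_weight_sub_le {s R : ℝ} (hs : 1 ≤ s) (k l : Mode d) (hk : k.len ≤ R) (hl : l.len ≤ R) :
    |k.weight s - l.weight s| ≤ s * 2 ^ s * R ^ (2 * s - 1) * |k.len - l.len| := by
  wlog h : l.len ≤ k.len generalizing k l
  · rw [abs_sub_comm, abs_sub_comm k.len]
    exact this l k hl hk (le_of_not_ge h)
  have k1 := k.one_le_len
  have l1 := l.one_le_len
  have hR : 0 < R := by linarith
  have hx : l.len ^ 2 ≤ k.len ^ 2 := by gcongr
  have h1 := rpow_sub_rpow_le (x := 1 + k.len ^ 2) (y := 1 + l.len ^ 2) (by positivity)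
    (by linarith) hs
  have h2 : 0 ≤ k.weight s - l.weight s := by
    unfold Mode.weight
    have : (1 + l.len ^ 2) ^ s ≤ (1 + k.len ^ 2) ^ s := by gcongr
    linarith
  rw [abs_of_nonneg h2, abs_of_nonneg (by linarith)]
  refine h1.trans ?_
  have e : s * 2 ^ s * R ^ (2 * s - 1) * (k.len - l.len)
      = s * (2 * R ^ 2) ^ (s - 1) * (2 * R * (k.len - l.len)) := by
    rw [mul_rpow zero_le_two (by positivity), ← rpow_two, ← rpow_mul hR.le,
      show (2 : ℝ) ^ s = 2 ^ (s - 1) * 2 by rw [← rpow_add_one two_ne_zero]; congr 1; ring,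
      show R ^ (2 * s - 1) = R ^ (2 * (s - 1)) * R by rw [← rpow_add_one hR.ne']; congr 1; ring]
    ring
  have h3 : 1 + k.len ^ 2 ≤ 2 * R ^ 2 := by nlinarith
  rw [e]
  have h4 : (1 + k.len ^ 2) - (1 + l.len ^ 2) ≤ 2 * R * (k.len - l.len) := by nlinarith
  have : 0 ≤ s - 1 := by linarith
  have h5 : 0 ≤ (1 + k.len ^ 2) - (1 + l.len ^ 2) := by linarith
  gcongr

lemma signs_cases (σ : Fin 3 → ℤˣ) : ((σ 0 * σ 1 = 1) ∨ (σ 0 * σ 1 = -1)) :=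
  Int.units_eq_one_or _

lemma abs_signedSum_weight_le {s : ℝ} (hs : 0 ≤ s) (σ : Fin 3 → ℤˣ) (j : Fin 3 → Mode d) :
    |signedSum (Mode.weight s) σ j| ≤ 3 * 2 ^ s * mu1 j ^ (2 * s) := by
  have h := fun i => (j i).weight_le hs (len_le_mu1 j i)
  refine (Finset.abs_sum_le_sum_abs _ _).trans ?_
  have : ∀ i ∈ (Finset.univ : Finset (Fin 3)), |((σ i : ℤ) : ℝ) * (j i).weight s|
      ≤ 2 ^ s * mu1 j ^ (2 * s) := by
    intro i _
    rw [abs_mul, abs_of_nonneg ((j i).weight_nonneg s)]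
    rcases Int.units_eq_one_or (σ i) with h' | h' <;> simpa [h'] using h i
  refine (Finset.sum_le_sum this).trans (le_of_eq ?_)
  rw [Finset.sum_const, Finset.card_univ, Fintype.card_fin, nsmul_eq_mul]
  push_cast; ring

section sorted
variable {a : Fin d → ℝ} {σ : Fin 3 → ℤˣ} {j : Fin 3 → Mode d}

lemma len_two_le (ha : a ∈ cube d) (h1 : (j 1).lenSq a ≤ (j 0).lenSq a)
    (h2 : (j 2).lenSq a ≤ (j 1).lenSq a) : (j 2).len ≤ 2 * mu3 j := by
  have h : ∀ i, (j 2).len ≤ 2 * (j i).len := by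
    intro i
    have k1 : (j 2).lenSq a ≤ (j i).lenSq a := by
      fin_cases i
      · exact h2.trans h1
      · exact h2
      · exact le_rfl
    have k2 := (j 2).le_lenSq ha
    have k3 := (j i).lenSq_le ha
    have := (j i).len_nonneg
    apply abs_le_of_sq_le_sq' _ (by positivity) |>.2
    nlinarith
  have : (j 2).len / 2 ≤ mu3 j := le_mu3_iff.2 fun i => by linarith [h i]
  linarith

lemma mu1_sq_le (ha : a ∈ cube d) (h1 : (j 1).lenSq a ≤ (j 0).lenSq a)
    (h2 : (j 2).lenSq a ≤ (j 1).lenSq a) : mu1 j ^ 2 ≤ (j 0).lenSq a := by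
  have h : mu1 j ≤ √((j 0).lenSq a) := mu1_le_iff.2 fun i => by
    apply Real.le_sqrt_of_sq_le
    refine ((j i).le_lenSq ha).trans ?_
    fin_cases i
    · exact le_rfl
    · exact h1
    · exact h2.trans h1
  have h0 : 0 ≤ (j 0).lenSq a := (sq_nonneg _).trans ((j 0).le_lenSq ha)
  have := one_le_mu1 j
  calc mu1 j ^ 2 ≤ √((j 0).lenSq a) ^ 2 := by gcongr
    _ = _ := Real.sq_sqrt h0

lemma abs_omega_sum_ge {κ p : ℝ} (hκ : 0 < κ) (hp : 0 < p) (ha : a ∈ cube d)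
    (h1 : (j 1).lenSq a ≤ (j 0).lenSq a)
    (h2 : (j 2).lenSq a ≤ (j 1).lenSq a) (hσ : σ 0 * σ 1 = 1) :
    √κ * mu1 j ^ 2 ≤ |signedSum (omega κ p a) σ j| := by
  have hpos : ∀ i, 0 ≤ (j i).lenSq a := fun i => (sq_nonneg _).trans ((j i).le_lenSq ha)
  have k0 : √κ * (j 0).lenSq a ≤ omega κ p a (j 0) := sqrt_mul_le_dispersion hκ.le hp.le (hpos 0)
  have k1 : omega κ p a (j 2) ≤ omega κ p a (j 1) := dispersion_mono hκ.le hp.le (hpos 2) h2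
  have k2 : 0 ≤ omega κ p a (j 2) := Real.sqrt_nonneg _
  have k3 : √κ * mu1 j ^ 2 ≤ √κ * (j 0).lenSq a :=
    mul_le_mul_of_nonneg_left (mu1_sq_le ha h1 h2) (Real.sqrt_nonneg _)
  rw [signedSum, Fin.sum_univ_three]
  rcases Int.units_eq_one_or (σ 0) with s0 | s0 <;> rcases Int.units_eq_one_or (σ 1) with s1 | s1 <;>
    rcases Int.units_eq_one_or (σ 2) with s2 | s2 <;> simp only [s0, s1, s2] at hσ ⊢
  all_goals first
    | (exfalso; revert hσ; decide)
    | (push_cast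
       first
        | (refine le_trans ?_ (le_abs_self _); linarith)
        | (refine le_trans ?_ (neg_le_abs _); linarith))

lemma abs_signedSum_weight_le_of_opposite {s : ℝ} (hs : 1 ≤ s) (ha : a ∈ cube d)
    (hmom : momentum σ j = 0) (h1 : (j 1).lenSq a ≤ (j 0).lenSq a)
    (h2 : (j 2).lenSq a ≤ (j 1).lenSq a) (hσ : σ 0 * σ 1 = -1) :
    |signedSum (Mode.weight s) σ j| ≤ (s + 1) * 2 ^ s * 2 * (mu1 j ^ (2 * s - 1) * mu3 j) := by
  have hR := one_le_mu1 j
  have hl := len_two_le ha h1 h2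
  have t0 := len_le_of_momentum hmom 0
  have t1 := len_le_of_momentum hmom 1
  simp only [Fin.reduceAdd, zero_add] at t0 t1
  have hd : |(j 0).len - (j 1).len| ≤ (j 2).len := by rw [abs_le]; constructor <;> linarith
  have k1 := abs_weight_sub_le hs (j 0) (j 1) (len_le_mu1 j 0) (len_le_mu1 j 1)
  have k2 := (j 2).weight_le (by linarith : 0 ≤ s) le_rfl
  have k3 := (j 2).weight_nonneg s
  have l2 := (j 2).len_pos
  have k4 : (j 2).len ^ (2 * s) ≤ mu1 j ^ (2 * s - 1) * (j 2).len := by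
    rw [show (j 2).len ^ (2 * s) = (j 2).len ^ (2 * s - 1) * (j 2).len by
      rw [← rpow_add_one l2.ne']; congr 1; ring]
    have := len_le_mu1 j 2
    have : 0 ≤ 2 * s - 1 := by linarith
    gcongr
  have e : |signedSum (Mode.weight s) σ j| ≤ |(j 0).weight s - (j 1).weight s| + (j 2).weight s := by
    rw [signedSum, Fin.sum_univ_three]
    have a1 := le_abs_self ((j 0).weight s - (j 1).weight s)
    have a2 := neg_le_abs ((j 0).weight s - (j 1).weight s)
    rcases Int.units_eq_one_or (σ 0) with s0 | s0 <;> rcases Int.units_eq_one_or (σ 1) with s1 | s1 <;>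
      rcases Int.units_eq_one_or (σ 2) with s2 | s2 <;> simp only [s0, s1, s2] at hσ ⊢
    all_goals first
      | (exfalso; revert hσ; decide)
      | (push_cast; rw [abs_le]; constructor <;> linarith)
  refine e.trans ?_
  have hm : 0 ≤ mu1 j ^ (2 * s - 1) := by positivity
  calc _ ≤ s * 2 ^ s * mu1 j ^ (2 * s - 1) * (j 2).len
        + 2 ^ s * (mu1 j ^ (2 * s - 1) * (j 2).len) := by
        refine add_le_add (k1.trans ?_) (k2.trans ?_)
        · gcongr
        · gcongr
    _ = (s + 1) * 2 ^ s * (mu1 j ^ (2 * s - 1) * (j 2).len) := by ring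
    _ ≤ (s + 1) * 2 ^ s * (mu1 j ^ (2 * s - 1) * (2 * mu3 j)) := by gcongr
    _ = _ := by ring

end sorted

/-- The interactions that are removed. -/
def removable (κ p : ℝ) (a : Fin d → ℝ) (N : ℝ) (σ : Fin 3 → ℤˣ) (j : Fin 3 → Mode d) : Prop :=
  mu1 j ≤ N ∨ √κ * mu1 j ^ 2 ≤ |signedSum (omega κ p a) σ j|

lemma sorted_induction {a : Fin d → ℝ} {P : (Fin 3 → ℤˣ) → (Fin 3 → Mode d) → Prop}
    (hP : ∀ (ρ : Equiv.Perm (Fin 3)) σ j, P (σ ∘ ρ) (j ∘ ρ) → P σ j)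
    (h : ∀ σ j, (j 1).lenSq a ≤ (j 0).lenSq a → (j 2).lenSq a ≤ (j 1).lenSq a → P σ j)
    (σ : Fin 3 → ℤˣ) (j : Fin 3 → Mode d) : P σ j := by
  obtain ⟨ρ, h1, h2⟩ := exists_sort a j
  exact hP ρ σ j (h _ _ h1 h2)

lemma exists_divisor_bound {κ p M s : ℝ} (hd : 2 ≤ d) (hκ : 0 < κ) (hp : 0 < p) (hM : 0 ≤ M)
    (hs : 1 ≤ s) {a : Fin d → ℝ} (ha : a ∈ nonresonantSet d κ p M) :
    (∀ σ j, momentum σ j = 0 → signedSum (omega κ p a) σ j ≠ 0) ∧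
    ∃ C : ℝ, 0 < C ∧ ∀ N : ℝ, 1 < N → ∀ σ j, momentum σ j = 0 → removable κ p a N σ j →
      |signedSum (Mode.weight s) σ j / signedSum (omega κ p a) σ j|
        ≤ C * (N ^ (d - 2) * log (1 + N) ^ (d + 1)) * (mu3 j ^ (M + 1) * mu1 j ^ (2 * s)) := by
  obtain ⟨hac, γ, hγ, hnr⟩ := ha
  have hk : 0 < √κ := Real.sqrt_pos.2 hκ
  have hlower : ∀ j : Fin 3 → Mode d, 0 <
      γ / ((j 0).len ^ (d - 1) * log (1 + (j 0).len ^ 2) ^ (d + 1) * (j 2).len ^ M) := fun j => by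
    have := (j 0).len_pos
    have := (j 2).len_pos
    have := (j 0).log_pos
    positivity
  constructor
  · refine sorted_induction (a := a) (fun ρ σ j h hm => ?_) fun σ j h1 h2 hm => ?_
    · rw [← signedSum_perm _ ρ]
      exact h (by rw [momentum_perm]; exact hm)
    · intro h0
      obtain ⟨n1, n2⟩ := hnr σ j hm h1 h2
      change _ → _ ≤ |signedSum (omega κ p a) σ j| / _ at n1
      change _ → _ ≤ |signedSum (omega κ p a) σ j| / _ at n2
      rw [h0, abs_zero, zero_div] at n1 n2
      rcases signs_cases σ with h | h
      · linarith [n2 h]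
      · exact absurd (n1 h) (not_le.2 (hlower j))
  · set C₁ : ℝ := 3 * 2 ^ s / √κ with hC₁
    set C₂ : ℝ := (s + 1) * 2 ^ s * 2 * (2 ^ (d + 1) * 2 ^ M / (γ * √κ)) with hC₂
    have hC₁0 : 0 < C₁ := by positivity
    have hC₂0 : 0 < C₂ := by positivity
    refine ⟨C₁ * 2 ^ (d + 1) + C₂, by positivity, fun N hN => ?_⟩
    have hlog : 1 / 2 ≤ log (1 + N) := by
      have h1 := Real.log_two_gt_d9
      have h2 : log 2 ≤ log (1 + N) := log_le_log (by norm_num) (by linarith)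
      norm_num at h1 ⊢; linarith
    have hL : (1 / 2) ^ (d + 1) ≤ N ^ (d - 2) * log (1 + N) ^ (d + 1) := by
      have h1 : (1 : ℝ) ≤ N ^ (d - 2) := one_le_pow₀ hN.le
      have h2 : ((1 : ℝ) / 2) ^ (d + 1) ≤ log (1 + N) ^ (d + 1) := by gcongr
      calc ((1 : ℝ) / 2) ^ (d + 1) = 1 * (1 / 2) ^ (d + 1) := (one_mul _).symm
        _ ≤ _ := by gcongr
    set L := N ^ (d - 2) * log (1 + N) ^ (d + 1) with hLdef
    have hL0 : 0 < L := lt_of_lt_of_le (by positivity) hL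
    have hL1 : 1 ≤ 2 ^ (d + 1) * L := by
      calc (1 : ℝ) = 2 ^ (d + 1) * (1 / 2) ^ (d + 1) := by rw [← mul_pow]; norm_num
        _ ≤ _ := by gcongr
    refine sorted_induction (a := a) (fun ρ σ j h hm hS => ?_) fun σ j h1 h2 hm hS => ?_
    · have := h (by rw [momentum_perm]; exact hm) (by
        simpa only [removable, mu1_perm, signedSum_perm] using hS)
      simpa only [mu1_perm, mu3_perm, signedSum_perm] using this
    · have hmu1 := one_le_mu1 j
      have hmu3 := one_le_mu3 j
      have hbig : √κ * mu1 j ^ 2 ≤ |signedSum (omega κ p a) σ j| →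
          |signedSum (Mode.weight s) σ j / signedSum (omega κ p a) σ j|
            ≤ (C₁ * 2 ^ (d + 1) + C₂) * L * (mu3 j ^ (M + 1) * mu1 j ^ (2 * s)) := by
        intro h
        have h3 : √κ ≤ |signedSum (omega κ p a) σ j| := by
          refine le_trans ?_ h
          have : (1 : ℝ) ≤ mu1 j ^ 2 := one_le_pow₀ hmu1
          nlinarith
        have h4 : (1 : ℝ) ≤ mu3 j ^ (M + 1) := one_le_rpow hmu3 (by linarith)
        rw [abs_div]
        calc _ ≤ 3 * 2 ^ s * mu1 j ^ (2 * s) / √κ := by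
              gcongr; exact abs_signedSum_weight_le (by linarith) σ j
          _ = C₁ * 1 * (1 * mu1 j ^ (2 * s)) := by rw [hC₁]; ring
          _ ≤ C₁ * (2 ^ (d + 1) * L) * (mu3 j ^ (M + 1) * mu1 j ^ (2 * s)) := by gcongr
          _ ≤ _ := by
            have : 0 ≤ C₂ * L * (mu3 j ^ (M + 1) * mu1 j ^ (2 * s)) := by positivity
            linarith
      rcases signs_cases σ with hσ | hσ
      · exact hbig (abs_omega_sum_ge hκ hp hac h1 h2 hσ)
      rcases hS with hS | hS
      swap
      · exact hbig hS
      have n1 := (hnr σ j hm h1 h2).1 hσ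
      change _ ≤ |signedSum (omega κ p a) σ j| / _ at n1
      have l0 := (j 0).len_pos
      have l2 := (j 2).len_pos
      have lg := (j 0).log_pos
      have hl0 := len_le_mu1 j 0
      have hl2 := len_two_le hac h1 h2
      have hlogN : log (1 + (j 0).len ^ 2) ≤ 2 * log (1 + N) := by
        have : log ((1 + N) ^ 2) = 2 * log (1 + N) := by rw [log_pow]; norm_num
        rw [← this]
        apply log_le_log (by positivity)
        have : (j 0).len ≤ N := hl0.trans hS
        nlinarith
      set Dn := (j 0).len ^ (d - 1) * log (1 + (j 0).len ^ 2) ^ (d + 1) * (j 2).len ^ M with hDn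
      have hDn0 : 0 < Dn := by positivity
      have hDle : Dn ≤ mu1 j ^ (d - 1) * (2 * log (1 + N)) ^ (d + 1) * (2 * mu3 j) ^ M := by
        rw [hDn]; gcongr
      have hOm : γ * √κ / Dn ≤ |signedSum (omega κ p a) σ j| := by
        rw [le_div_iff₀ hk] at n1
        calc γ * √κ / Dn = γ / Dn * √κ := by ring
          _ ≤ _ := n1
      have hW := abs_signedSum_weight_le_of_opposite hs hac hm h1 h2 hσ
      rw [abs_div]
      calc _ ≤ ((s + 1) * 2 ^ s * 2 * (mu1 j ^ (2 * s - 1) * mu3 j)) / (γ * √κ / Dn) := by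
            gcongr
        _ = (s + 1) * 2 ^ s * 2 * (mu1 j ^ (2 * s - 1) * mu3 j) / (γ * √κ) * Dn := by
            field_simp
        _ ≤ (s + 1) * 2 ^ s * 2 * (mu1 j ^ (2 * s - 1) * mu3 j) / (γ * √κ) *
            (mu1 j ^ (d - 1) * (2 * log (1 + N)) ^ (d + 1) * (2 * mu3 j) ^ M) := by gcongr
        _ = C₂ * (mu1 j ^ (d - 2) * log (1 + N) ^ (d + 1)) * (mu3 j ^ (M + 1) * mu1 j ^ (2 * s)) := by
            have e1 : mu1 j ^ (d - 1) = mu1 j ^ (d - 2) * mu1 j := by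
              rw [← pow_succ]; congr 1; omega
            have e2 : mu1 j ^ (2 * s) = mu1 j ^ (2 * s - 1) * mu1 j := by
              rw [← rpow_add_one (by linarith)]; congr 1; ring
            have e3 : mu3 j ^ (M + 1) = mu3 j ^ M * mu3 j := rpow_add_one (by linarith) M
            rw [e1, e2, e3, mul_pow, mul_rpow zero_le_two (by linarith), hC₂]
            ring
        _ ≤ C₂ * L * (mu3 j ^ (M + 1) * mu1 j ^ (2 * s)) := by
            rw [hLdef]
            have : 0 < log (1 + N) := by linarith
            gcongr
        _ ≤ _ := by
            have : 0 ≤ C₁ * 2 ^ (d + 1) * L * (mu3 j ^ (M + 1) * mu1 j ^ (2 * s)) := by positivity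
            linarith

lemma abs_signedSum_weight_le_of_not_removable {κ p s N : ℝ} (hκ : 0 < κ) (hp : 0 < p)
    (hs : 1 ≤ s) {a : Fin d → ℝ} (ha : a ∈ cube d) (hN : 1 < N) (σ : Fin 3 → ℤˣ)
    (j : Fin 3 → Mode d) (hm : momentum σ j = 0) (hS : ¬removable κ p a N σ j) :
    |signedSum (Mode.weight s) σ j| ≤ (s + 1) * 2 ^ s * 2 * N⁻¹ * (mu3 j * mu1 j ^ (2 * s)) := by
  revert σ j
  refine sorted_induction (a := a) (fun ρ σ j h hm hS => ?_) fun σ j h1 h2 hm hS => ?_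
  · have := h (by rw [momentum_perm]; exact hm) (by
        simpa only [removable, mu1_perm, signedSum_perm] using hS)
    simpa only [mu1_perm, mu3_perm, signedSum_perm] using this
  · rw [removable, not_or, not_le, not_le] at hS
    have hmu1 := one_le_mu1 j
    have hmu3 := one_le_mu3 j
    rcases signs_cases σ with hσ | hσ
    · exact absurd (abs_omega_sum_ge hκ hp ha h1 h2 hσ) (not_le.2 hS.2)
    refine (abs_signedSum_weight_le_of_opposite hs ha hm h1 h2 hσ).trans ?_
    have e : mu1 j ^ (2 * s - 1) = (mu1 j)⁻¹ * mu1 j ^ (2 * s) := by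
      rw [rpow_sub_one (by linarith)]; field_simp
    have hinv : (mu1 j)⁻¹ ≤ N⁻¹ := inv_anti₀ (by linarith) hS.1.le
    rw [e]
    calc _ = (s + 1) * 2 ^ s * 2 * (mu1 j)⁻¹ * (mu3 j * mu1 j ^ (2 * s)) := by ring
      _ ≤ _ := by gcongr

lemma omega_le {κ p : ℝ} (hκ : 0 ≤ κ) (hp : 0 ≤ p) {a : Fin d → ℝ} (ha : a ∈ cube d)
    (k : Mode d) : omega κ p a k ≤ √(κ + p) * (4 * k.len ^ 2) := by
  have h1 : 1 ≤ k.lenSq a := (one_le_pow₀ k.one_le_len).trans (k.le_lenSq ha)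
  refine (dispersion_le hκ hp h1).trans ?_
  exact mul_le_mul_of_nonneg_left (k.lenSq_le ha) (Real.sqrt_nonneg _)

/-! ### The modified energy -/

open Classical in
/-- The correction of the Sobolev energy that removes the cubic terms of its time derivative. -/
def energyCorrection (κ m : ℝ) (g : ℝ → ℝ) (a : Fin d → ℝ) (s N : ℝ) : TrilinearHamiltonian d where
  coeff σ j := if removable κ (m * deriv g m) a N σ j then
    ((signedSum (Mode.weight s) σ j / signedSum (omega κ (m * deriv g m) a) σ j : ℝ) : ℂ)
      * (cubicHam κ m g a).coeff σ j else 0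
  symmetric ρ σ j := by
    have : removable κ (m * deriv g m) a N (σ ∘ ρ) (j ∘ ρ) ↔ removable κ (m * deriv g m) a N σ j := by
      simp only [removable, mu1_perm, signedSum_perm]
    simp only [this, signedSum_perm, (cubicHam κ m g a).symmetric]
  momentum_support σ j h := by
    rw [(cubicHam κ m g a).momentum_support σ j h, mul_zero, ite_self]
  reality σ j := by
    have : removable κ (m * deriv g m) a N (fun i => -σ i) j ↔ removable κ (m * deriv g m) a N σ j := by
      simp only [removable, signedSum_neg, abs_neg]
    simp only [this, signedSum_neg, (cubicHam κ m g a).reality, neg_div_neg_eq]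
    split_ifs
    · rw [map_mul, Complex.conj_ofReal]
    · simp

lemma seqBound_hsNorm {s : ℝ} {w : Seq d} (hw : MemHs s w) : SeqBound s w (hsNorm s w) := by
  have e : ∀ j : Mode d, (jap j.1 ^ s * ‖w j‖) ^ 2 = j.weight s * ‖w j‖ ^ 2 := fun j => by
    rw [j.weight_eq]; ring
  have h := L2Bound.of_summable (b := fun j : Mode d => jap j.1 ^ s * ‖w j‖) (by
    simp only [e]; exact hw)
  simp only [e] at h
  exact h

lemma one_le_pow_mul_log (d : ℕ) {N : ℝ} (hN : 1 < N) :
    1 ≤ 2 ^ (d + 1) * (N ^ (d - 2) * log (1 + N) ^ (d + 1)) := by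
  have hlog : 1 / 2 ≤ log (1 + N) := by
    have h1 := Real.log_two_gt_d9
    have h2 : log 2 ≤ log (1 + N) := log_le_log (by norm_num) (by linarith)
    norm_num at h1 ⊢; linarith
  have h1 : (1 : ℝ) ≤ N ^ (d - 2) := one_le_pow₀ hN.le
  calc (1 : ℝ) = 2 ^ (d + 1) * (1 * (1 / 2) ^ (d + 1)) := by rw [one_mul, ← mul_pow]; norm_num
    _ ≤ _ := by gcongr

lemma smode_hasSum {f : SMode d → ℂ} {S : ℂ} (h : HasSum f S) :
    HasSum (fun j => f (j, 1) + f (j, -1)) S := by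
  refine (h.prod_fiberwise fun j => hasSum_fintype _).congr_fun fun j => ?_
  rw [UnitsInt.univ, Finset.sum_pair (by decide)]

/-- Absolute estimate of a trilinear sum against a diagonal operator. -/
lemma summable_mul_term (E : TrilinearHamiltonian d) {s M K B : ℝ} (hM : 0 ≤ M)
    (hs : M + 1 + d ≤ s) (hK : 0 ≤ K) (c : Triad d → ℝ)
    (hc : ∀ p, momentum p.1 p.2 = 0 →
      ‖(c p : ℂ) * E.coeff p.1 p.2‖ ≤ K * (mu3 p.2 ^ (M + 1) * mu1 p.2 ^ (2 * s)))
    {w : Seq d} (hw : SeqBound s w B) :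
    Summable (fun p => ‖(c p : ℂ) * E.term w p‖) ∧
      ∑' p, ‖(c p : ℂ) * E.term w p‖ ≤ triConst d s * K * (B * B * B) := by
  have h := QHD.summable_triTerm hM hs hK (c := fun p : Triad d => (c p : ℂ) * E.coeff p.1 p.2)
    (fun p hp => by rw [E.momentum_support _ _ hp, mul_zero]) hc (x := fun _ => w)
    (A := fun _ => B) (fun _ => hw)
  have e : ∀ p, triTerm (fun p : Triad d => (c p : ℂ) * E.coeff p.1 p.2) (fun _ => w) p
      = (c p : ℂ) * E.term w p := fun p => by
    rw [triTerm, TrilinearHamiltonian.term, mul_assoc]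
  simpa only [e] using h

/-- The constants in the main estimate do not depend on `N`. -/
theorem exists_modified_energy {M : ℝ} (hd : 2 ≤ d) (hM : 0 < M) {κ m τ : ℝ} {g G : ℝ → ℝ}
    (hκ : 0 < κ) (hm : 0 < m) (hτ : 0 < τ) (hg : ContDiffOn ℝ ∞ g (Set.Ioi 0)) (hgm : g m = 0)
    (hg' : 0 < deriv g m) (hG : ∀ x : ℝ, 0 < x → HasDerivAt G (g x) x) {a : Fin d → ℝ}
    (ha : a ∈ nonresonantSet d κ (m * deriv g m) M) {s : ℝ} (hs : M + d + 2 ≤ s) :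
    ∃ C c : ℝ, 0 < C ∧ 0 < c ∧ ∀ N : ℝ, 1 < N →
      ∃ E : TrilinearHamiltonian d,
        (∀ (σ : Fin 3 → ℤˣ) (j : Fin 3 → Mode d),
          ‖E.coeff σ j‖ ≤ C * (N ^ (d - 2) * log (1 + N) ^ (d + 1)
            * mu3 j ^ (M + 1) * mu1 j ^ (2 * s))) ∧
        ∀ w : Seq d, MemHs s w →
          hsNorm s w ≤ c / log (1 + N) ^ (d + 1) →
          Summable (E.term w) ∧
          ∃ P : ℂ,
            HasPoissonBracketAt
              (fun v => (sobolevEnergy s v : ℂ) + E.eval v)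
              (fun v => (hamiltonianW κ m τ g G a v : ℂ)) w P ∧
            ‖P‖ ≤ C * (N ^ (d - 2) * log (1 + N) ^ (d + 1) * hsNorm s w ^ 4
              + N⁻¹ * hsNorm s w ^ 3) := by
  set p := m * deriv g m with hpdef
  have hp : 0 < p := mul_pos hm hg'
  have hd0 : (0 : ℝ) ≤ d := d.cast_nonneg
  have hs1 : 1 ≤ s := by linarith
  have hac : a ∈ cube d := ha.1
  obtain ⟨ε, Cg, hε, hCg, hgrad⟩ := exists_hamGrad_expansion d hκ hm hτ hg hgm hg' hG
    (by linarith : (d : ℝ) + 1 ≤ s)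
  obtain ⟨CT, hCT, hT⟩ := exists_cubicHam_bound d (g := g) hκ hm hg'
  obtain ⟨hne, CD, hCD, hdiv⟩ := exists_divisor_bound hd hκ hp hM.le hs1 ha
  set tri := triConst d s with htri
  have htri0 : 0 < tri := triConst_pos d s
  set K₁ := CD * CT with hK₁
  set K₃ := (s + 1) * 2 ^ s * 2 * CT with hK₃
  have hK₁0 : 0 < K₁ := by positivity
  have hK₃0 : 0 < K₃ := by positivity
  set C₄ := 3 * (tri * K₁ * (2 * Cg)) + 2 * Cg * 2 ^ (d + 1) with hC₄
  have hC₄0 : 0 < C₄ := by positivity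
  refine ⟨K₁ + tri * K₃ + C₄, min ε 1 * log 2 ^ (d + 1), by positivity, ?_, fun N hN => ?_⟩
  · have : 0 < log 2 := Real.log_pos (by norm_num)
    positivity
  set E := energyCorrection κ m g a s N with hE
  set T := cubicHam κ m g a with hTdef
  set L := N ^ (d - 2) * log (1 + N) ^ (d + 1) with hL
  have hL1 : 1 ≤ 2 ^ (d + 1) * L := one_le_pow_mul_log d hN
  have hL0 : 0 < L := by
    by_contra h
    have : 2 ^ (d + 1) * L ≤ 0 := mul_nonpos_of_nonneg_of_nonpos (by positivity) (not_lt.1 h)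
    linarith
  have hmu : ∀ j : Fin 3 → Mode d, 0 < mu1 j ∧ 0 < mu3 j := fun j =>
    ⟨one_pos.trans_le (one_le_mu1 j), one_pos.trans_le (one_le_mu3 j)⟩
  have hbdd : E.IsBdd s M (K₁ * L) := by
    intro σ j
    obtain ⟨m1, m3⟩ := hmu j
    by_cases hm0 : momentum σ j = 0
    swap
    · rw [E.momentum_support σ j hm0, norm_zero]; positivity
    simp only [hE, energyCorrection]
    split_ifs with hS
    · rw [norm_mul, Complex.norm_real, Real.norm_eq_abs]
      calc _ ≤ CD * L * (mu3 j ^ (M + 1) * mu1 j ^ (2 * s)) * CT :=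
            mul_le_mul (hdiv N hN σ j hm0 hS) (hT a hac σ j) (norm_nonneg _) (by positivity)
        _ = _ := by rw [hK₁]; ring
    · rw [norm_zero]; positivity
  refine ⟨E, fun σ j => ?_, fun w hw hsmall => ?_⟩
  · obtain ⟨m1, m3⟩ := hmu j
    calc _ ≤ K₁ * L * (mu3 j ^ (M + 1) * mu1 j ^ (2 * s)) := hbdd σ j
      _ = K₁ * (L * mu3 j ^ (M + 1) * mu1 j ^ (2 * s)) := by ring
      _ ≤ _ := by
        gcongr
        have : 0 < tri * K₃ := by positivity
        linarith
  set B := hsNorm s w with hB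
  have hwB : SeqBound s w B := seqBound_hsNorm hw
  have hB0 : 0 ≤ B := hwB.1
  have hBε : B ≤ min ε 1 := by
    have h2 : 0 < log 2 := Real.log_pos (by norm_num)
    have h3 : log 2 ≤ log (1 + N) := log_le_log (by norm_num) (by linarith)
    have h4 : 0 < log (1 + N) := h2.trans_le h3
    refine hsmall.trans ((div_le_iff₀ (by positivity)).2 ?_)
    gcongr
  have hB1 : B ≤ 1 := hBε.trans (min_le_right _ _)
  obtain ⟨hq, r, hr, hj⟩ := hgrad a hac w B (hBε.trans (min_le_left _ _)) hwB
  have hsM : M + 1 + d ≤ s := by linarith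
  have hKL : 0 ≤ K₁ * L := by positivity
  -- the four contributions to the bracket
  set om := omega κ p a with hom
  set W := fun q : Triad d => signedSum (Mode.weight s) q.1 q.2 with hW
  set Om := fun q : Triad d => signedSum om q.1 q.2 with hOm
  have hrpow : ∀ j : Fin 3 → Mode d, 1 ≤ mu3 j ^ (M + 1) := fun j =>
    one_le_rpow (one_le_mu3 j) (by linarith)
  have hTW := summable_mul_term T hM.le hsM (K := 2 ^ s * CT) (by positivity)
    (fun q => (q.2 0).weight s) (fun q _ => by
      obtain ⟨m1, m3⟩ := hmu q.2
      rw [norm_mul, Complex.norm_real, Real.norm_eq_abs, abs_of_nonneg ((q.2 0).weight_nonneg s)]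
      calc _ ≤ 2 ^ s * mu1 q.2 ^ (2 * s) * CT :=
            mul_le_mul ((q.2 0).weight_le (by linarith) (len_le_mu1 q.2 0)) (hT a hac _ _)
              (norm_nonneg _) (by positivity)
        _ = 2 ^ s * CT * (1 * mu1 q.2 ^ (2 * s)) := by ring
        _ ≤ _ := by gcongr; exact hrpow q.2) hwB
  obtain ⟨hWsum, hWhas⟩ := hasSum_weighted_triGrad T w (Mode.weight s) hTW.1
  set Kω := √(κ + p) * 4 * (N ^ 2 * (K₁ * L) + 3 * 2 ^ s / √κ * CT) with hKω
  have hOmE := summable_mul_term E hM.le hsM (K := Kω) (by positivity)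
    (fun q => om (q.2 0)) (fun q hq0 => by
      obtain ⟨m1, m3⟩ := hmu q.2
      have hk : 0 < √κ := Real.sqrt_pos.2 hκ
      have ho : om (q.2 0) ≤ √(κ + p) * 4 * mu1 q.2 ^ 2 := by
        refine (omega_le hκ.le hp.le hac _).trans ?_
        have := len_le_mu1 q.2 0
        have := (q.2 0).len_nonneg
        rw [← mul_assoc]; gcongr
      have ho0 : 0 ≤ om (q.2 0) := Real.sqrt_nonneg _
      rw [norm_mul, Complex.norm_real, Real.norm_eq_abs, abs_of_nonneg ho0]
      by_cases hS : removable κ p a N q.1 q.2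
      swap
      · have : E.coeff q.1 q.2 = 0 := by simp only [hE, energyCorrection]; exact if_neg hS
        rw [this, norm_zero, mul_zero]; positivity
      rcases id hS with hS1 | hS2
      · calc _ ≤ √(κ + p) * 4 * mu1 q.2 ^ 2 * (K₁ * L * (mu3 q.2 ^ (M + 1) * mu1 q.2 ^ (2 * s))) :=
              mul_le_mul ho (hbdd _ _) (norm_nonneg _) (by positivity)
          _ ≤ √(κ + p) * 4 * N ^ 2 * (K₁ * L * (mu3 q.2 ^ (M + 1) * mu1 q.2 ^ (2 * s))) := by gcongr
          _ = √(κ + p) * 4 * (N ^ 2 * (K₁ * L) + 0) * (mu3 q.2 ^ (M + 1) * mu1 q.2 ^ (2 * s)) := by ring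
          _ ≤ _ := by rw [hKω]; gcongr; positivity
      · have hc : ‖E.coeff q.1 q.2‖ ≤ 3 * 2 ^ s * mu1 q.2 ^ (2 * s) / (√κ * mu1 q.2 ^ 2) * CT := by
          simp only [hE, energyCorrection]
          rw [if_pos hS, norm_mul, Complex.norm_real, Real.norm_eq_abs, abs_div]
          refine mul_le_mul ?_ (hT a hac _ _) (norm_nonneg _) (by positivity)
          exact div_le_div₀ (by positivity) (abs_signedSum_weight_le (by linarith) _ _)
            (by positivity) hS2
        calc _ ≤ √(κ + p) * 4 * mu1 q.2 ^ 2 *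
              (3 * 2 ^ s * mu1 q.2 ^ (2 * s) / (√κ * mu1 q.2 ^ 2) * CT) :=
              mul_le_mul ho hc (norm_nonneg _) (by positivity)
          _ = √(κ + p) * 4 * (0 + 3 * 2 ^ s / √κ * CT) * (1 * mu1 q.2 ^ (2 * s)) := by
              field_simp; ring
          _ ≤ _ := by
              rw [hKω]
              gcongr
              · positivity
              · exact hrpow q.2) hwB
  obtain ⟨hOsum, hOhas⟩ := hasSum_weighted_triGrad E w om hOmE.1
  set y : Seq d := fun j => conj (quadGrad κ m g a w j + r j) with hy
  have hyB : SeqBound s y (2 * Cg * B ^ 2) := by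
    refine (hq.of_le hr zero_le_one zero_le_one fun j => ?_).mono_right ?_
    · rw [hy, Complex.norm_conj, one_mul, one_mul]; exact norm_add_le _ _
    · have : B ^ 3 ≤ B ^ 2 := pow_le_pow_of_le_one hB0 hB1 (by norm_num)
      have : Cg * B ^ 3 ≤ Cg * B ^ 2 := by gcongr
      linarith
  obtain ⟨h4s, h4b⟩ := summable_sval_triGrad E hM.le hsM hKL hbdd hwB hyB
    (fun x => (((x.2 : ℤ) : ℝ) : ℂ)) (fun x => by
      rcases Int.units_eq_one_or x.2 with h | h <;> simp [h])
  set t₃ : Mode d → ℂ := fun j => Complex.I * ((j.weight s : ℂ) *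
    (w j * r j - conj (w j * r j))) with ht₃
  have h3 := L2Bound.summable_mul hwB hr
  have h3' := L2Bound.tsum_mul_le hwB hr
  have h3le : ∀ j, ‖t₃ j‖ ≤ 2 * |jap j.1 ^ s * ‖w j‖ * (jap j.1 ^ s * ‖r j‖)| := by
    intro j
    have hjp := jap_pos j.1
    rw [ht₃, norm_mul, Complex.norm_I, one_mul, norm_mul, Complex.norm_real, Real.norm_eq_abs,
      abs_of_nonneg (j.weight_nonneg s), j.weight_eq, abs_of_nonneg (by positivity)]
    have : ‖w j * r j - conj (w j * r j)‖ ≤ 2 * (‖w j‖ * ‖r j‖) := by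
      refine (norm_sub_le _ _).trans (le_of_eq ?_)
      rw [Complex.norm_conj, norm_mul]; ring
    calc _ ≤ (jap j.1 ^ s) ^ 2 * (2 * (‖w j‖ * ‖r j‖)) := by gcongr
      _ = _ := by ring
  have h3s : Summable t₃ := Summable.of_norm_bounded (h3.mul_left 2) h3le
  have h3b : ‖∑' j, t₃ j‖ ≤ 2 * (B * (Cg * B ^ 3)) := by
    have k1 : Summable fun j => ‖t₃ j‖ := Summable.of_nonneg_of_le (fun _ => norm_nonneg _) h3le
      (h3.mul_left 2)
    refine (norm_tsum_le_tsum_norm k1).trans ((k1.tsum_le_tsum h3le (h3.mul_left 2)).trans ?_)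
    rw [tsum_mul_left]; gcongr
  -- the cubic terms
  classical
  set R : Triad d → ℝ := fun q => if removable κ p a N q.1 q.2 then 0 else W q with hR
  have hcub : ∀ q : Triad d, ((W q : ℝ) : ℂ) * T.term w q - ((Om q : ℝ) : ℂ) * E.term w q
      = (R q : ℂ) * T.term w q := by
    intro q
    simp only [TrilinearHamiltonian.term, hE, energyCorrection, hR]
    by_cases hm0 : momentum q.1 q.2 = 0
    swap
    · rw [T.momentum_support _ _ hm0]; simp
    split_ifs with hS
    · have : (Om q : ℂ) ≠ 0 := by exact_mod_cast hne q.1 q.2 hm0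
      change (W q : ℂ) * _ - (Om q : ℂ) * (((W q / Om q : ℝ) : ℂ) * _ * _) = _
      have h : (Om q : ℂ) * ((W q : ℂ) / (Om q : ℂ)) = W q := mul_div_cancel₀ _ this
      rw [Complex.ofReal_zero, zero_mul, Complex.ofReal_div, mul_assoc ((W q : ℂ) / (Om q : ℂ)),
        ← mul_assoc (Om q : ℂ), h, sub_self]
    · simp
  obtain ⟨hRs, hRb⟩ := summable_mul_term T hM.le hsM (K := K₃ * N⁻¹) (by positivity) R
    (fun q hm0 => by
      obtain ⟨m1, m3⟩ := hmu q.2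
      simp only [hR]
      split_ifs with hS
      · simp only [Complex.ofReal_zero, zero_mul, norm_zero]; positivity
      · rw [norm_mul, Complex.norm_real, Real.norm_eq_abs]
        calc _ ≤ (s + 1) * 2 ^ s * 2 * N⁻¹ * (mu3 q.2 * mu1 q.2 ^ (2 * s)) * CT :=
              mul_le_mul (abs_signedSum_weight_le_of_not_removable hκ hp hs1 hac hN _ _ hm0 hS)
                (hT a hac _ _) (norm_nonneg _) (by positivity)
          _ = K₃ * N⁻¹ * (mu3 q.2 * mu1 q.2 ^ (2 * s)) := by rw [hK₃]; ring
          _ ≤ _ := by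
              gcongr
              calc mu3 q.2 = mu3 q.2 ^ (1 : ℝ) := (rpow_one _).symm
                _ ≤ _ := rpow_le_rpow_of_exponent_le (one_le_mu3 _) (by linarith)) hwB
  have hcubsum : ∑' q, ((W q : ℝ) : ℂ) * T.term w q - ∑' q, ((Om q : ℝ) : ℂ) * E.term w q
      = ∑' q, (R q : ℂ) * T.term w q := by
    exact (hWsum.tsum_sub hOsum).symm.trans (tsum_congr hcub)
  have hbr := ((smode_hasSum hWhas).mul_left Complex.I).sub ((smode_hasSum hOhas).mul_left Complex.I)
    |>.add (h3s.hasSum.sub ((smode_hasSum h4s.hasSum).mul_left Complex.I))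
  refine ⟨(E.summable_triTerm hM.le hsM hKL hbdd (x := fun _ => w) (fun _ => hwB)).1.of_norm, _,
    ⟨fun j => j.weight s * conj (w j) + triGrad E w (j, 1),
      fun j => j.weight s * w j + triGrad E w (j, -1),
      fun j => hamGrad κ m τ g a w j, fun j => conj (hamGrad κ m τ g a w j),
      fun j => ?_, fun j => (hj j).1, hbr.congr_fun fun j => ?_⟩, ?_⟩
  · have k1 := hasWirtingerDerivAt_sobolevEnergy hwB j
    have k2 := hasWirtingerDerivAt_eval E hM.le hsM hKL hbdd hwB j
    refine (k1.add k2).congr_fderiv ?_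
    ext h
    simp
    ring
  · have hqj : quadGrad κ m g a w j = triGrad T w (j, 1) :=
      quadGrad_eq_triGrad hκ hm hg' hac (by linarith) hwB j
    have hqj' : conj (triGrad T w (j, 1)) = triGrad T w (j, -1) := (triGrad_flip T w (j, 1)).symm
    beta_reduce
    rw [(hj j).2, hqj, ht₃]
    simp only [sval, signedCoeff, hy, map_add, map_mul, Complex.conj_ofReal, Complex.conj_conj,
      hqj, hom]
    simp [hqj']
    ring
  · change ‖Complex.I * ∑' q, ((W q : ℝ) : ℂ) * T.term w q - Complex.I * ∑' q, ((Om q : ℝ) : ℂ) * E.term w q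
      + _‖ ≤ _
    rw [← mul_sub, hcubsum]
    have hcb : ‖∑' q, (R q : ℂ) * T.term w q‖ ≤ tri * (K₃ * N⁻¹) * (B * B * B) :=
      (norm_tsum_le_tsum_norm hRs).trans hRb
    have hN0 : 0 < N⁻¹ := by positivity
    calc _ ≤ ‖∑' q, (R q : ℂ) * T.term w q‖ + (‖∑' j, t₃ j‖
          + ‖∑' x : SMode d, (((x.2 : ℤ) : ℝ) : ℂ) * sval y x * triGrad E w x‖) := by
          refine (norm_add_le _ _).trans (add_le_add (le_of_eq ?_) ((norm_sub_le _ _).trans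
            (add_le_add le_rfl (le_of_eq ?_))))
          · rw [norm_mul, Complex.norm_I, one_mul]
          · rw [norm_mul, Complex.norm_I, one_mul]
      _ ≤ tri * (K₃ * N⁻¹) * (B * B * B) + (2 * (B * (Cg * B ^ 3)) * (2 ^ (d + 1) * L)
          + 3 * (tri * (K₁ * L) * (2 * Cg * B ^ 2 * B * B))) := by
          refine add_le_add hcb (add_le_add (h3b.trans ?_) h4b)
          exact le_mul_of_one_le_right (by positivity) hL1
      _ = tri * K₃ * (N⁻¹ * B ^ 3) + C₄ * (L * B ^ 4) := by rw [hC₄]; ring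
      _ ≤ _ := by
          have e1 : 0 ≤ N⁻¹ * B ^ 3 := by positivity
          have e2 : 0 ≤ L * B ^ 4 := by positivity
          have e3 : 0 ≤ (K₁ + C₄) * (N⁻¹ * B ^ 3) := by positivity
          have e4 : 0 ≤ (K₁ + tri * K₃) * (L * B ^ 4) := by positivity
          linarith

end QHD

end

theorem proposition4p3 (d : ℕ) (hd : d = 2 ∨ d = 3) :
    -- the set of non-resonant parameters has full measure, for an exponent depending only on `d`
    (∃ M : ℝ, 0 < M ∧ ∀ κ p : ℝ, 0 < κ → 0 < p →
      ∀ᵐ a ∂(volume.restrict (QHD.cube d)), a ∈ QHD.nonresonantSet d κ p M) ∧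
    -- the modified energy
    (∀ M : ℝ, 0 < M → ∃ s₀ : ℝ, 0 < s₀ ∧
      ∀ (κ m τ : ℝ) (g G : ℝ → ℝ), 0 < κ → 0 < m → 0 < τ →
        ContDiffOn ℝ ∞ g (Set.Ioi 0) → g m = 0 → 0 < deriv g m →
        (∀ x : ℝ, 0 < x → HasDerivAt G (g x) x) →
      ∀ a ∈ QHD.nonresonantSet d κ (m * deriv g m) M,
      ∀ s : ℝ, s₀ ≤ s →
      ∃ C c : ℝ, 0 < C ∧ 0 < c ∧ ∀ N : ℝ, 1 < N →
      ∃ E : QHD.TrilinearHamiltonian d,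
        (∀ (σ : Fin 3 → ℤˣ) (j : Fin 3 → QHD.Mode d),
          ‖E.coeff σ j‖ ≤ C * (N ^ (d - 2) * log (1 + N) ^ (d + 1)
            * QHD.mu3 j ^ (M + 1) * QHD.mu1 j ^ (2 * s))) ∧
        ∀ w : QHD.Seq d, QHD.MemHs s w →
          QHD.hsNorm s w ≤ c / log (1 + N) ^ (d + 1) →
          Summable (E.term w) ∧
          ∃ P : ℂ,
            QHD.HasPoissonBracketAt
              (fun v => (QHD.sobolevEnergy s v : ℂ) + E.eval v)
              (fun v => (QHD.hamiltonianW κ m τ g G a v : ℂ)) w P ∧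
            ‖P‖ ≤ C * (N ^ (d - 2) * log (1 + N) ^ (d + 1) * QHD.hsNorm s w ^ 4
              + N⁻¹ * QHD.hsNorm s w ^ 3)) := by
  have hd2 : 2 ≤ d := by omega
  exact ⟨⟨((2 * d + 3 : ℕ) : ℝ), by positivity, fun κ p hκ hp => QHD.ae_mem_nonresonantSet hκ hp⟩,
    fun M hM => ⟨M + d + 2, by positivity, fun κ m τ g G hκ hm hτ hg hgm hg' hG a ha s hs =>
      QHD.exists_modified_energy hd2 hM hκ hm hτ hg hgm hg' hG ha hs⟩⟩
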